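/- **Theorem (resonance of type $(n_1:n_2:0)$ in $\mathbb R^2\times\mathbb C^n$, $n>3$).** Let $n>3$, let $n_1,n_2\ge 1$ be coprime integers and let $\omega_1,\dots,\omega_n$ be nonzero real numbers with $n_1\omega_2-n_2\omega_1=0$ and with $\omega_1,\omega_3,\dots,\omega_n$ linearly independent over $\mathbb Q$. Let $a_0,a_1,\dots,a_n\in\{1,-1\}$. On $\mathbb R^2\times\mathbb C^n$, with coordinates $(x_1,x_2,z_1,\dots,z_n)$, put $$\phi(x_1,x_2,z)=(x_1,-x_2,\bar z_1,\dots,\bar z_n),\qquad \psi(x_1,x_2,z)=(a_0x_1,-a_0x_2,a_1\bar z_1,\dots,a_n\bar z_n).$$ Let $X$ be a $C^\infty$ vector field on $\mathbb R^2\times\mathbb C^n$ with $X(0)=0$, $X\circ\phi=-\phi\circ X$, $X\circ\psi=-\psi\circ X$ and $(dX)_0(x_1,x_2,z)=(x_2,0,-i\omega_1z_1,\dots,-i\omega_nz_n)$. Two smooth vector fields $X,Y$ are called formally conjugate if there is a formal power series map $h(y)=y+(\text{terms of degree}\ge2)$ such that $\hat X(h(y))=Dh(y)\,\hat Y(y)$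 as formal power series, where $\hat X,\hat Y$ are the Taylor series at $0$. Write $w=z_1^{n_2}\bar z_2^{n_1}$, $R=\operatorname{Re}w$, $J=\operatorname{Im}w$, $P=\bar z_1^{n_2-1}z_2^{n_1}$, $Q=z_1^{n_2}\bar z_2^{n_1-1}$. Then $X$ is formally conjugate to a vector field of one of the following types, for some $C^\infty$ real functions $f_i$ (of the listed variables): *Type A*, $f_i=f_i(x_1,|z_1|^2,|z_2|^2,R,|z_3|^2,\dots,|z_n|^2)$, $0\le i\le 2n+5$: $$\begin{aligned}\dot x_1&=x_2+x_1Jf_0,\qquad \dot x_2=f_1+x_2Jf_0,\\ \dot z_1&=-i\omega_1z_1+iz_1f_2+iPf_3+z_1Jf_4+PJf_5,\\ \dot z_2&=-i\omega_2z_2+iz_2f_6+iQf_7+z_2Jf_8+QJf_9,\\ \dot z_j&=-i\omega_jz_j+iz_jf_{2j+4}+z_jJf_{2j+5}\quad(3\le j\le n).\end{aligned}$$ *Type B*, $f_i=f_i(x_1,|z_1|^2,|z_2|^2,R^2,|z_3|^2,\dots,|z_n|^2)$, $0\le i\le 2n+5$: $$\begin{aligned}\dot x_1&=x_2+x_1RJf_0,\qquad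 \dot x_2=f_1+x_2RJf_0,\\ \dot z_1&=-i\omega_1z_1+iz_1f_2+PJf_3+iPRf_4+z_1RJf_5,\\ \dot z_2&=-i\omega_2z_2+iz_2f_6+QJf_7+iQRf_8+z_2RJf_9,\\ \dot z_j&=-i\omega_jz_j+iz_jf_{2j+4}+z_jRJf_{2j+5}\quad(3\le j\le n).\end{aligned}$$ *Type C*, $f_i=f_i(x_1^2,|z_1|^2,|z_2|^2,R,|z_3|^2,\dots,|z_n|^2)$, $0\le i\le 2n+5$: as Type A, with $\dot x_2=x_1f_1+x_2Jf_0$ in place of the second equation. *Type D*, $f_i=f_i(x_1^2,|z_1|^2,|z_2|^2,R^2,x_1R,|z_3|^2,\dots,|z_n|^2)$, $0\le i\le 3n+9$: $$\begin{aligned}\dot x_1&=x_2+x_1^2Jf_0+x_1RJf_1,\qquad \dot x_2=x_1f_2+x_1x_2Jf_0+Rf_3+x_2RJf_1,\\ \dot z_1&=-i\omega_1z_1+iz_1f_4+PJf_5+ix_1Pf_6+x_1z_1Jf_7+iPRf_8+z_1RJf_9,\\ \dot z_2&=-i\omega_2z_2+iz_2f_{10}+QJf_{11}+ix_1Qf_{12}+x_1z_2Jf_{13}+iQRf_{14}+z_2RJf_{15},\\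 \dot z_j&=-i\omega_jz_j+iz_jf_{3j+7}+x_1z_jJf_{3j+8}+z_jRJf_{3j+9}\quad(3\le j\le n).\end{aligned}$$ The type is determined as follows. Consider the condition that one of these holds: $a_1=a_2=1$; or $a_1=a_2=-1$ and $n_1+n_2$ is even; or $a_1=1,\ a_2=-1$ and $n_1$ is even; or $a_1=-1,\ a_2=1$ and $n_2$ is even. If $a_0=1$, the type is A when the condition holds and B otherwise; if $a_0=-1$, the type is C when the condition holds and D otherwise. -/

import Mathlib

open scoped ComplexConjugate Nat

noncomputable section

namespace Bireversible

/-! ### Formal conjugacy of smooth vector fields at the origin -/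

section Formal

variable {E : Type*} [NormedAddCommGroup E] [NormedSpace ℝ E]

/-- The Taylor series at the origin: the term of degree `k` is `D^k X(0) / k!`. -/
def taylor (X : E → E) : FormalMultilinearSeries ℝ E E :=
  fun k => ((k ! : ℝ)⁻¹) • iteratedFDeriv ℝ k X 0

/-- The homogeneous part of degree `k` of the formal vector field `Dh(y) · Y(y)`, for formal
series `h` and `Y`: the sum over `i + j = k + 1` of the derivative of `y ↦ h i (y, …, y)`, applied
to `Y j (y, …, y)`. -/
def pushDegree (h Y : FormalMultilinearSeries ℝ E E) (k : ℕ) (y : E) : E :=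
  ∑ ij ∈ Finset.HasAntidiagonal.antidiagonal (k + 1),
    (h ij.1).linearDeriv (fun _ => y) (fun _ => Y ij.2 (fun _ => y))

/-- `X` and `Y` are formally conjugate: a formal change of coordinates `x = h(y)` with
`h = id + (terms of degree ≥ 2)` satisfies `X(h(y)) = Dh(y) · Y(y)` as formal power series, where
`X` and `Y` stand for their Taylor series at the origin. The homogeneous part of degree `k` of a
formal series `p` is `y ↦ p k (y, …, y)`. -/
def FormallyConjugate (X Y : E → E) : Prop :=
  ∃ h : FormalMultilinearSeries ℝ E E,
    (∀ v, h 0 v = 0) ∧ (∀ y : E, h 1 (fun _ => y) = y) ∧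
    ∀ (k : ℕ) (y : E), ((taylor X).comp h) k (fun _ => y) = pushDegree h (taylor Y) k y

end Formal

/-! ### The phase space, the linear part and the reversing involutions

The phase space is `ℝ² × ℂⁿ` with `n = m + 2`; the coordinates `z₁, z₂` are `z 0, z 1`, and
`z₃, …, zₙ` are `z j.succ.succ` for `j : Fin m`. -/

/-- `ℝ² × ℂⁿ` with `n = m + 2`, coordinates `(x₁, x₂, z)`. -/
abbrev PhaseSpace (m : ℕ) : Type := ℝ × ℝ × (Fin (m + 2) → ℂ)

/-- The linear vector field `ẋ₁ = x₂, ẋ₂ = 0, ż_j = -i ω_j z_j`, which is the block matrix with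
blocks `(0 1; 0 0)` and `(0 ω_j; -ω_j 0)` in the real coordinates `z_j = Re z_j + i Im z_j`. -/
def linearPart {m : ℕ} (ω : Fin (m + 2) → ℝ) (p : PhaseSpace m) : PhaseSpace m :=
  (p.2.1, 0, fun j => -Complex.I * (ω j : ℂ) * p.2.2 j)

/-- `φ(x₁, x₂, z) = (x₁, -x₂, z̄)`. -/
def phi {m : ℕ} (p : PhaseSpace m) : PhaseSpace m :=
  (p.1, -p.2.1, fun j => conj (p.2.2 j))

/-- `ψ(x₁, x₂, z) = (a₀ x₁, -a₀ x₂, a₁ z̄₁, …, aₙ z̄ₙ)` with signs `a₀, a₁, …, aₙ`. -/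
def psi {m : ℕ} (a₀ : ℤˣ) (a : Fin (m + 2) → ℤˣ) (p : PhaseSpace m) : PhaseSpace m :=
  (((a₀ : ℤ) : ℝ) * p.1, -((a₀ : ℤ) : ℝ) * p.2.1,
    fun j => ((a j : ℤ) : ℂ) * conj (p.2.2 j))

/-! ### The normal forms -/

/-- The resonant monomial `z₁^{n₂} z̄₂^{n₁}`. -/
def resMon (n₁ n₂ : ℕ) {m : ℕ} (z : Fin (m + 2) → ℂ) : ℂ :=
  z 0 ^ n₂ * conj (z 1) ^ n₁

/-- The monomial `z̄₁^{n₂-1} z₂^{n₁}`. -/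
def resMon₁ (n₁ n₂ : ℕ) {m : ℕ} (z : Fin (m + 2) → ℂ) : ℂ :=
  conj (z 0) ^ (n₂ - 1) * z 1 ^ n₁

/-- The monomial `z₁^{n₂} z̄₂^{n₁-1}`. -/
def resMon₂ (n₁ n₂ : ℕ) {m : ℕ} (z : Fin (m + 2) → ℂ) : ℂ :=
  z 0 ^ n₂ * conj (z 1) ^ (n₁ - 1)

/-- The vector `(|z₃|², …, |zₙ|²)`. -/
def tailSq {m : ℕ} (z : Fin (m + 2) → ℂ) : Fin m → ℝ :=
  fun j => ‖z j.succ.succ‖ ^ 2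

/-- Type A. -/
def normalFormA {m : ℕ} (ω : Fin (m + 2) → ℝ) (n₁ n₂ : ℕ)
    (f : ℕ → (Fin (m + 4) → ℝ) → ℝ) (p : PhaseSpace m) : PhaseSpace m :=
  let x₁ : ℝ := p.1
  let x₂ : ℝ := p.2.1
  let z : Fin (m + 2) → ℂ := p.2.2
  let R : ℝ := (resMon n₁ n₂ z).re
  let J : ℝ := (resMon n₁ n₂ z).im
  let P : ℂ := resMon₁ n₁ n₂ z
  let Q : ℂ := resMon₂ n₁ n₂ z
  let F : ℕ → ℝ := fun i =>
    f i (Matrix.vecCons x₁ (Matrix.vecCons (‖z 0‖ ^ 2) (Matrix.vecCons (‖z 1‖ ^ 2)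
      (Matrix.vecCons R (tailSq z)))))
  (x₂ + x₁ * J * F 0,
   F 1 + x₂ * J * F 0,
   Matrix.vecCons
    (-Complex.I * ω 0 * z 0 + Complex.I * z 0 * F 2 + Complex.I * P * F 3
      + z 0 * J * F 4 + P * J * F 5)
    (Matrix.vecCons
      (-Complex.I * ω 1 * z 1 + Complex.I * z 1 * F 6 + Complex.I * Q * F 7
        + z 1 * J * F 8 + Q * J * F 9)
      (fun j : Fin m =>
        -Complex.I * ω j.succ.succ * z j.succ.succ
          + Complex.I * z j.succ.succ * F (2 * (j : ℕ) + 10)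
          + z j.succ.succ * J * F (2 * (j : ℕ) + 11))))

/-- Type B. -/
def normalFormB {m : ℕ} (ω : Fin (m + 2) → ℝ) (n₁ n₂ : ℕ)
    (f : ℕ → (Fin (m + 4) → ℝ) → ℝ) (p : PhaseSpace m) : PhaseSpace m :=
  let x₁ : ℝ := p.1
  let x₂ : ℝ := p.2.1
  let z : Fin (m + 2) → ℂ := p.2.2
  let R : ℝ := (resMon n₁ n₂ z).re
  let J : ℝ := (resMon n₁ n₂ z).im
  let P : ℂ := resMon₁ n₁ n₂ z
  let Q : ℂ := resMon₂ n₁ n₂ z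
  let F : ℕ → ℝ := fun i =>
    f i (Matrix.vecCons x₁ (Matrix.vecCons (‖z 0‖ ^ 2) (Matrix.vecCons (‖z 1‖ ^ 2)
      (Matrix.vecCons (R ^ 2) (tailSq z)))))
  (x₂ + x₁ * R * J * F 0,
   F 1 + x₂ * R * J * F 0,
   Matrix.vecCons
    (-Complex.I * ω 0 * z 0 + Complex.I * z 0 * F 2 + P * J * F 3
      + Complex.I * P * R * F 4 + z 0 * R * J * F 5)
    (Matrix.vecCons
      (-Complex.I * ω 1 * z 1 + Complex.I * z 1 * F 6 + Q * J * F 7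
        + Complex.I * Q * R * F 8 + z 1 * R * J * F 9)
      (fun j : Fin m =>
        -Complex.I * ω j.succ.succ * z j.succ.succ
          + Complex.I * z j.succ.succ * F (2 * (j : ℕ) + 10)
          + z j.succ.succ * R * J * F (2 * (j : ℕ) + 11))))

/-- Type C. -/
def normalFormC {m : ℕ} (ω : Fin (m + 2) → ℝ) (n₁ n₂ : ℕ)
    (f : ℕ → (Fin (m + 4) → ℝ) → ℝ) (p : PhaseSpace m) : PhaseSpace m :=
  let x₁ : ℝ := p.1
  let x₂ : ℝ := p.2.1
  let z : Fin (m + 2) → ℂ := p.2.2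
  let R : ℝ := (resMon n₁ n₂ z).re
  let J : ℝ := (resMon n₁ n₂ z).im
  let P : ℂ := resMon₁ n₁ n₂ z
  let Q : ℂ := resMon₂ n₁ n₂ z
  let F : ℕ → ℝ := fun i =>
    f i (Matrix.vecCons (x₁ ^ 2) (Matrix.vecCons (‖z 0‖ ^ 2) (Matrix.vecCons (‖z 1‖ ^ 2)
      (Matrix.vecCons R (tailSq z)))))
  (x₂ + x₁ * J * F 0,
   x₁ * F 1 + x₂ * J * F 0,
   Matrix.vecCons
    (-Complex.I * ω 0 * z 0 + Complex.I * z 0 * F 2 + Complex.I * P * F 3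
      + z 0 * J * F 4 + P * J * F 5)
    (Matrix.vecCons
      (-Complex.I * ω 1 * z 1 + Complex.I * z 1 * F 6 + Complex.I * Q * F 7
        + z 1 * J * F 8 + Q * J * F 9)
      (fun j : Fin m =>
        -Complex.I * ω j.succ.succ * z j.succ.succ
          + Complex.I * z j.succ.succ * F (2 * (j : ℕ) + 10)
          + z j.succ.succ * J * F (2 * (j : ℕ) + 11))))

/-- Type D. -/
def normalFormD {m : ℕ} (ω : Fin (m + 2) → ℝ) (n₁ n₂ : ℕ)
    (f : ℕ → (Fin (m + 5) → ℝ) → ℝ) (p : PhaseSpace m) : PhaseSpace m :=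
  let x₁ : ℝ := p.1
  let x₂ : ℝ := p.2.1
  let z : Fin (m + 2) → ℂ := p.2.2
  let R : ℝ := (resMon n₁ n₂ z).re
  let J : ℝ := (resMon n₁ n₂ z).im
  let P : ℂ := resMon₁ n₁ n₂ z
  let Q : ℂ := resMon₂ n₁ n₂ z
  let F : ℕ → ℝ := fun i =>
    f i (Matrix.vecCons (x₁ ^ 2) (Matrix.vecCons (‖z 0‖ ^ 2) (Matrix.vecCons (‖z 1‖ ^ 2)
      (Matrix.vecCons (R ^ 2) (Matrix.vecCons (x₁ * R) (tailSq z))))))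
  (x₂ + x₁ ^ 2 * J * F 0 + x₁ * R * J * F 1,
   x₁ * F 2 + x₁ * x₂ * J * F 0 + R * F 3 + x₂ * R * J * F 1,
   Matrix.vecCons
    (-Complex.I * ω 0 * z 0 + Complex.I * z 0 * F 4 + P * J * F 5 + Complex.I * x₁ * P * F 6
      + x₁ * z 0 * J * F 7 + Complex.I * P * R * F 8 + z 0 * R * J * F 9)
    (Matrix.vecCons
      (-Complex.I * ω 1 * z 1 + Complex.I * z 1 * F 10 + Q * J * F 11 + Complex.I * x₁ * Q * F 12
        + x₁ * z 1 * J * F 13 + Complex.I * Q * R * F 14 + z 1 * R * J * F 15)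
      (fun j : Fin m =>
        -Complex.I * ω j.succ.succ * z j.succ.succ
          + Complex.I * z j.succ.succ * F (3 * (j : ℕ) + 16)
          + x₁ * z j.succ.succ * J * F (3 * (j : ℕ) + 17)
          + z j.succ.succ * R * J * F (3 * (j : ℕ) + 18))))

/-- The four types of normal form. -/
inductive NFType
  | A
  | B
  | C
  | D

/-- The table of types, in terms of the signs `a₀, a₁, a₂` and the parities of `n₁`, `n₂` and
`n₁ + n₂`. -/
def tableType (a₀ a₁ a₂ : ℤˣ) (n₁ n₂ : ℕ) : NFType :=
  if a₀ = 1 then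
    if a₁ = 1 ∧ a₂ = 1 then NFType.A
    else if a₁ = -1 ∧ a₂ = -1 then (if Even (n₁ + n₂) then NFType.A else NFType.B)
    else if a₁ = 1 ∧ a₂ = -1 then (if Even n₁ then NFType.A else NFType.B)
    else (if Even n₂ then NFType.A else NFType.B)
  else
    if a₁ = 1 ∧ a₂ = 1 then NFType.C
    else if a₁ = -1 ∧ a₂ = -1 then (if Even (n₁ + n₂) then NFType.C else NFType.D)
    else if a₁ = 1 ∧ a₂ = -1 then (if Even n₁ then NFType.C else NFType.D)
    else (if Even n₂ then NFType.C else NFType.D)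

/-- `Y` is a normal form of the given type, with smooth coefficient functions `f i`. Only the
indices `i ≤ 2n + 5` (types A, B, C) or `i ≤ 3n + 9` (type D) occur in the formulas. -/
def IsNormalForm {m : ℕ} (ω : Fin (m + 2) → ℝ) (n₁ n₂ : ℕ) :
    NFType → (PhaseSpace m → PhaseSpace m) → Prop
  | NFType.A, Y => ∃ f : ℕ → (Fin (m + 4) → ℝ) → ℝ,
      (∀ i, ContDiff ℝ (⊤ : ℕ∞) (f i)) ∧ Y = normalFormA ω n₁ n₂ f
  | NFType.B, Y => ∃ f : ℕ → (Fin (m + 4) → ℝ) → ℝ,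
      (∀ i, ContDiff ℝ (⊤ : ℕ∞) (f i)) ∧ Y = normalFormB ω n₁ n₂ f
  | NFType.C, Y => ∃ f : ℕ → (Fin (m + 4) → ℝ) → ℝ,
      (∀ i, ContDiff ℝ (⊤ : ℕ∞) (f i)) ∧ Y = normalFormC ω n₁ n₂ f
  | NFType.D, Y => ∃ f : ℕ → (Fin (m + 5) → ℝ) → ℝ,
      (∀ i, ContDiff ℝ (⊤ : ℕ∞) (f i)) ∧ Y = normalFormD ω n₁ n₂ f

end Bireversible

end

/-! The normal form is built degree by degree. Let L be the linear part. Once a conjugacy is fixed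
below degree k, its degree k part h and the degree k part N of the normal form must satisfy the
homological equation V = Dh·L − L∘h + N, where V depends only on lower degrees (`substPart_eq`,
`pushPart_eq`). It therefore suffices to reduce every homogeneous V modulo the range of the
homological operator (`exists_formal_normal_form`).

Homogeneous smooth maps are polynomials, by Euler's identity. On the monomial x₁ᵃ x₂ᵇ z^α z̄^β the
derivative along L is a scalar plus the nilpotent operator x₂ ∂/∂x₁ (`lieD_mon`). In the
z-components, the range contains every nonresonant monomial and every resonant one divisible by x₂.
In the nilpotent block, eliminating h₂ leaves a second order equation for h₁; its obstructions are
the fields g·(x₁∂₁ + x₂∂₂) + e·∂₂ with g, e resonant and free of x₂ (`solve_nilpotent`).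

Both involutions reverse L, so averaging a solution makes h equivariant and N reversible without
disturbing the equation (`homological_average`). The integer vectors orthogonal to ω are the
multiples of (n₂, −n₁, 0, …, 0) (`resonance_int`), so the resonant monomials are products of powers
of x₁, |z_j|² and w or w̄, possibly times z_j, P or Q. Such a function f satisfies f∘φ = f̄ and f∘ψ
= ±f̄; according to its sign, averaging a field with coefficient c·f gives zero or a real multiple
of one definite field. The sign of x₁ is a₀ and that of w is a₁^{n₂} a₂^{n₁}; the four values of
this pair are the four types. The identity w² = 2Rw − |w|² then reduces powers of w to powers of R
times 1 or w (`map_pow_mem`).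

Finally, the coefficients found in all degrees are assembled into formal series in the invariants,
and Borel's lemma in the space of invariants gives smooth f_i (`exists_realization`). -/

noncomputable section

namespace Bireversible

/-! ### Homogeneous maps and diagonal Taylor coefficients -/

section Homogeneous

variable {E F G : Type*} [NormedAddCommGroup E] [NormedSpace ℝ E]
  [NormedAddCommGroup F] [NormedSpace ℝ F] [NormedAddCommGroup G] [NormedSpace ℝ G]

/-- Smooth maps which are homogeneous of degree `k`, that is, homogeneous polynomial maps. -/
structure IsHomog (k : ℕ) (f : E → F) : Prop where
  contDiff : ContDiff ℝ (⊤ : ℕ∞) f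
  hom : ∀ (t : ℝ) (y : E), f (t • y) = t ^ k • f y

/-- The homogeneous part of degree `k` of the Taylor series at the origin. -/
def diagTaylor (k : ℕ) (f : E → F) (y : E) : F :=
  ((k ! : ℝ)⁻¹) • iteratedFDeriv ℝ k f 0 (fun _ => y)

/-- Restriction to lines turns questions about diagonal Taylor parts into one-variable calculus. -/
lemma iteratedDeriv_line {f : E → F} (hf : ContDiff ℝ (⊤ : ℕ∞) f) (k : ℕ) (y : E) :
    iteratedDeriv k (fun t : ℝ => f (t • y)) 0 = iteratedFDeriv ℝ k f 0 (fun _ => y) := by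
  have h := (ContinuousLinearMap.toSpanSingleton ℝ y).iteratedFDeriv_comp_right hf (0 : ℝ)
    (i := k) (by exact_mod_cast le_top)
  have h2 : (f ∘ (ContinuousLinearMap.toSpanSingleton ℝ y)) = fun t : ℝ => f (t • y) := by
    ext t; simp
  rw [h2] at h
  rw [iteratedDeriv_eq_iteratedFDeriv, h]
  simp

lemma diagTaylor_eq_line {f : E → F} (hf : ContDiff ℝ (⊤ : ℕ∞) f) (k : ℕ) (y : E) :
    diagTaylor k f y = ((k ! : ℝ)⁻¹) • iteratedDeriv k (fun t : ℝ => f (t • y)) 0 := by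
  rw [iteratedDeriv_line hf, diagTaylor]

lemma diagTaylor_zero (f : E → F) (y : E) : diagTaylor 0 f y = f 0 := by
  simp [diagTaylor]

lemma diagTaylor_one (f : E → F) (y : E) : diagTaylor 1 f y = fderiv ℝ f 0 y := by
  simp [diagTaylor]

lemma diagTaylor_add {f g : E → F} (hf : ContDiff ℝ (⊤ : ℕ∞) f) (hg : ContDiff ℝ (⊤ : ℕ∞) g) (k : ℕ) (y : E) :
    diagTaylor k (fun x => f x + g x) y = diagTaylor k f y + diagTaylor k g y := by
  have hk : ((k : ℕ) : WithTop ℕ∞) ≤ (⊤ : ℕ∞) := by exact_mod_cast le_top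
  have := iteratedFDeriv_add_apply (x := (0 : E)) (hf.contDiffAt.of_le hk) (hg.contDiffAt.of_le hk)
  rw [diagTaylor, diagTaylor, diagTaylor, ← smul_add]
  congr 1
  change iteratedFDeriv ℝ k (f + g) 0 _ = _
  rw [this]; rfl

lemma diagTaylor_const_smul {f : E → F} (hf : ContDiff ℝ (⊤ : ℕ∞) f) (c : ℝ) (k : ℕ) (y : E) :
    diagTaylor k (fun x => c • f x) y = c • diagTaylor k f y := by
  have hk : ((k : ℕ) : WithTop ℕ∞) ≤ (⊤ : ℕ∞) := by exact_mod_cast le_top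
  have := iteratedFDeriv_const_smul_apply (x := (0 : E)) (a := c) (hf.contDiffAt.of_le hk)
  rw [diagTaylor, diagTaylor, smul_comm c]
  congr 1
  change iteratedFDeriv ℝ k (c • f) 0 _ = _
  rw [this]; rfl

lemma diagTaylor_sum {ι : Type*} (s : Finset ι) {f : ι → E → F} (hf : ∀ i ∈ s, ContDiff ℝ (⊤ : ℕ∞) (f i))
    (k : ℕ) (y : E) :
    diagTaylor k (fun x => ∑ i ∈ s, f i x) y = ∑ i ∈ s, diagTaylor k (f i) y := by
  classical
  induction s using Finset.induction_on with
  | empty =>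
    have := diagTaylor_const_smul (E := E) (F := F) (f := fun _ => 0) contDiff_const 0 k y
    simpa using this
  | insert a s ha ih =>
    simp only [Finset.sum_insert ha]
    rw [diagTaylor_add (hf a (by simp)) (ContDiff.sum fun i hi => hf i (by simp [hi])),
      ih fun i hi => hf i (by simp [hi])]

lemma IsHomog.diagTaylor_eq {k : ℕ} {f : E → F} (hf : IsHomog k f) (j : ℕ) (y : E) :
    diagTaylor j f y = if j = k then f y else 0 := by
  rw [diagTaylor_eq_line hf.contDiff]
  simp only [hf.hom]
  have h1 : iteratedDeriv j (fun t : ℝ => t ^ k • f y) 0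
      = (iteratedDeriv j (fun t : ℝ => t ^ k) 0) • f y := by
    have hc : ContDiffAt ℝ j (fun t : ℝ => t ^ k) 0 := by fun_prop
    have := (ContinuousLinearMap.toSpanSingleton ℝ (f y)).iteratedFDeriv_comp_left hc le_rfl
    rw [iteratedDeriv_eq_iteratedFDeriv, iteratedDeriv_eq_iteratedFDeriv]
    have h2 : (ContinuousLinearMap.toSpanSingleton ℝ (f y)) ∘ (fun t : ℝ => t ^ k)
        = fun t : ℝ => t ^ k • f y := by ext t; simp
    rw [h2] at this
    rw [this]
    simp
  rw [h1, iteratedDeriv_fun_pow_zero]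
  split_ifs with h
  · subst h
    rw [smul_smul, inv_mul_cancel₀ (by positivity), one_smul]
  · simp

lemma eq_zero_of_pow_smul_isLittleO {c : F} {k : ℕ}
    (h : (fun t : ℝ => t ^ k • c) =o[nhds 0] fun t : ℝ => t ^ k) : c = 0 := by
  by_contra hc
  have h1 := h.def (c := ‖c‖ / 2) (by positivity)
  have h2 : ∀ᶠ t : ℝ in nhdsWithin 0 {0}ᶜ, False := by
    filter_upwards [nhdsWithin_le_nhds h1, self_mem_nhdsWithin] with t ht ht0
    rw [norm_smul] at ht
    have : 0 < ‖t ^ k‖ := by simpa using pow_pos (abs_pos.2 ht0) k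
    have hc' : 0 < ‖c‖ := by simpa using hc
    nlinarith
  simp at h2
  exact (NormedField.nhdsNE_neBot (0 : ℝ)).ne h2

/-- Strong induction on j: once the lower derivatives vanish, the Taylor polynomial of order j is
its top term alone. Taylor's theorem makes that term o(t^j), which forces its coefficient to be
zero. -/
lemma iteratedDeriv_eq_zero_of_isLittleO {g : ℝ → F} (hg : ContDiff ℝ (⊤ : ℕ∞) g) {k : ℕ}
    (h : g =o[nhds 0] fun t : ℝ => t ^ k) {j : ℕ} (hj : j ≤ k) : iteratedDeriv j g 0 = 0 := by
  induction j using Nat.strong_induction_on with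
  | _ j ih =>
    have h1 := taylor_isLittleO_univ (x₀ := 0) (n := j) (hg.of_le (by exact_mod_cast le_top))
    have h2 : g =o[nhds 0] fun t : ℝ => t ^ j := by
      refine h.trans_isBigO ?_
      refine Asymptotics.IsBigO.of_bound 1 ?_
      filter_upwards [Metric.ball_mem_nhds (0 : ℝ) one_pos] with t ht
      have : |t| ≤ 1 := by simpa using (mem_ball_zero_iff.1 ht).le
      simpa using pow_le_pow_of_le_one (abs_nonneg t) this hj
    simp only [sub_zero] at h1
    have h3 := h2.sub h1
    simp only [sub_sub_cancel] at h3
    have h4 : ∀ t, taylorWithinEval g j Set.univ 0 t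
        = t ^ j • (((j ! : ℝ)⁻¹) • iteratedDeriv j g 0) := by
      intro t
      rw [taylor_within_apply, Finset.sum_range_succ, Finset.sum_eq_zero]
      · simp [iteratedDerivWithin_univ, smul_smul, mul_comm]
      · intro i hi
        rw [iteratedDerivWithin_univ, ih i (Finset.mem_range.1 hi)
          ((Finset.mem_range.1 hi).le.trans hj), smul_zero]
    simp only [h4] at h3
    have h5 := eq_zero_of_pow_smul_isLittleO h3
    exact (smul_eq_zero.1 h5).resolve_left (by positivity)

lemma diagTaylor_eq_zero_of_isBigO {f : E → F} (hf : ContDiff ℝ (⊤ : ℕ∞) f) {k : ℕ}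
    (h : f =O[nhds 0] fun y => ‖y‖ ^ (k + 1)) {j : ℕ} (hj : j ≤ k) (y : E) :
    diagTaylor j f y = 0 := by
  rw [diagTaylor_eq_line hf, iteratedDeriv_eq_zero_of_isLittleO _ _ hj, smul_zero]
  · exact hf.comp (by fun_prop)
  · have ht : Filter.Tendsto (fun t : ℝ => t • y) (nhds 0) (nhds 0) := by
      have : Continuous fun t : ℝ => t • y := by fun_prop
      simpa using this.tendsto 0
    have h1 := h.comp_tendsto ht
    have h2 : ((fun y : E => ‖y‖ ^ (k + 1)) ∘ fun t : ℝ => t • y)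
        =O[nhds 0] fun t : ℝ => t ^ (k + 1) := by
      refine Asymptotics.IsBigO.of_bound (‖y‖ ^ (k + 1)) (Filter.Eventually.of_forall fun t => ?_)
      simp [norm_smul, mul_pow, mul_comm]
    exact (h1.trans h2).trans_isLittleO (Asymptotics.isLittleO_pow_pow (by omega))

/-- Both sides are continuous in t and the nonzero t are dense. This permits cancelling a factor t,
as `IsHomog.fderiv_apply` requires. -/
lemma IsHomog.of_ne_zero {k : ℕ} {f : E → F} (hf : ContDiff ℝ (⊤ : ℕ∞) f)
    (h : ∀ (t : ℝ) (y : E), t ≠ 0 → f (t • y) = t ^ k • f y) : IsHomog k f := by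
  refine ⟨hf, fun t y => ?_⟩
  have hc := hf.continuous
  have := Continuous.ext_on (dense_compl_singleton (0 : ℝ)) (f := fun t : ℝ => f (t • y))
    (g := fun t : ℝ => t ^ k • f y) (by fun_prop) (by fun_prop) fun t ht => h t y ht
  exact congrFun this t

lemma IsHomog.add {k : ℕ} {f g : E → F} (hf : IsHomog k f) (hg : IsHomog k g) :
    IsHomog k fun y => f y + g y :=
  ⟨hf.1.add hg.1, fun t y => by rw [hf.2, hg.2, smul_add]⟩

lemma IsHomog.sub {k : ℕ} {f g : E → F} (hf : IsHomog k f) (hg : IsHomog k g) :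
    IsHomog k fun y => f y - g y :=
  ⟨hf.1.sub hg.1, fun t y => by rw [hf.2, hg.2, smul_sub]⟩

lemma IsHomog.const_smul {k : ℕ} {f : E → F} (hf : IsHomog k f) (c : ℝ) :
    IsHomog k fun y => c • f y :=
  ⟨contDiff_const.smul hf.1, fun t y => by rw [hf.2, smul_comm]⟩

lemma IsHomog.sum {ι : Type*} (s : Finset ι) {k : ℕ} {f : ι → E → F}
    (hf : ∀ i ∈ s, IsHomog k (f i)) : IsHomog k fun y => ∑ i ∈ s, f i y :=
  ⟨ContDiff.sum fun i hi => (hf i hi).1, fun t y => by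
    rw [Finset.smul_sum]; exact Finset.sum_congr rfl fun i hi => (hf i hi).2 t y⟩

lemma IsHomog.clm_comp {k : ℕ} {f : E → F} (hf : IsHomog k f) (L : F →L[ℝ] G) :
    IsHomog k fun y => L (f y) :=
  ⟨L.contDiff.comp hf.1, fun t y => by rw [hf.2, map_smul]⟩

lemma IsHomog.comp_clm {k : ℕ} {f : F → G} (hf : IsHomog k f) (L : E →L[ℝ] F) :
    IsHomog k fun y => f (L y) :=
  ⟨hf.1.comp L.contDiff, fun t y => by rw [map_smul, hf.2]⟩

lemma IsHomog.smul {k l : ℕ} {f : E → ℝ} {g : E → F} (hf : IsHomog k f) (hg : IsHomog l g) :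
    IsHomog (k + l) fun y => f y • g y :=
  ⟨hf.1.smul hg.1, fun t y => by
    rw [hf.2, hg.2, smul_eq_mul, smul_smul, smul_smul, pow_add]; congr 1; ring⟩

lemma IsHomog.contDiff_fderiv_apply {f : E → F} {g : E → E} (hf : ContDiff ℝ (⊤ : ℕ∞) f)
    (hg : ContDiff ℝ (⊤ : ℕ∞) g) : ContDiff ℝ (⊤ : ℕ∞) fun y => fderiv ℝ f y (g y) :=
  (hf.fderiv_right (m := (⊤ : ℕ∞)) (by simp)).clm_apply hg

lemma IsHomog.smul_fderiv {k : ℕ} {f : E → F} (hf : IsHomog k f) (t : ℝ) (y v : E) :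
    t • fderiv ℝ f (t • y) v = t ^ k • fderiv ℝ f y v := by
  have hd : Differentiable ℝ f := hf.1.differentiable (by simp)
  have h1 : HasFDerivAt (fun y => f (t • y)) ((fderiv ℝ f (t • y)).comp
      (t • ContinuousLinearMap.id ℝ E)) y :=
    (hd (t • y)).hasFDerivAt.comp y ((hasFDerivAt_id y).const_smul t)
  have h2 : HasFDerivAt (fun y => f (t • y)) (t ^ k • fderiv ℝ f y) y := by
    simp only [hf.hom]
    exact (hd y).hasFDerivAt.const_smul (t ^ k)
  have := congrArg (fun L : E →L[ℝ] F => L v) (h1.unique h2)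
  simpa using this

lemma IsHomog.fderiv_apply {k l m : ℕ} {f : E → F} {g : E → E} (hf : IsHomog k f)
    (hg : IsHomog l g) (h : k + l = m + 1) : IsHomog m fun y => fderiv ℝ f y (g y) := by
  refine IsHomog.of_ne_zero (contDiff_fderiv_apply hf.1 hg.1) fun t y ht => ?_
  have h1 := hf.smul_fderiv t y (g (t • y))
  rw [hg.2, map_smul, map_smul, smul_smul, smul_smul, ← pow_add, h] at h1
  rw [hg.2, map_smul]
  apply smul_right_injective F ht
  simp only
  rw [smul_smul, h1, pow_succ', smul_smul]

end Homogeneous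

/-! ### Borel's lemma -/

section Borel

variable {E F : Type*} [NormedAddCommGroup E] [NormedSpace ℝ E]
  [NormedAddCommGroup F] [NormedSpace ℝ F]

lemma IsHomog.exists_norm_le {k : ℕ} {f : E → F} (hf : IsHomog k f) :
    ∃ B : ℝ, 0 ≤ B ∧ ∀ y, ‖f y‖ ≤ B * ‖y‖ ^ k := by
  refine ⟨‖(k ! : ℝ)⁻¹‖ * ‖iteratedFDeriv ℝ k f 0‖, by positivity, fun y => ?_⟩
  have h := hf.diagTaylor_eq k y
  rw [if_pos rfl] at h
  rw [← h, diagTaylor, norm_smul, mul_assoc]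
  gcongr
  simpa using (iteratedFDeriv ℝ k f 0).le_opNorm fun _ => y

/-- By homogeneity of p the function is f(l·)·p, but in rescaled form its derivative of order j is
l^(j−r) times that of f·p at l·x. For j < r this factor is at most 1/l, so a large l makes all
derivatives below order r small. The last bound keeps a factor ‖x‖^j, which controls tails of the
Borel series near the origin. -/
lemma exists_borel_scale [FiniteDimensional ℝ E] (f : ContDiffBump (0 : E)) (hf : f.rOut ≤ 2) {r : ℕ} {p : E → F}
    (hp : IsHomog r p) :
    ∃ l : ℝ, 1 ≤ l ∧
      (∀ j, ∃ C, ∀ x, ‖iteratedFDeriv ℝ j (fun y => (l ^ r)⁻¹ • f (l • y) • p (l • y)) x‖ ≤ C) ∧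
      (∀ j < r, ∀ x, ‖iteratedFDeriv ℝ j (fun y => (l ^ r)⁻¹ • f (l • y) • p (l • y)) x‖
        ≤ (1 / 2) ^ r) ∧
      ∀ j < r, ∀ x, ‖(l ^ r)⁻¹ • f (l • x) • p (l • x)‖ ≤ (1 / 2) ^ r * ‖x‖ ^ j := by
  set g : E → F := fun y => f y • p y with hg
  have hgs : ContDiff ℝ (⊤ : ℕ∞) g := f.contDiff.smul hp.1
  have hgc : HasCompactSupport g := f.hasCompactSupport.smul_right
  have hC : ∀ j, ∃ C, ∀ x, ‖iteratedFDeriv ℝ j g x‖ ≤ C := fun j =>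
    (hgs.continuous_iteratedFDeriv (by exact_mod_cast le_top)).bounded_above_of_compact_support
      (hgc.iteratedFDeriv j)
  choose C hC using hC
  obtain ⟨B, hB0, hB⟩ := hp.exists_norm_le
  -- The cutoff vanishes outside ‖u‖ ≤ 2; inside, ‖p u‖ ≤ B‖u‖^r ≤ B·2^(r−j)·‖u‖^j.
  have hgB : ∀ j ≤ r, ∀ u, ‖g u‖ ≤ B * 2 ^ r * ‖u‖ ^ j := by
    intro j hj u
    by_cases hu : ‖u‖ ≤ 2
    · have h1 : ‖g u‖ ≤ ‖p u‖ := by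
        rw [hg]; simp only [norm_smul]
        have : ‖f u‖ ≤ 1 := by
          rw [Real.norm_of_nonneg f.nonneg]; exact f.le_one
        nlinarith [norm_nonneg (p u)]
      refine h1.trans ((hB u).trans ?_)
      rw [mul_assoc]
      gcongr
      calc ‖u‖ ^ r = ‖u‖ ^ (r - j) * ‖u‖ ^ j := by rw [← pow_add]; congr 1; omega
        _ ≤ 2 ^ (r - j) * ‖u‖ ^ j := by gcongr
        _ ≤ 2 ^ r * ‖u‖ ^ j := by gcongr <;> norm_num
    · have : f u = 0 := f.zero_of_le_dist (by rw [dist_zero_right]; linarith)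
      rw [hg]; simp only [this, zero_smul, norm_zero]; positivity
  obtain ⟨D, hD⟩ := Finset.exists_le ((Finset.range r).image C)
  -- The two entries of the inner maximum serve the derivative bound and the value bound: after
  -- division by l each becomes at most (1/2)^r.
  set l : ℝ := max 1 (2 ^ r * max D (B * 2 ^ r)) with hl
  have hl1 : 1 ≤ l := le_max_left _ _
  have hl0 : 0 < l := by linarith
  have hlD : 2 ^ r * D ≤ l := le_trans (by gcongr; exact le_max_left _ _) (le_max_right _ _)
  have hlB : 2 ^ r * (B * 2 ^ r) ≤ l :=
    le_trans (by gcongr; exact le_max_right _ _) (le_max_right _ _)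
  have hinv : ∀ j < r, (l ^ r)⁻¹ * l ^ j ≤ l⁻¹ := by
    intro j hj
    rw [inv_mul_le_iff₀ (by positivity)]
    calc l ^ j ≤ l ^ (r - 1) := pow_le_pow_right₀ hl1 (by omega)
      _ = l ^ r * l⁻¹ := by
        rw [eq_mul_inv_iff_mul_eq₀ hl0.ne', ← pow_succ]; congr 1; omega
  have hit : ∀ j x, iteratedFDeriv ℝ j (fun y => (l ^ r)⁻¹ • f (l • y) • p (l • y)) x
      = (l ^ r)⁻¹ • l ^ j • iteratedFDeriv ℝ j g (l • x) := by
    intro j x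
    have hj : ((j : ℕ) : WithTop ℕ∞) ≤ (⊤ : ℕ∞) := by exact_mod_cast le_top
    have h1 := iteratedFDeriv_const_smul_apply (x := x) (a := (l ^ r)⁻¹) (i := j)
      (f := fun y => g (l • y))
      ((hgs.comp (contDiff_const_smul l)).contDiffAt.of_le hj)
    have h2 := congrFun (iteratedFDeriv_comp_const_smul (i := j) l (hgs.of_le hj)) x
    change iteratedFDeriv ℝ j ((l ^ r)⁻¹ • fun y => g (l • y)) x = _
    rw [h1, h2]
  refine ⟨l, hl1, fun j => ⟨(l ^ r)⁻¹ * (l ^ j * C j), fun x => ?_⟩, fun j hj x => ?_,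
    fun j hj x => ?_⟩
  · rw [hit, norm_smul, norm_smul, Real.norm_of_nonneg (by positivity),
      Real.norm_of_nonneg (by positivity)]
    gcongr
    exact hC j _
  · rw [hit, norm_smul, norm_smul, Real.norm_of_nonneg (by positivity),
      Real.norm_of_nonneg (by positivity), ← mul_assoc]
    have hCD : C j ≤ D := hD _ (Finset.mem_image_of_mem _ (Finset.mem_range.2 hj))
    calc (l ^ r)⁻¹ * l ^ j * ‖iteratedFDeriv ℝ j g (l • x)‖ ≤ l⁻¹ * D := by
          gcongr
          · exact hinv j hj
          · exact (hC j _).trans hCD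
      _ ≤ (1 / 2) ^ r := by
          rw [inv_mul_le_iff₀ hl0, one_div, inv_pow, ← div_eq_mul_inv, le_div_iff₀ (by positivity)]
          linarith
  · rw [norm_smul, Real.norm_of_nonneg (by positivity)]
    calc (l ^ r)⁻¹ * ‖g (l • x)‖ ≤ (l ^ r)⁻¹ * (B * 2 ^ r * ‖l • x‖ ^ j) := by
          gcongr; exact hgB j hj.le _
      _ = (l ^ r)⁻¹ * l ^ j * (B * 2 ^ r) * ‖x‖ ^ j := by
          rw [norm_smul, Real.norm_of_nonneg hl0.le, mul_pow]; ring
      _ ≤ l⁻¹ * (B * 2 ^ r) * ‖x‖ ^ j := by gcongr; exact hinv j hj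
      _ ≤ (1 / 2) ^ r * ‖x‖ ^ j := by
          gcongr
          rw [inv_mul_le_iff₀ hl0, one_div, inv_pow, ← div_eq_mul_inv, le_div_iff₀ (by positivity)]
          linarith

/-- **Borel's lemma**: every formal power series is the Taylor series of a smooth function. -/
theorem exists_contDiff_of_isHomog [FiniteDimensional ℝ E] [CompleteSpace F] {p : ℕ → E → F} (hp : ∀ r, IsHomog r (p r)) :
    ∃ f : E → F, ContDiff ℝ (⊤ : ℕ∞) f ∧
      ∀ K, (fun y => f y - ∑ r ∈ Finset.range (K + 1), p r y) =O[nhds 0] fun y => ‖y‖ ^ (K + 1) := by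
  let χ : ContDiffBump (0 : E) := ⟨1, 2, one_pos, one_lt_two⟩
  choose l hl1 hC hder hval using fun r => exists_borel_scale χ le_rfl (hp r)
  set T : ℕ → E → F := fun r y => (l r ^ r)⁻¹ • χ (l r • y) • p r (l r • y) with hT
  have hTs : ∀ r, ContDiff ℝ (⊤ : ℕ∞) (T r) := fun r =>
    contDiff_const.smul ((χ.contDiff.comp (contDiff_const_smul _)).smul
      ((hp r).1.comp (contDiff_const_smul _)))
  have hgeom : Summable fun r : ℕ => (1 / 2 : ℝ) ^ r := summable_geometric_two
  have hsum : ∀ y, Summable fun r => T r y := by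
    intro y
    refine Summable.of_norm_bounded_eventually_nat hgeom ?_
    filter_upwards [Filter.eventually_gt_atTop 0] with r hr
    simpa using hval r 0 hr y
  refine ⟨fun y => ∑' r, T r y, ?_, fun K => ?_⟩
  · refine contDiff_tsum_of_eventually (v := fun _ r => (1 / 2 : ℝ) ^ r) hTs
      (fun _ _ => hgeom) fun k _ => ?_
    rw [Nat.cofinite_eq_atTop]
    filter_upwards [Filter.eventually_gt_atTop k] with r hr
    exact hder r k hr
  -- The estimate by ‖y‖^(K+1) is available only for r > K+1. The term r = K+1 is therefore grouped
  -- with the finitely many terms whose cutoff is 1 near the origin, and is itself O(‖y‖^(K+1)) by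
  -- homogeneity.
  · have hnear : ∀ᶠ y in nhds (0 : E), ∀ r ∈ Finset.range (K + 2), T r y = p r y := by
      rw [Filter.eventually_all_finset]
      intro r _
      have hl0 : 0 < l r := by linarith [hl1 r]
      have h1 : ∀ᶠ y in nhds (0 : E), χ (l r • y) = 1 := by
        have : Filter.Tendsto (fun y : E => l r • y) (nhds 0) (nhds 0) := by
          have : Continuous fun y : E => l r • y := by fun_prop
          simpa using this.tendsto 0
        exact this.eventually χ.eventuallyEq_one
      filter_upwards [h1] with y hy
      simp only [hT, hy, one_smul, (hp r).hom]
      rw [smul_smul, inv_mul_cancel₀ (by positivity), one_smul]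
    have hK : (p (K + 1)) =O[nhds 0] fun y => ‖y‖ ^ (K + 1) := by
      obtain ⟨B, -, hB⟩ := (hp (K + 1)).exists_norm_le
      exact Asymptotics.IsBigO.of_bound B (Filter.Eventually.of_forall fun y => by
        simpa using hB y)
    have htail : (fun y => ∑' r, T (r + (K + 2)) y) =O[nhds 0] fun y => ‖y‖ ^ (K + 1) := by
      refine Asymptotics.IsBigO.of_bound (∑' r : ℕ, (1 / 2 : ℝ) ^ (r + (K + 2)))
        (Filter.Eventually.of_forall fun y => ?_)
      have hs := (summable_nat_add_iff (K + 2)).2 hgeom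
      rw [norm_pow, norm_norm, ← tsum_mul_right]
      refine tsum_of_norm_bounded (hs.mul_right _).hasSum fun r => ?_
      exact hval _ (K + 1) (by omega) y
    refine (hK.add htail).congr' ?_ Filter.EventuallyEq.rfl
    filter_upwards [hnear] with y hy
    rw [← (hsum y).sum_add_tsum_nat_add (K + 2), Finset.sum_congr rfl hy,
      Finset.sum_range_succ _ (K + 1)]
    abel

end Borel

/-! ### Degree by degree construction of the formal normal form -/

section Recursion

/-- A sequence built by choosing, at each step, a term satisfying a property which depends on the
previous terms. -/
def recSeq {α : Type*} [Inhabited α] (P : ℕ → (ℕ → α) → α → Prop) (k : ℕ) : α :=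
  open Classical in
  let u : ℕ → α := fun j => if _ : j < k then recSeq P j else default
  if h : ∃ a, P k u a then h.choose else default

/-- Dependent choice in which each step sees the whole past. Since P reads only entries below k, by
`hloc`, a step may be run on a sequence that takes the default value from k on. -/
lemma exists_seq_of_step {α : Type*} [Inhabited α] (P : ℕ → (ℕ → α) → α → Prop)
    (hloc : ∀ k u v a, (∀ j < k, u j = v j) → P k u a → P k v a)
    (step : ∀ k u, (∀ j < k, P j u (u j)) → ∃ a, P k u a) :
    ∃ u : ℕ → α, ∀ k, P k u (u k) := by
  refine ⟨recSeq P, fun k => ?_⟩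
  induction k using Nat.strong_induction_on with
  | _ k ih =>
    set u : ℕ → α := fun j => if _ : j < k then recSeq P j else default with hu
    have huj : ∀ j < k, recSeq P j = u j := fun j hj => by simp [hu, hj]
    have hex : ∃ a, P k u a := step k u fun j hj => by
      rw [← huj j hj]
      exact hloc j _ _ _ (fun i hi => huj i (hi.trans hj)) (ih j hj)
    have hk : recSeq P k = hex.choose := by
      rw [recSeq]; exact dif_pos hex
    rw [hk]
    exact hloc k _ _ _ (fun j hj => (huj j hj).symm) hex.choose_spec

/-- The terms of degree less than `k`. -/
def truncSeq {E : Type*} [Zero E] (k : ℕ) (H : ℕ → E → E) (j : ℕ) : E → E := if j < k then H j else 0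

lemma truncSeq_of_lt {E : Type*} [Zero E] {k j : ℕ} (h : j < k) (H : ℕ → E → E) :
    truncSeq k H j = H j := if_pos h

lemma truncSeq_of_le {E : Type*} [Zero E] {k j : ℕ} (h : k ≤ j) (H : ℕ → E → E) :
    truncSeq k H j = 0 := if_neg (by omega)

variable {E : Type*} [NormedAddCommGroup E] [NormedSpace ℝ E]

/-- The homogeneous part of degree `k` of `X ∘ H`, where `H j` is the part of degree `j` of `H`. -/
def substPart (X : E → E) (k : ℕ) (H : ℕ → E → E) (y : E) : E :=
  ∑ c : Composition k, taylor X c.length fun i => H (c.blocksFun i) y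

/-- The homogeneous part of degree `k` of `DH · N`, where `H j` and `N j` are the parts of degree
`j` of `H` and `N`. -/
def pushPart (k : ℕ) (H N : ℕ → E → E) (y : E) : E :=
  ∑ ij ∈ Finset.HasAntidiagonal.antidiagonal (k + 1), fderiv ℝ (H ij.1) y (N ij.2 y)

lemma taylor_one_apply (X : E → E) (v : Fin 1 → E) : taylor X 1 v = fderiv ℝ X 0 (v 0) := by
  simp [taylor]

/-- Only the composition with a single block involves H k, and it contributes DX(0)·H k. All other
compositions have blocks smaller than k, hence do not notice the truncation. -/
lemma substPart_eq {X : E → E} {k : ℕ} (hk : 0 < k) (H : ℕ → E → E) (y : E) :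
    substPart X k H y = substPart X k (truncSeq k H) y + fderiv ℝ X 0 (H k y) := by
  classical
  have hsingle : ∀ H : ℕ → E → E, (taylor X (Composition.single k hk).length fun i =>
      H ((Composition.single k hk).blocksFun i) y) = fderiv ℝ X 0 (H k y) := by
    intro H
    rw [← taylor_one_apply X fun _ => H k y]
    refine (taylor X).congr (Composition.single_length hk) fun i _ _ => ?_
    rw [Composition.single_blocksFun]
  unfold substPart
  rw [← Finset.add_sum_erase _ _ (Finset.mem_univ (Composition.single k hk)),
    ← Finset.add_sum_erase _ (fun c : Composition k => taylor X c.length fun i =>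
      truncSeq k H (c.blocksFun i) y) (Finset.mem_univ (Composition.single k hk)),
    hsingle, hsingle, truncSeq_of_le le_rfl, Pi.zero_apply, map_zero, zero_add, add_comm]
  congr 1
  refine Finset.sum_congr rfl fun c hc => ?_
  have hc' := (Composition.ne_single_iff hk).1 (Finset.ne_of_mem_erase hc)
  congr 1
  ext i
  rw [truncSeq_of_lt (hc' i)]

/-- The top degree terms enter through the index pairs (k, 1) and (1, k) alone, distinct because k ≥
2. The pairs containing 0 vanish since H 0 = N 0 = 0, and the remaining ones have both indices below
k. -/
lemma pushPart_eq {k : ℕ} (hk : 2 ≤ k) (H N : ℕ → E → E) (y : E) (hH0 : H 0 = 0) (hN0 : N 0 = 0)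
    (hH1 : H 1 = id) :
    pushPart k H N y
      = pushPart k (truncSeq k H) (truncSeq k N) y + fderiv ℝ (H k) y (N 1 y) + N k y := by
  classical
  unfold pushPart
  have h1 : ((k, 1) : ℕ × ℕ) ∈ Finset.HasAntidiagonal.antidiagonal (k + 1) := by simp
  have h2 : ((1, k) : ℕ × ℕ) ∈ (Finset.HasAntidiagonal.antidiagonal (k + 1)).erase (k, 1) := by
    simp [add_comm]; omega
  rw [← Finset.add_sum_erase _ _ h1, ← Finset.add_sum_erase _ _ h2,
    ← Finset.add_sum_erase _ (fun ij : ℕ × ℕ =>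
      fderiv ℝ (truncSeq k H ij.1) y (truncSeq k N ij.2 y)) h1,
    ← Finset.add_sum_erase _ (fun ij : ℕ × ℕ =>
      fderiv ℝ (truncSeq k H ij.1) y (truncSeq k N ij.2 y)) h2]
  simp only [truncSeq_of_le le_rfl, hH1, fderiv_id, Pi.zero_apply, map_zero, zero_add,
    ContinuousLinearMap.id_apply]
  have h3 : fderiv ℝ (0 : E → E) y = 0 := fderiv_const_apply 0
  rw [h3, zero_apply, zero_add]
  have h4 : ∑ ij ∈ ((Finset.HasAntidiagonal.antidiagonal (k + 1)).erase (k, 1)).erase (1, k),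
      fderiv ℝ (H ij.1) y (N ij.2 y)
      = ∑ ij ∈ ((Finset.HasAntidiagonal.antidiagonal (k + 1)).erase (k, 1)).erase (1, k),
        fderiv ℝ (truncSeq k H ij.1) y (truncSeq k N ij.2 y) := by
    refine Finset.sum_congr rfl fun ij hij => ?_
    obtain ⟨i, j⟩ := ij
    simp only [Finset.mem_erase, ne_eq, Prod.mk.injEq, Finset.HasAntidiagonal.mem_antidiagonal] at hij
    obtain ⟨hij1, hij2, hij3⟩ := hij
    by_cases hi0 : i = 0
    · subst hi0
      simp [truncSeq, hH0, h3, show 0 < k by omega]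
    by_cases hj0 : j = 0
    · subst hj0
      simp [truncSeq, hN0]
    rw [truncSeq_of_lt (show i < k by omega), truncSeq_of_lt (show j < k by omega)]
  rw [h4]
  abel

lemma isHomog_substPart (X : E → E) (k : ℕ) {H : ℕ → E → E} (hH : ∀ j, IsHomog j (H j)) :
    IsHomog k (substPart X k H) := by
  refine IsHomog.sum _ fun c _ => ⟨?_, fun t y => ?_⟩
  · exact (ContinuousMultilinearMap.contDiff _).comp (contDiff_pi.2 fun i => (hH _).1)
  · simp only [(hH _).hom]
    have := (taylor X c.length).map_smul_univ (fun i => t ^ c.blocksFun i)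
      fun i => H (c.blocksFun i) y
    rw [this, Finset.prod_pow_eq_pow_sum, c.sum_blocksFun]

lemma isHomog_zero (k : ℕ) : IsHomog k (0 : E → E) := ⟨contDiff_const, fun t y => by simp⟩

lemma isHomog_truncSeq {k : ℕ} {H : ℕ → E → E} (hH : ∀ j < k, IsHomog j (H j)) (j : ℕ) :
    IsHomog j (truncSeq k H j) := by
  unfold truncSeq
  split_ifs with h
  · exact hH j h
  · exact isHomog_zero j

lemma isHomog_pushPart (k : ℕ) {H N : ℕ → E → E} (hH : ∀ j, IsHomog j (H j))
    (hN : ∀ j, IsHomog j (N j)) : IsHomog k (pushPart k H N) :=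
  IsHomog.sum _ fun ij hij => (hH ij.1).fderiv_apply (hN ij.2) (by simpa using hij)

/-- The relation X∘ρ = (−ρ)∘X is differentiated k times at the fixed point 0 of the linear map ρ. -/
lemma taylor_reversible {X : E → E} (hX : ContDiff ℝ (⊤ : ℕ∞) X) {ρ : E →L[ℝ] E}
    (hρ : ∀ p, X (ρ p) = -ρ (X p)) (k : ℕ) (v : Fin k → E) :
    taylor X k (fun i => ρ (v i)) = -ρ (taylor X k v) := by
  have hk : ((k : ℕ) : WithTop ℕ∞) ≤ (⊤ : ℕ∞) := by exact_mod_cast le_top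
  have h1 := ρ.iteratedFDeriv_comp_right hX (0 : E) hk
  have h2 := (-ρ).iteratedFDeriv_comp_left (x := 0) hX.contDiffAt hk
  have h3 : X ∘ ρ = (-ρ) ∘ X := by ext p; simp [hρ]
  rw [h3, h2, map_zero] at h1
  have h4 := congrArg (fun m : ContinuousMultilinearMap ℝ (fun _ : Fin k => E) E => m v) h1
  simp only [ContinuousLinearMap.compContinuousMultilinearMap_coe, Function.comp_apply,
    ContinuousMultilinearMap.compContinuousLinearMap_apply] at h4
  change (k ! : ℝ)⁻¹ • iteratedFDeriv ℝ k X 0 (fun i => ρ (v i))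
    = -ρ ((k ! : ℝ)⁻¹ • iteratedFDeriv ℝ k X 0 v)
  rw [← h4, map_smul, ← smul_neg]
  rfl

lemma substPart_reversible {X : E → E} (hX : ContDiff ℝ (⊤ : ℕ∞) X) {ρ : E →L[ℝ] E}
    (hρ : ∀ p, X (ρ p) = -ρ (X p)) (k : ℕ) {H : ℕ → E → E}
    (hH : ∀ j p, H j (ρ p) = ρ (H j p)) (p : E) :
    substPart X k H (ρ p) = -ρ (substPart X k H p) := by
  simp only [substPart, hH, taylor_reversible hX hρ, map_sum, Finset.sum_neg_distrib]

lemma fderiv_equivariant {h : E → E} (hh : Differentiable ℝ h) {ρ : E →L[ℝ] E}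
    (hρ : ∀ p, h (ρ p) = ρ (h p)) (p v : E) :
    fderiv ℝ h (ρ p) (ρ v) = ρ (fderiv ℝ h p v) := by
  have h1 : HasFDerivAt (fun p => h (ρ p)) ((fderiv ℝ h (ρ p)).comp ρ) p :=
    (hh (ρ p)).hasFDerivAt.comp p ρ.hasFDerivAt
  have h2 : HasFDerivAt (fun p => h (ρ p)) (ρ.comp (fderiv ℝ h p)) p := by
    simp only [hρ]
    exact ρ.hasFDerivAt.comp p (hh p).hasFDerivAt
  exact congrArg (fun L : E →L[ℝ] E => L v) (h1.unique h2)

lemma pushPart_reversible {ρ : E →L[ℝ] E} (k : ℕ) {H N : ℕ → E → E}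
    (hHs : ∀ j, IsHomog j (H j)) (hH : ∀ j p, H j (ρ p) = ρ (H j p))
    (hN : ∀ j p, N j (ρ p) = -ρ (N j p)) (p : E) :
    pushPart k H N (ρ p) = -ρ (pushPart k H N p) := by
  simp only [pushPart, hN, map_neg, map_sum, Finset.sum_neg_distrib]
  congr 1
  exact Finset.sum_congr rfl fun ij _ =>
    fderiv_equivariant ((hHs _).1.differentiable (by simp)) (hH _) _ _

lemma pushDegree_eq (h Y : FormalMultilinearSeries ℝ E E) (k : ℕ) (y : E) :
    pushDegree h Y k y
      = pushPart k (fun j y => h j fun _ => y) (fun j y => Y j fun _ => y) y := by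
  refine Finset.sum_congr rfl fun ij _ => ?_
  have h1 : HasFDerivAt (fun y : E => h ij.1 fun _ => y)
      (((h ij.1).linearDeriv fun _ => y).comp
        (ContinuousLinearMap.pi fun _ => ContinuousLinearMap.id ℝ E)) y :=
    ((h ij.1).hasFDerivAt _).comp y
      (ContinuousLinearMap.pi fun _ => ContinuousLinearMap.id ℝ E).hasFDerivAt
  rw [h1.fderiv]
  rfl

lemma comp_apply_diag (X : E → E) (h : FormalMultilinearSeries ℝ E E) (k : ℕ) (y : E) :
    ((taylor X).comp h) k (fun _ => y) = substPart X k (fun j y => h j fun _ => y) y := by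
  rw [FormalMultilinearSeries.comp, sum_apply]
  rfl

/-- If every homogeneous reversible vector field can be brought into a given class by solving the
homological equation, then every reversible vector field is formally conjugate to one whose Taylor
polynomials are in this class. -/
theorem exists_formal_normal_form {X : E → E} (hX : ContDiff ℝ (⊤ : ℕ∞) X) (hX0 : X 0 = 0) {ι : Type*}
    (ρ : ι → E →L[ℝ] E) (hρ : ∀ i p, X (ρ i p) = -ρ i (X p)) (C : ℕ → Set (E → E))
    (hdec : ∀ k, 2 ≤ k → ∀ V : E → E, IsHomog k V → (∀ i p, V (ρ i p) = -ρ i (V p)) →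
      ∃ h N : E → E, IsHomog k h ∧ (∀ i p, h (ρ i p) = ρ i (h p)) ∧ IsHomog k N ∧
        (∀ i p, N (ρ i p) = -ρ i (N p)) ∧ N ∈ C k ∧
        ∀ y, V y = fderiv ℝ h y (fderiv ℝ X 0 y) - fderiv ℝ X 0 (h y) + N y) :
    ∃ N : ℕ → E → E, (∀ k, 2 ≤ k → IsHomog k (N k) ∧ N k ∈ C k) ∧
      ∀ Y : E → E, Y 0 = 0 → (∀ v, fderiv ℝ Y 0 v = fderiv ℝ X 0 v) →
        (∀ k, 2 ≤ k → diagTaylor k Y = N k) → FormallyConjugate X Y := by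
  set L := fderiv ℝ X 0 with hL
  have hLρ : ∀ i p, L (ρ i p) = -ρ i (L p) := by
    intro i p
    have := taylor_reversible hX (hρ i) 1 fun _ => p
    simpa [taylor_one_apply] using this
  -- A term is the pair (H k, N k). Degrees 0 and 1 are pinned to (0, 0) and (id, L). From degree 2
  -- on, the homological equation is imposed with right-hand data computed from the truncated
  -- sequences, so that `P` depends only on earlier terms.
  let P : ℕ → (ℕ → (E → E) × (E → E)) → (E → E) × (E → E) → Prop := fun k u a =>
    IsHomog k a.1 ∧ (∀ i p, a.1 (ρ i p) = ρ i (a.1 p)) ∧ IsHomog k a.2 ∧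
    (∀ i p, a.2 (ρ i p) = -ρ i (a.2 p)) ∧ (k = 0 → a = (0, 0)) ∧ (k = 1 → a = (id, ⇑L)) ∧
    (2 ≤ k → a.2 ∈ C k ∧ ∀ y, substPart X k (truncSeq k fun j => (u j).1) y
      - pushPart k (truncSeq k fun j => (u j).1) (truncSeq k fun j => (u j).2) y
      = fderiv ℝ a.1 y (L y) - L (a.1 y) + a.2 y)
  have : Inhabited ((E → E) × (E → E)) := ⟨(0, 0)⟩
  obtain ⟨u, hu⟩ : ∃ u : ℕ → (E → E) × (E → E), ∀ k, P k u (u k) := by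
    refine exists_seq_of_step P ?_ ?_
    · rintro k u v a huv ⟨h1, h2, h3, h4, h5, h6, h7⟩
      have e1 : (truncSeq k fun j => (u j).1) = truncSeq k fun j => (v j).1 := by
        funext j; unfold truncSeq; split_ifs with h
        · exact congrArg Prod.fst (huv j h)
        · rfl
      have e2 : (truncSeq k fun j => (u j).2) = truncSeq k fun j => (v j).2 := by
        funext j; unfold truncSeq; split_ifs with h
        · exact congrArg Prod.snd (huv j h)
        · rfl
      rw [e1, e2] at h7
      exact ⟨h1, h2, h3, h4, h5, h6, h7⟩
    · intro k u hu
      rcases Nat.lt_or_ge k 2 with hk | hk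
      · interval_cases k
        · exact ⟨(0, 0), isHomog_zero 0, by simp, isHomog_zero 0, by simp, by simp, by simp,
            by simp⟩
        · exact ⟨(id, ⇑L), ⟨contDiff_id, by simp⟩, by simp, ⟨L.contDiff, by simp⟩, hLρ, by simp,
            by simp, by simp⟩
      · have t1 := isHomog_truncSeq (k := k) (H := fun j => (u j).1) fun j hj => (hu j hj).1
        have t2 := isHomog_truncSeq (k := k) (H := fun j => (u j).2) fun j hj => (hu j hj).2.2.1
        have r1 : ∀ i j p, truncSeq k (fun j => (u j).1) j (ρ i p)
            = ρ i (truncSeq k (fun j => (u j).1) j p) := by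
          intro i j p; unfold truncSeq; split_ifs with h
          · exact (hu j h).2.1 i p
          · simp
        have r2 : ∀ i j p, truncSeq k (fun j => (u j).2) j (ρ i p)
            = -ρ i (truncSeq k (fun j => (u j).2) j p) := by
          intro i j p; unfold truncSeq; split_ifs with h
          · exact (hu j h).2.2.2.1 i p
          · simp
        obtain ⟨h, N, hh1, hh2, hN1, hN2, hN3, heq⟩ := hdec k hk _
          ((isHomog_substPart X k t1).sub (isHomog_pushPart k t1 t2)) (by
            intro i p
            rw [substPart_reversible hX (hρ i) k (r1 i), pushPart_reversible k t1 (r1 i) (r2 i),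
              map_sub]
            abel)
        exact ⟨(h, N), hh1, hh2, hN1, hN2, by omega, by omega, fun _ => ⟨hN3, heq⟩⟩
  refine ⟨fun k => (u k).2, fun k hk => ⟨(hu k).2.2.1, ((hu k).2.2.2.2.2.2 hk).1⟩, ?_⟩
  intro Y hY0 hY1 hYk
  have hu0 := (hu 0).2.2.2.2.1 rfl
  have hu1 := (hu 1).2.2.2.2.2.1 rfl
  -- The Taylor coefficient of order k turns the polynomial map H k back into a multilinear map with
  -- that diagonal.
  let h : FormalMultilinearSeries ℝ E E := fun k => taylor (u k).1 k
  have hdiag : (fun j (y : E) => h j fun _ => y) = fun j => (u j).1 := by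
    funext j y
    have := (hu j).1.diagTaylor_eq j y
    rw [if_pos rfl] at this
    exact this
  have hYdiag : (fun j (y : E) => taylor Y j fun _ => y) = fun j => (u j).2 := by
    funext j y
    change diagTaylor j Y y = _
    rcases Nat.lt_or_ge j 2 with hj | hj
    · interval_cases j
      · rw [diagTaylor_zero, hY0, hu0]; rfl
      · rw [diagTaylor_one, hY1, hu1]
    · rw [hYk j hj]
  refine ⟨h, fun v => ?_, fun y => ?_, fun k y => ?_⟩
  · have := congrFun (congrFun hdiag 0) 0
    rw [Subsingleton.elim v fun _ => 0]
    simpa [hu0] using this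
  · have := congrFun (congrFun hdiag 1) y
    simpa [hu1] using this
  · rw [comp_apply_diag, pushDegree_eq, hdiag, hYdiag]
    -- The homological equation is available only from degree 2. In degree 0 both sides vanish
    -- because X 0 = 0; in degree 1 both equal L y.
    rcases Nat.lt_or_ge k 2 with hk | hk
    · interval_cases k
      · have e : substPart X 0 (fun j => (u j).1) y = 0 := by
          have := (taylor X).comp_coeff_zero h (fun _ => y) (fun _ => 0)
          rw [comp_apply_diag, hdiag] at this
          rw [this]
          simpa [taylor] using hX0
        rw [e, pushPart, show Finset.HasAntidiagonal.antidiagonal (0 + 1) = {(0, 1), (1, 0)} from rfl]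
        have h3 : fderiv ℝ (0 : E → E) y = 0 := fderiv_const_apply 0
        simp [hu0, h3]
      · rw [substPart_eq one_pos, pushPart,
          show Finset.HasAntidiagonal.antidiagonal (1 + 1) = {(0, 2), (1, 1), (2, 0)} from rfl]
        have h3 : fderiv ℝ (0 : E → E) y = 0 := fderiv_const_apply 0
        have e : substPart X 1 (truncSeq 1 fun j => (u j).1) y = 0 := by
          have hz : (truncSeq 1 fun j => (u j).1) = fun _ => 0 := by
            funext j; unfold truncSeq; split_ifs with hj
            · obtain rfl : j = 0 := by omega
              simp [hu0]
            · rfl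
          rw [hz, substPart, Finset.sum_eq_zero]
          intro c _
          have : Nonempty (Fin c.length) := ⟨⟨0, c.length_pos_of_pos one_pos⟩⟩
          exact (taylor X c.length).map_zero
        rw [e]
        simp [hu0, hu1, h3, ← hL]
    · rw [substPart_eq (by omega), pushPart_eq hk _ _ _ (by simp [hu0]) (by simp [hu0])
        (by simp [hu1])]
      have := ((hu k).2.2.2.2.2.2 hk).2 y
      rw [sub_eq_iff_eq_add] at this
      rw [this, hu1]
      simp only [← hL]
      abel

end Recursion

/-! ### Polynomial functions on the phase space -/

section Polynomials

variable {m : ℕ}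

/-- The monomial `x₁ᵃ x₂ᵇ z^α z̄^β`. -/
def mon (a b : ℕ) (α β : Fin (m + 2) → ℕ) (p : PhaseSpace m) : ℂ :=
  (p.1 : ℂ) ^ a * (p.2.1 : ℂ) ^ b * ((∏ j, p.2.2 j ^ α j) * ∏ j, conj (p.2.2 j) ^ β j)

/-- The space of homogeneous polynomials of degree `k` in `x₁, x₂, z, z̄`. -/
def polySpan (m k : ℕ) : Submodule ℂ (PhaseSpace m → ℂ) :=
  Submodule.span ℂ {f | ∃ a b α β, a + b + (∑ j, α j + ∑ j, β j) = k ∧ f = mon a b α β}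

lemma mon_mem {a b k : ℕ} {α β : Fin (m + 2) → ℕ} (h : a + b + (∑ j, α j + ∑ j, β j) = k) :
    mon a b α β ∈ polySpan m k :=
  Submodule.subset_span ⟨a, b, α, β, h, rfl⟩

lemma contDiff_coord (j : Fin (m + 2)) : ContDiff ℝ (⊤ : ℕ∞) fun p : PhaseSpace m => p.2.2 j := by
  fun_prop

lemma contDiff_conj : ContDiff ℝ (⊤ : ℕ∞) fun z : ℂ => conj z :=
  Complex.conjCLE.contDiff

lemma contDiff_ofReal' : ContDiff ℝ (⊤ : ℕ∞) fun x : ℝ => (x : ℂ) :=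
  Complex.ofRealCLM.contDiff

lemma isHomog_mon {a b k : ℕ} {α β : Fin (m + 2) → ℕ}
    (h : a + b + (∑ j, α j + ∑ j, β j) = k) : IsHomog k (mon a b α β) where
  contDiff := by
    unfold mon
    have h1 : ContDiff ℝ (⊤ : ℕ∞) fun p : PhaseSpace m => (p.1 : ℂ) := contDiff_ofReal'.comp contDiff_fst
    have h2 : ContDiff ℝ (⊤ : ℕ∞) fun p : PhaseSpace m => (p.2.1 : ℂ) :=
      contDiff_ofReal'.comp (contDiff_fst.comp contDiff_snd)
    refine ((h1.pow a).mul (h2.pow b)).mul ((contDiff_prod fun j _ => (contDiff_coord j).pow _).mul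
      (contDiff_prod fun j _ => ?_))
    exact (contDiff_conj.comp (contDiff_coord j)).pow _
  hom t y := by
    simp only [mon, Prod.smul_fst, Prod.smul_snd, Pi.smul_apply, smul_eq_mul, Complex.ofReal_mul,
      Complex.real_smul, map_mul, Complex.conj_ofReal, mul_pow, Finset.prod_mul_distrib,
      Finset.prod_pow_eq_pow_sum, ← h, pow_add, Complex.ofReal_pow]
    ring

lemma isHomog_of_mem_polySpan {k : ℕ} {f : PhaseSpace m → ℂ} (hf : f ∈ polySpan m k) :
    IsHomog k f := by
  induction hf using Submodule.span_induction with
  | mem f hf =>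
    obtain ⟨a, b, α, β, h, rfl⟩ := hf
    exact isHomog_mon h
  | zero => exact ⟨contDiff_const, fun t y => by simp⟩
  | add f g _ _ hf hg => exact hf.add hg
  | smul c f _ hf =>
    exact ⟨contDiff_const.mul hf.1, fun t y => by
      simp only [Pi.smul_apply, hf.hom, smul_eq_mul, Complex.real_smul]; ring⟩

lemma mul_mem_polySpan {k : ℕ} {c : PhaseSpace m → ℂ} (hc : ∀ a b α β,
    a + b + (∑ j, α j + ∑ j, β j) = k → (fun p => c p * mon a b α β p) ∈ polySpan m (k + 1))
    {f : PhaseSpace m → ℂ} (hf : f ∈ polySpan m k) : (fun p => c p * f p) ∈ polySpan m (k + 1) := by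
  induction hf using Submodule.span_induction with
  | mem f hf =>
    obtain ⟨a, b, α, β, h, rfl⟩ := hf
    exact hc a b α β h
  | zero =>
    convert Submodule.zero_mem (polySpan m (k + 1)) using 1
    ext p; simp
  | add f g _ _ hf hg =>
    convert Submodule.add_mem _ hf hg using 1
    ext p; simp [mul_add]
  | smul d f _ hf =>
    convert Submodule.smul_mem _ d hf using 1
    ext p; simp; ring

lemma prod_pow_add_single {n : ℕ} (z : Fin n → ℂ) (α : Fin n → ℕ) (j : Fin n) :
    ∏ l, z l ^ (α + Pi.single j 1 : Fin n → ℕ) l = z j * ∏ l, z l ^ α l := by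
  simp only [Pi.add_apply, pow_add, Finset.prod_mul_distrib]
  rw [mul_comm, Finset.prod_eq_single j (f := fun l => z l ^ (Pi.single j 1 : Fin n → ℕ) l)]
  · simp
  · intro l _ hl; simp [hl]
  · simp

lemma sum_add_single {n : ℕ} (α : Fin n → ℕ) (j : Fin n) :
    ∑ l, (α + Pi.single j 1 : Fin n → ℕ) l = ∑ l, α l + 1 := by
  simp [Finset.sum_add_distrib]

lemma x₁_mul_mem {k : ℕ} {f : PhaseSpace m → ℂ} (hf : f ∈ polySpan m k) :
    (fun p => (p.1 : ℂ) * f p) ∈ polySpan m (k + 1) := by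
  refine mul_mem_polySpan (fun a b α β h => ?_) hf
  convert mon_mem (a := a + 1) (b := b) (α := α) (β := β) (k := k + 1) (by omega) using 1
  ext p; simp only [mon]; ring

lemma x₂_mul_mem {k : ℕ} {f : PhaseSpace m → ℂ} (hf : f ∈ polySpan m k) :
    (fun p => (p.2.1 : ℂ) * f p) ∈ polySpan m (k + 1) := by
  refine mul_mem_polySpan (fun a b α β h => ?_) hf
  convert mon_mem (a := a) (b := b + 1) (α := α) (β := β) (k := k + 1) (by omega) using 1
  ext p; simp only [mon]; ring

lemma z_mul_mem {k : ℕ} {f : PhaseSpace m → ℂ} (hf : f ∈ polySpan m k) (j : Fin (m + 2)) :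
    (fun p => p.2.2 j * f p) ∈ polySpan m (k + 1) := by
  refine mul_mem_polySpan (fun a b α β h => ?_) hf
  convert mon_mem (a := a) (b := b) (α := α + Pi.single j 1) (β := β) (k := k + 1)
    (by rw [sum_add_single]; omega) using 1
  ext p; simp only [mon, prod_pow_add_single]; ring

lemma conj_z_mul_mem {k : ℕ} {f : PhaseSpace m → ℂ} (hf : f ∈ polySpan m k) (j : Fin (m + 2)) :
    (fun p => conj (p.2.2 j) * f p) ∈ polySpan m (k + 1) := by
  refine mul_mem_polySpan (fun a b α β h => ?_) hf
  convert mon_mem (a := a) (b := b) (α := α) (β := β + Pi.single j 1) (k := k + 1)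
    (by rw [sum_add_single]; omega) using 1
  ext p; simp only [mon, prod_pow_add_single]; ring

/-- Euler's identity. -/
lemma IsHomog.fderiv_self {E F : Type*} [NormedAddCommGroup E] [NormedSpace ℝ E]
    [NormedAddCommGroup F] [NormedSpace ℝ F] {k : ℕ} {f : E → F} (hf : IsHomog k f) (y : E) :
    fderiv ℝ f y y = (k : ℝ) • f y := by
  have h1 : HasDerivAt (fun t : ℝ => f (t • y)) (fderiv ℝ f y y) 1 := by
    have h0 : HasDerivAt (fun t : ℝ => t • y) y 1 := by
      simpa using (hasDerivAt_id (1 : ℝ)).smul_const y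
    have hd : HasFDerivAt f (fderiv ℝ f y) ((1 : ℝ) • y) := by
      rw [one_smul]; exact (hf.1.differentiable (by simp) y).hasFDerivAt
    exact hd.comp_hasDerivAt (1 : ℝ) h0
  have h2 : HasDerivAt (fun t : ℝ => f (t • y)) ((k : ℝ) • f y) 1 := by
    simp only [hf.hom]
    simpa using (hasDerivAt_pow k (1 : ℝ)).smul_const (f y)
  exact h1.unique h2

lemma phaseSpace_eq_sum (y : PhaseSpace m) : y = y.1 • ((1, 0, 0) : PhaseSpace m)
    + y.2.1 • ((0, 1, 0) : PhaseSpace m)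
    + ∑ j, ((y.2.2 j).re • ((0, 0, Pi.single j 1) : PhaseSpace m)
      + (y.2.2 j).im • ((0, 0, Pi.single j Complex.I) : PhaseSpace m)) := by
  refine Prod.ext ?_ (Prod.ext ?_ ?_)
  · simp [Prod.fst_sum]
  · simp [Prod.fst_sum, Prod.snd_sum]
  · ext l
    simp only [Prod.snd_add, Prod.snd_sum, Prod.smul_snd, smul_zero, add_zero,
      Pi.add_apply, Finset.sum_apply, Pi.smul_apply, Pi.single_apply, Complex.real_smul]
    simp [Finset.sum_add_distrib, Complex.re_add_im]

/-- Induction on the degree through Euler's identity: f is a constant times the sum of the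
coordinates multiplied by partial derivatives, which are homogeneous of one degree less. The real
coordinates Re z_j and Im z_j are rewritten in z_j and z̄_j. -/
lemma mem_polySpan_of_isHomog {k : ℕ} {f : PhaseSpace m → ℂ} (hf : IsHomog k f) :
    f ∈ polySpan m k := by
  induction k generalizing f with
  | zero =>
    have h0 : f = f 0 • mon 0 0 0 0 := by
      ext p
      have h1 := hf.hom 0 p
      simp only [zero_smul, pow_zero, one_smul] at h1
      simp [mon, h1]
    rw [h0]
    exact Submodule.smul_mem _ _ (mon_mem (by simp))
  | succ k ih =>
    have hD : ∀ v : PhaseSpace m, (fun y => fderiv ℝ f y v) ∈ polySpan m k := fun v =>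
      ih (hf.fderiv_apply (l := 0) (g := fun _ => v) ⟨contDiff_const, by simp⟩ (by omega))
    have hfy : ∀ y, f y = ((k : ℂ) + 1)⁻¹ * ((y.1 : ℂ) * fderiv ℝ f y (1, 0, 0)
        + (y.2.1 : ℂ) * fderiv ℝ f y (0, 1, 0)
        + ∑ j, ((1 / 2 : ℂ) * (y.2.2 j * fderiv ℝ f y (0, 0, Pi.single j 1))
          + (1 / 2 : ℂ) * (conj (y.2.2 j) * fderiv ℝ f y (0, 0, Pi.single j 1))
          + (-Complex.I / 2) * (y.2.2 j * fderiv ℝ f y (0, 0, Pi.single j Complex.I))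
          + (Complex.I / 2) * (conj (y.2.2 j) * fderiv ℝ f y (0, 0, Pi.single j Complex.I)))) := by
      intro y
      have h1 := hf.fderiv_self y
      have h2 : fderiv ℝ f y y = (y.1 : ℂ) * fderiv ℝ f y (1, 0, 0)
          + (y.2.1 : ℂ) * fderiv ℝ f y (0, 1, 0)
          + ∑ j, (((y.2.2 j).re : ℂ) * fderiv ℝ f y (0, 0, Pi.single j 1)
          + ((y.2.2 j).im : ℂ) * fderiv ℝ f y (0, 0, Pi.single j Complex.I)) := by
        conv_lhs => enter [2]; rw [phaseSpace_eq_sum y]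
        simp only [map_add, map_sum, map_smul, Complex.real_smul]
      have h3 : ((k : ℂ) + 1) ≠ 0 := by exact_mod_cast (Nat.succ_ne_zero k)
      rw [eq_inv_mul_iff_mul_eq₀ h3]
      rw [h2, Complex.real_smul] at h1
      push_cast at h1
      rw [← h1]
      congr 1
      refine Finset.sum_congr rfl fun j _ => ?_
      rw [Complex.re_eq_add_conj, Complex.im_eq_sub_conj, div_mul_eq_div_div_swap]
      rw [div_eq_mul_inv _ Complex.I, Complex.inv_I]
      ring
    have hf' : f = ((k : ℂ) + 1)⁻¹ • ((fun y => (y.1 : ℂ) * fderiv ℝ f y (1, 0, 0))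
        + (fun y => (y.2.1 : ℂ) * fderiv ℝ f y (0, 1, 0))
        + ∑ j, ((1 / 2 : ℂ) • (fun y => y.2.2 j * fderiv ℝ f y (0, 0, Pi.single j 1))
          + (1 / 2 : ℂ) • (fun y => conj (y.2.2 j) * fderiv ℝ f y (0, 0, Pi.single j 1))
          + (-Complex.I / 2) • (fun y => y.2.2 j * fderiv ℝ f y (0, 0, Pi.single j Complex.I))
          + (Complex.I / 2) •
            (fun y => conj (y.2.2 j) * fderiv ℝ f y (0, 0, Pi.single j Complex.I)))) := by
      ext y
      rw [hfy y]
      simp [Finset.sum_apply]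
    rw [hf']
    refine Submodule.smul_mem _ _ (Submodule.add_mem _ (Submodule.add_mem _ (x₁_mul_mem (hD _))
      (x₂_mul_mem (hD _))) (Submodule.sum_mem _ fun j _ => ?_))
    exact Submodule.add_mem _ (Submodule.add_mem _ (Submodule.add_mem _
      (Submodule.smul_mem _ _ (z_mul_mem (hD _) j))
      (Submodule.smul_mem _ _ (conj_z_mul_mem (hD _) j)))
      (Submodule.smul_mem _ _ (z_mul_mem (hD _) j)))
      (Submodule.smul_mem _ _ (conj_z_mul_mem (hD _) j))

end Polynomials

/-! ### The homological equation -/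

section Homological

variable {m : ℕ} (ω : Fin (m + 2) → ℝ)

/-- The derivative along the linear vector field. -/
def lieD {F : Type*} [NormedAddCommGroup F] [NormedSpace ℝ F] (f : PhaseSpace m → F)
    (y : PhaseSpace m) : F := fderiv ℝ f y (linearPart ω y)

/-- The frequency `-i ω·(α - β)` of the monomial `z^α z̄^β`. -/
def freq (α β : Fin (m + 2) → ℕ) : ℂ := -Complex.I * ∑ j, (ω j : ℂ) * ((α j : ℂ) - β j)

/-- The flow of the linear vector field. -/
def linearFlow (t : ℝ) (y : PhaseSpace m) : PhaseSpace m :=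
  (y.1 + t * y.2.1, y.2.1, fun j => Complex.exp (-Complex.I * ω j * t) * y.2.2 j)

lemma hasDerivAt_linearFlow (y : PhaseSpace m) :
    HasDerivAt (fun t => linearFlow ω t y) (linearPart ω y) 0 := by
  refine HasDerivAt.prodMk ?_ (HasDerivAt.prodMk (hasDerivAt_const _ _) (hasDerivAt_pi.2 fun j => ?_))
  · simpa using ((hasDerivAt_id (0 : ℝ)).mul_const y.2.1).const_add y.1
  · have h1 : HasDerivAt (fun t : ℝ => -Complex.I * ω j * (t : ℂ)) (-Complex.I * ω j) 0 := by
      simpa using (Complex.ofRealCLM.hasDerivAt (x := (0 : ℝ))).const_mul (-Complex.I * ω j)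
    simpa using h1.cexp.mul_const (y.2.2 j)

/-- The chain rule at time 0. The flow acts explicitly on monomials, so differentiating along it
avoids computing their Fréchet derivatives. -/
lemma lieD_eq_of_hasDerivAt {f : PhaseSpace m → ℂ} (hf : ContDiff ℝ (⊤ : ℕ∞) f) {y : PhaseSpace m} {c : ℂ}
    (h : HasDerivAt (fun t => f (linearFlow ω t y)) c 0) : lieD ω f y = c := by
  have h0 : linearFlow ω 0 y = y := by simp [linearFlow]
  have hd : HasFDerivAt f (fderiv ℝ f y) (linearFlow ω 0 y) := by
    rw [h0]; exact (hf.differentiable (by simp) y).hasFDerivAt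
  exact (hd.comp_hasDerivAt (0 : ℝ) (hasDerivAt_linearFlow ω y)).unique h

lemma mon_linearFlow (a b : ℕ) (α β : Fin (m + 2) → ℕ) (t : ℝ) (y : PhaseSpace m) :
    mon a b α β (linearFlow ω t y) = ((y.1 : ℂ) + t * y.2.1) ^ a * (y.2.1 : ℂ) ^ b *
      (Complex.exp (freq ω α β * t) *
        ((∏ j, y.2.2 j ^ α j) * ∏ j, conj (y.2.2 j) ^ β j)) := by
  have h1 : ∀ j, conj (Complex.exp (-Complex.I * ω j * t)) = Complex.exp (Complex.I * ω j * t) := by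
    intro j; rw [← Complex.exp_conj]; simp
  have h2 : Complex.exp (freq ω α β * t) = (∏ j, Complex.exp (-Complex.I * ω j * t) ^ α j) *
      ∏ j, Complex.exp (Complex.I * ω j * t) ^ β j := by
    simp only [← Complex.exp_nat_mul, ← Complex.exp_sum, ← Complex.exp_add,
      ← Finset.sum_add_distrib]
    congr 1
    rw [freq, Finset.mul_sum, Finset.sum_mul]
    exact Finset.sum_congr rfl fun j _ => by ring
  rw [h2]
  simp only [mon, linearFlow, map_mul, h1, mul_pow, Finset.prod_mul_distrib]
  push_cast
  ring

/-- This displays the semisimple part, multiplication by the frequency, and the nilpotent part x₂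
∂/∂x₁. For a = 0 the truncated exponent a − 1 is harmless, its coefficient being zero. -/
lemma lieD_mon (a b : ℕ) (α β : Fin (m + 2) → ℕ) (y : PhaseSpace m) :
    lieD ω (mon a b α β) y
      = a * mon (a - 1) (b + 1) α β y + freq ω α β * mon a b α β y := by
  apply lieD_eq_of_hasDerivAt ω (isHomog_mon rfl).1
  simp only [mon_linearFlow]
  have h1 : HasDerivAt (fun t : ℝ => (y.1 : ℂ) + t * y.2.1) (y.2.1 : ℂ) 0 := by
    simpa using ((Complex.ofRealCLM.hasDerivAt (x := (0 : ℝ))).mul_const (y.2.1 : ℂ)).const_add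
      (y.1 : ℂ)
  have h2 : HasDerivAt (fun t : ℝ => Complex.exp (freq ω α β * t)) (freq ω α β) 0 := by
    have : HasDerivAt (fun t : ℝ => freq ω α β * (t : ℂ)) (freq ω α β) 0 := by
      simpa using (Complex.ofRealCLM.hasDerivAt (x := (0 : ℝ))).const_mul (freq ω α β)
    simpa using this.cexp
  have h3 := ((h1.fun_pow a).mul_const ((y.2.1 : ℂ) ^ b)).fun_mul
    (h2.mul_const ((∏ j, y.2.2 j ^ α j) * ∏ j, conj (y.2.2 j) ^ β j))
  refine h3.congr_deriv ?_
  simp [mon]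
  ring

variable {ω}

lemma lieD_add {F : Type*} [NormedAddCommGroup F] [NormedSpace ℝ F] {f g : PhaseSpace m → F}
    (hf : ContDiff ℝ (⊤ : ℕ∞) f) (hg : ContDiff ℝ (⊤ : ℕ∞) g) (y : PhaseSpace m) :
    lieD ω (f + g) y = lieD ω f y + lieD ω g y := by
  simp only [lieD]
  rw [fderiv_add (hf.differentiable (by simp) y) (hg.differentiable (by simp) y)]
  rfl

lemma lieD_smul {f : PhaseSpace m → ℂ} (hf : ContDiff ℝ (⊤ : ℕ∞) f) (c : ℂ) (y : PhaseSpace m) :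
    lieD ω (c • f) y = c * lieD ω f y := by
  simp only [lieD]
  rw [fderiv_const_smul (hf.differentiable (by simp) y)]
  rfl

lemma lieD_zero : lieD ω (0 : PhaseSpace m → ℂ) = 0 := by
  ext y
  have : fderiv ℝ (0 : PhaseSpace m → ℂ) y = 0 := fderiv_const_apply 0
  simp [lieD, this]

lemma lieD_mem {k : ℕ} {f : PhaseSpace m → ℂ} (hf : f ∈ polySpan m k) :
    lieD ω f ∈ polySpan m k := by
  induction hf using Submodule.span_induction with
  | mem f hf =>
    obtain ⟨a, b, α, β, h, rfl⟩ := hf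
    have : lieD ω (mon a b α β)
        = (a : ℂ) • mon (a - 1) (b + 1) α β + freq ω α β • mon a b α β := by
      ext y; rw [lieD_mon]; simp
    rw [this]
    refine Submodule.add_mem _ ?_ (Submodule.smul_mem _ _ (mon_mem h))
    rcases Nat.eq_zero_or_pos a with rfl | ha
    · simp
    · exact Submodule.smul_mem _ _ (mon_mem (by omega))
  | zero => rw [lieD_zero]; exact Submodule.zero_mem _
  | add f g hf' hg' hf hg =>
    have : lieD ω (f + g) = lieD ω f + lieD ω g := by
      ext y; exact lieD_add (isHomog_of_mem_polySpan hf').1 (isHomog_of_mem_polySpan hg').1 y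
    rw [this]; exact Submodule.add_mem _ hf hg
  | smul c f hf' hf =>
    have : lieD ω (c • f) = c • lieD ω f := by
      ext y; exact lieD_smul (isHomog_of_mem_polySpan hf').1 c y
    rw [this]; exact Submodule.smul_mem _ _ hf

variable (ω)

/-- The span of the monomials of degree `k` without `x₂` which are annihilated by the semisimple
part of `lieD + μ`. -/
def resSpan (μ : ℂ) (k : ℕ) : Submodule ℂ (PhaseSpace m → ℂ) :=
  Submodule.span ℂ {f | ∃ a α β, a + (∑ j, α j + ∑ j, β j) = k ∧ freq ω α β + μ = 0 ∧
    f = mon a 0 α β}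

variable {ω}

lemma resSpan_le (μ : ℂ) (k : ℕ) : resSpan ω μ k ≤ polySpan m k := by
  refine Submodule.span_le.2 ?_
  rintro f ⟨a, α, β, h, -, rfl⟩
  exact mon_mem (by omega)

/-- `f` lies in the range of `lieD + μ` up to resonant terms. -/
def Solvable (ω : Fin (m + 2) → ℝ) (μ : ℂ) (k : ℕ) (f : PhaseSpace m → ℂ) : Prop :=
  ∃ h ∈ polySpan m k, ∃ N ∈ resSpan ω μ k, f = lieD ω h + μ • h + N

lemma Solvable.add {μ : ℂ} {k : ℕ} {f g : PhaseSpace m → ℂ} (hf : Solvable ω μ k f)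
    (hg : Solvable ω μ k g) : Solvable ω μ k (f + g) := by
  obtain ⟨h, hh, N, hN, rfl⟩ := hf
  obtain ⟨h', hh', N', hN', rfl⟩ := hg
  refine ⟨h + h', Submodule.add_mem _ hh hh', N + N', Submodule.add_mem _ hN hN', ?_⟩
  ext y
  have := lieD_add (ω := ω) (isHomog_of_mem_polySpan hh).1 (isHomog_of_mem_polySpan hh').1 y
  simp only [Pi.add_apply, Pi.smul_apply, this, smul_eq_mul]
  ring

lemma Solvable.smul {μ : ℂ} {k : ℕ} {f : PhaseSpace m → ℂ} (hf : Solvable ω μ k f) (c : ℂ) :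
    Solvable ω μ k (c • f) := by
  obtain ⟨h, hh, N, hN, rfl⟩ := hf
  refine ⟨c • h, Submodule.smul_mem _ c hh, c • N, Submodule.smul_mem _ c hN, ?_⟩
  ext y
  have := lieD_smul (ω := ω) (isHomog_of_mem_polySpan hh).1 c y
  simp only [Pi.add_apply, Pi.smul_apply, this, smul_eq_mul]
  ring

lemma Solvable.range {μ : ℂ} {k : ℕ} {h : PhaseSpace m → ℂ} (hh : h ∈ polySpan m k) :
    Solvable ω μ k (lieD ω h + μ • h) :=
  ⟨h, hh, 0, Submodule.zero_mem _, by simp⟩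

/-- At resonance only the nilpotent part remains: a monomial with a factor x₂ is the image of the
one with that x₂ replaced by x₁, up to the factor a + 1, and a monomial without x₂ is its own normal
form. Off resonance the scalar is invertible and the nilpotent correction has a smaller exponent of
x₁, so induction on a applies. -/
lemma solvable_mon (μ : ℂ) {a b k : ℕ} {α β : Fin (m + 2) → ℕ}
    (h : a + b + (∑ j, α j + ∑ j, β j) = k) : Solvable ω μ k (mon a b α β) := by
  by_cases hμ : freq ω α β + μ = 0
  · rcases b with _ | b
    · refine ⟨0, Submodule.zero_mem _, mon a 0 α β,
        Submodule.subset_span ⟨a, α, β, by omega, hμ, rfl⟩, ?_⟩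
      rw [lieD_zero]; simp
    · have h1 := (Solvable.range (ω := ω) (μ := μ)
        (mon_mem (a := a + 1) (b := b) (k := k) (α := α) (β := β) (by omega))).smul
        ((a : ℂ) + 1)⁻¹
      convert h1 using 1
      ext y
      have h3 : ((a : ℂ) + 1) ≠ 0 := by exact_mod_cast (Nat.succ_ne_zero a)
      simp only [Pi.smul_apply, Pi.add_apply, lieD_mon, smul_eq_mul, add_assoc, ← add_mul, hμ]
      push_cast
      field_simp
      simp
  · induction a generalizing b with
    | zero =>
      have h1 := (Solvable.range (ω := ω) (μ := μ)
        (mon_mem (a := 0) (b := b) (k := k) (α := α) (β := β) h)).smul (freq ω α β + μ)⁻¹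
      convert h1 using 1
      ext y
      simp only [Pi.smul_apply, Pi.add_apply, lieD_mon, smul_eq_mul]
      field_simp
      push_cast
      ring
    | succ a ih =>
      have h1 := (Solvable.range (ω := ω) (μ := μ)
        (mon_mem (a := a + 1) (b := b) (k := k) (α := α) (β := β) h)).smul (freq ω α β + μ)⁻¹
      have h2 := (ih (b := b + 1) (by omega)).smul (-((freq ω α β + μ)⁻¹ * (a + 1)))
      convert h1.add h2 using 1
      ext y
      simp only [Pi.smul_apply, Pi.add_apply, lieD_mon, smul_eq_mul, Nat.add_sub_cancel]
      push_cast
      field_simp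
      ring

lemma solvable_of_mem (μ : ℂ) {k : ℕ} {f : PhaseSpace m → ℂ} (hf : f ∈ polySpan m k) :
    Solvable ω μ k f := by
  induction hf using Submodule.span_induction with
  | mem f hf =>
    obtain ⟨a, b, α, β, h, rfl⟩ := hf
    exact solvable_mon μ h
  | zero => simpa using (solvable_mon (ω := ω) (m := m) (a := k) (b := 0) (α := 0) (β := 0) μ
      (by simp)).smul 0
  | add f g _ _ hf hg => exact hf.add hg
  | smul c f _ hf => exact hf.smul c

lemma lieD_x₁_mul {f : PhaseSpace m → ℂ} (hf : ContDiff ℝ (⊤ : ℕ∞) f) (y : PhaseSpace m) :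
    lieD ω (fun p => (p.1 : ℂ) * f p) y = y.2.1 * f y + y.1 * lieD ω f y := by
  have h1 : HasFDerivAt (fun p : PhaseSpace m => (p.1 : ℂ))
      (Complex.ofRealCLM.comp (ContinuousLinearMap.fst ℝ ℝ (ℝ × (Fin (m + 2) → ℂ)))) y :=
    (Complex.ofRealCLM.comp (ContinuousLinearMap.fst ℝ ℝ (ℝ × (Fin (m + 2) → ℂ)))).hasFDerivAt
  have h2 := h1.fun_mul (hf.differentiable (by simp) y).hasFDerivAt
  rw [lieD, h2.fderiv]
  simp [linearPart, lieD]
  ring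

/-- On resonant polynomials, the derivative along the linear field lies in the range of
`g ↦ 2 x₂ g + x₁ lieD g`. -/
lemma lieD_resonant {k : ℕ} {f : PhaseSpace m → ℂ} (hf : f ∈ resSpan ω 0 (k + 1)) :
    ∃ g ∈ resSpan ω 0 k, ∀ y, lieD ω f y = 2 * (y.2.1 * g y) + y.1 * lieD ω g y := by
  induction hf using Submodule.span_induction with
  | mem f hf =>
    obtain ⟨a, α, β, h, hμ, rfl⟩ := hf
    rw [add_zero] at hμ
    rcases a with _ | a
    · refine ⟨0, Submodule.zero_mem _, fun y => ?_⟩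
      rw [lieD_zero, lieD_mon, hμ]; simp
    -- For g = x₁ᵃ M, the expression 2x₂g + x₁·lieD g equals (a + 2) x₁ᵃ x₂ M, while the target is
    -- (a + 1) x₁ᵃ x₂ M.
    · refine ⟨(((a : ℂ) + 1) / (a + 2)) • mon a 0 α β, Submodule.smul_mem _ _
        (Submodule.subset_span ⟨a, α, β, by omega, by simpa using hμ, rfl⟩), fun y => ?_⟩
      rw [lieD_smul (isHomog_mon rfl).1, lieD_mon, lieD_mon, hμ]
      have h3 : ((a : ℂ) + 2) ≠ 0 := by exact_mod_cast (Nat.succ_ne_zero (a + 1))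
      have h4 : (y.1 : ℂ) * ((a : ℂ) * mon (a - 1) (0 + 1) α β y) = a * mon a 1 α β y := by
        rcases a with _ | a
        · simp
        · simp only [mon, Nat.add_sub_cancel, zero_add]; ring
      have h5 : (y.2.1 : ℂ) * mon a 0 α β y = mon a 1 α β y := by simp only [mon]; ring
      simp only [Nat.add_sub_cancel, Pi.smul_apply, smul_eq_mul, zero_mul, add_zero, zero_add]
        at h4 ⊢
      have h6 : (2 : ℂ) * (y.2.1 * ((a + 1) / (a + 2) * mon a 0 α β y))
          = 2 * ((a + 1) / (a + 2)) * mon a 1 α β y := by rw [← h5]; ring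
      have h7 : (y.1 : ℂ) * ((a + 1) / (a + 2) * (a * mon (a - 1) 1 α β y))
          = (a + 1) / (a + 2) * (a * mon a 1 α β y) := by rw [← h4]; ring
      rw [h6, h7]
      push_cast
      field_simp
      ring
  | zero => exact ⟨0, Submodule.zero_mem _, fun y => by rw [lieD_zero]; simp⟩
  | add f g hf' hg' hf hg =>
    obtain ⟨f₁, hf₁, hf⟩ := hf
    obtain ⟨g₁, hg₁, hg⟩ := hg
    refine ⟨f₁ + g₁, Submodule.add_mem _ hf₁ hg₁, fun y => ?_⟩
    rw [lieD_add (isHomog_of_mem_polySpan (resSpan_le _ _ hf')).1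
      (isHomog_of_mem_polySpan (resSpan_le _ _ hg')).1,
      lieD_add (isHomog_of_mem_polySpan (resSpan_le _ _ hf₁)).1
      (isHomog_of_mem_polySpan (resSpan_le _ _ hg₁)).1, hf, hg]
    simp only [Pi.add_apply]
    ring
  | smul c f hf' hf =>
    obtain ⟨f₁, hf₁, hf⟩ := hf
    refine ⟨c • f₁, Submodule.smul_mem _ c hf₁, fun y => ?_⟩
    rw [lieD_smul (isHomog_of_mem_polySpan (resSpan_le _ _ hf')).1,
      lieD_smul (isHomog_of_mem_polySpan (resSpan_le _ _ hf₁)).1, hf]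
    simp only [Pi.smul_apply, smul_eq_mul]
    ring

/-- The first equation determines h₂ = lieD h₁ − u + x₁g. Substituted into the second, it gives v +
lieD u = lieD (lieD h₁) + (2x₂g + x₁·lieD g) + e. One solves v + lieD u = lieD h + e, then h = lieD
h₁ + N with N resonant; `lieD_resonant` writes lieD N as the bracket. -/
lemma solve_nilpotent {k : ℕ} {u v : PhaseSpace m → ℂ} (hu : u ∈ polySpan m (k + 1))
    (hv : v ∈ polySpan m (k + 1)) :
    ∃ h₁ ∈ polySpan m (k + 1), ∃ h₂ ∈ polySpan m (k + 1), ∃ g ∈ resSpan ω 0 k,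
      ∃ e ∈ resSpan ω 0 (k + 1), (∀ y, u y = lieD ω h₁ y - h₂ y + y.1 * g y) ∧
        ∀ y, v y = lieD ω h₂ y + (y.2.1 * g y + e y) := by
  obtain ⟨h, hh, e, he, hvu⟩ := solvable_of_mem (ω := ω) 0 (Submodule.add_mem _ hv (lieD_mem (ω := ω) hu))
  obtain ⟨h₁, hh₁, N, hN, rfl⟩ := solvable_of_mem (ω := ω) 0 hh
  obtain ⟨g, hg, hgN⟩ := lieD_resonant hN
  have hxg := x₁_mul_mem (resSpan_le _ _ hg)
  refine ⟨h₁, hh₁, lieD ω h₁ + ((-1 : ℂ) • u + fun p => (p.1 : ℂ) * g p), Submodule.add_mem _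
    (lieD_mem hh₁) (Submodule.add_mem _ (Submodule.smul_mem _ _ hu) hxg), g, hg, e, he,
    fun y => ?_, fun y => ?_⟩
  · simp
  · have h1 := congrFun hvu y
    have s1 := (isHomog_of_mem_polySpan (lieD_mem (ω := ω) hh₁)).1
    have s2 := (isHomog_of_mem_polySpan hu).1
    have s3 := (isHomog_of_mem_polySpan hxg).1
    have s4 := (isHomog_of_mem_polySpan (resSpan_le _ _ hN)).1
    have s5 := (isHomog_of_mem_polySpan (resSpan_le _ _ hg)).1
    have s6 : ContDiff ℝ (⊤ : ℕ∞) ((-1 : ℂ) • u) := contDiff_const.smul s2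
    have s7 : ContDiff ℝ (⊤ : ℕ∞) ((-1 : ℂ) • u + fun p => (p.1 : ℂ) * g p) := s6.add s3
    rw [lieD_add s1 s7, lieD_add s6 s3,
      lieD_smul s2, lieD_x₁_mul s5]
    simp only [zero_smul, add_zero] at h1
    simp only [Pi.add_apply] at h1
    rw [lieD_add s1 s4, hgN] at h1
    rw [eq_sub_of_add_eq h1]
    ring

lemma fderiv_phaseSpace {h : PhaseSpace m → PhaseSpace m} (hh : ContDiff ℝ (⊤ : ℕ∞) h)
    (y v : PhaseSpace m) :
    fderiv ℝ h y v = (fderiv ℝ (fun p => (h p).1) y v, fderiv ℝ (fun p => (h p).2.1) y v,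
      fun j => fderiv ℝ (fun p => (h p).2.2 j) y v) := by
  have hd := (hh.differentiable (by simp) y).hasFDerivAt
  rw [hd.fst.fderiv, hd.snd.fst.fderiv]
  refine Prod.ext rfl (Prod.ext rfl ?_)
  ext j
  have hj : HasFDerivAt (fun p => (h p).2.2 j) _ y := hasFDerivAt_pi'.1 hd.snd.snd j
  simp only [hj.fderiv]
  rfl

lemma re_lieD {f : PhaseSpace m → ℂ} (hf : ContDiff ℝ (⊤ : ℕ∞) f) (y : PhaseSpace m) :
    lieD ω (fun p => (f p).re) y = (lieD ω f y).re := by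
  have h1 := Complex.reCLM.hasFDerivAt.comp y (hf.differentiable (by simp) y).hasFDerivAt
  have h2 : (Complex.reCLM ∘ f) = fun p => (f p).re := rfl
  rw [h2] at h1
  rw [lieD, h1.fderiv]
  rfl

/-- Every homogeneous vector field is, up to resonant terms, in the range of the homological
operator. -/
theorem exists_homological {k : ℕ} {V : PhaseSpace m → PhaseSpace m} (hV : IsHomog (k + 1) V) :
    ∃ h : PhaseSpace m → PhaseSpace m, IsHomog (k + 1) h ∧ ∃ g ∈ resSpan ω 0 k,
      ∃ e ∈ resSpan ω 0 (k + 1), ∃ q : Fin (m + 2) → PhaseSpace m → ℂ,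
      (∀ j, q j ∈ resSpan ω (Complex.I * ω j) (k + 1)) ∧
      ∀ y, V y = fderiv ℝ h y (linearPart ω y) - linearPart ω (h y)
        + (y.1 * (g y).re, y.2.1 * (g y).re + (e y).re, fun j => q j y) := by
  have hV1 : (fun y => ((V y).1 : ℂ)) ∈ polySpan m (k + 1) :=
    mem_polySpan_of_isHomog ((hV.clm_comp (ContinuousLinearMap.fst ℝ ℝ _)).clm_comp
      Complex.ofRealCLM)
  have hV2 : (fun y => ((V y).2.1 : ℂ)) ∈ polySpan m (k + 1) :=
    mem_polySpan_of_isHomog (((hV.clm_comp (ContinuousLinearMap.snd ℝ ℝ _)).clm_comp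
      (ContinuousLinearMap.fst ℝ ℝ _)).clm_comp Complex.ofRealCLM)
  have hVz : ∀ j, (fun y => (V y).2.2 j) ∈ polySpan m (k + 1) := fun j =>
    mem_polySpan_of_isHomog (((hV.clm_comp (ContinuousLinearMap.snd ℝ ℝ _)).clm_comp
      (ContinuousLinearMap.snd ℝ ℝ _)).clm_comp
        (ContinuousLinearMap.proj (R := ℝ) j : (Fin (m + 2) → ℂ) →L[ℝ] ℂ))
  obtain ⟨h₁, hh₁, h₂, hh₂, g, hg, e, he, hu, hv⟩ := solve_nilpotent (ω := ω) hV1 hV2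
  choose hz hhz q hq hzq using fun j => solvable_of_mem (ω := ω) (Complex.I * ω j) (hVz j)
  have s1 := isHomog_of_mem_polySpan hh₁
  have s2 := isHomog_of_mem_polySpan hh₂
  have sz := fun j => isHomog_of_mem_polySpan (hhz j)
  -- The operator is real on the (x₁, x₂) block, so real parts of the complex solution solve the
  -- real equations.
  let h : PhaseSpace m → PhaseSpace m := fun y => ((h₁ y).re, (h₂ y).re, fun j => hz j y)
  have hsh : IsHomog (k + 1) h := by
    refine ⟨(Complex.reCLM.contDiff.comp s1.1).prodMk ((Complex.reCLM.contDiff.comp s2.1).prodMk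
      (contDiff_pi.2 fun j => (sz j).1)), fun t y => ?_⟩
    refine Prod.ext ?_ (Prod.ext ?_ ?_)
    · exact (s1.clm_comp Complex.reCLM).hom t y
    · exact (s2.clm_comp Complex.reCLM).hom t y
    · ext j; exact (sz j).hom t y
  refine ⟨h, hsh, g, hg, e, he, q, hq, fun y => ?_⟩
  rw [fderiv_phaseSpace hsh.1]
  refine Prod.ext ?_ (Prod.ext ?_ ?_)
  · have h1 := congrArg Complex.re (hu y)
    have h2 := re_lieD (ω := ω) s1.1 y
    simp only [lieD] at h1 h2
    simp only [Prod.fst_add, Prod.fst_sub, linearPart, h] at h2 ⊢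
    rw [h2]
    simpa [linearPart] using h1
  · have h1 := congrArg Complex.re (hv y)
    have h2 := re_lieD (ω := ω) s2.1 y
    simp only [lieD] at h1 h2
    simp only [Prod.fst_add, Prod.snd_add, Prod.fst_sub, Prod.snd_sub, linearPart, h] at h2 ⊢
    rw [h2]
    simpa [linearPart] using h1
  · ext j
    have h1 := congrFun (hzq j) y
    simp only [Pi.add_apply, Pi.smul_apply, lieD, smul_eq_mul] at h1
    simp only [Prod.snd_add, Prod.snd_sub, Pi.add_apply, Pi.sub_apply, linearPart, h] at h1 ⊢
    rw [h1]
    ring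

end Homological

/-! ### Reversing involutions and averaging -/

section Averaging

variable {m : ℕ}

/-- The involution `psi` as a continuous linear map. -/
def psiL (a₀ : ℤˣ) (a : Fin (m + 2) → ℤˣ) : PhaseSpace m →L[ℝ] PhaseSpace m :=
  LinearMap.toContinuousLinearMap
    { toFun := psi a₀ a
      map_add' := fun p q => by
        refine Prod.ext ?_ (Prod.ext ?_ (funext fun j => ?_)) <;> simp [psi] <;> ring
      map_smul' := fun c p => by
        refine Prod.ext ?_ (Prod.ext ?_ (funext fun j => ?_)) <;> simp [psi] <;> ring }

@[simp]
lemma psiL_apply (a₀ : ℤˣ) (a : Fin (m + 2) → ℤˣ) (p : PhaseSpace m) :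
    psiL a₀ a p = psi a₀ a p := rfl

lemma phi_eq_psi (p : PhaseSpace m) : phi p = psi 1 1 p := by
  simp [phi, psi]

lemma psi_psi_comm (a₀ b₀ : ℤˣ) (a b : Fin (m + 2) → ℤˣ) (p : PhaseSpace m) :
    psi a₀ a (psi b₀ b p) = psi b₀ b (psi a₀ a p) := by
  refine Prod.ext ?_ (Prod.ext ?_ (funext fun j => ?_)) <;> simp [psi] <;> ring

lemma psi_psi (a₀ : ℤˣ) (a : Fin (m + 2) → ℤˣ) (p : PhaseSpace m) :
    psi a₀ a (psi a₀ a p) = p := by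
  refine Prod.ext ?_ (Prod.ext ?_ (funext fun j => ?_))
  · rcases Int.units_eq_one_or a₀ with h | h <;> simp [psi, h]
  · rcases Int.units_eq_one_or a₀ with h | h <;> simp [psi, h]
  · rcases Int.units_eq_one_or (a j) with h | h <;> simp [psi, h]

lemma linearPart_psi (ω : Fin (m + 2) → ℝ) (a₀ : ℤˣ) (a : Fin (m + 2) → ℤˣ) (p : PhaseSpace m) :
    linearPart ω (psi a₀ a p) = -psi a₀ a (linearPart ω p) := by
  refine Prod.ext ?_ (Prod.ext ?_ (funext fun j => ?_)) <;> simp [psi, linearPart]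
  ring

/-! ### Averaging over a linear involution -/

section Abstract

variable {E : Type*} [NormedAddCommGroup E] [NormedSpace ℝ E]

/-- The part of a map which is equivariant under an involution. -/
def eqvPart (ρ : E →L[ℝ] E) (h : E → E) (y : E) : E := (1 / 2 : ℝ) • (h y + ρ (h (ρ y)))

/-- The part of a vector field which is reversed by an involution. -/
def revPart (ρ : E →L[ℝ] E) : (E → E) →ₗ[ℝ] E → E where
  toFun N y := (1 / 2 : ℝ) • (N y - ρ (N (ρ y)))
  map_add' N M := by ext y; simp only [Pi.add_apply, map_add]; module
  map_smul' c N := by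
    ext y; simp only [Pi.smul_apply, map_smul, RingHom.id_apply]; module

lemma revPart_apply (ρ : E →L[ℝ] E) (N : E → E) (y : E) :
    revPart ρ N y = (1 / 2 : ℝ) • (N y - ρ (N (ρ y))) := rfl

lemma IsHomog.eqvPart {k : ℕ} {h : E → E} (hh : IsHomog k h) (ρ : E →L[ℝ] E) :
    IsHomog k (eqvPart ρ h) :=
  (hh.add ((hh.comp_clm ρ).clm_comp ρ)).const_smul _

lemma eqvPart_equivariant {ρ : E →L[ℝ] E} (hρ : ∀ p, ρ (ρ p) = p) (h : E → E) (p : E) :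
    eqvPart ρ h (ρ p) = ρ (eqvPart ρ h p) := by
  simp only [Bireversible.eqvPart, hρ, map_smul, map_add]
  rw [add_comm]

lemma eqvPart_equivariant_of_comm {ρ τ : E →L[ℝ] E} (hc : ∀ p, ρ (τ p) = τ (ρ p)) {h : E → E}
    (hh : ∀ p, h (τ p) = τ (h p)) (p : E) : eqvPart ρ h (τ p) = τ (eqvPart ρ h p) := by
  simp only [Bireversible.eqvPart, hc, hh, map_smul, map_add]

/-- Conjugating the equation by ρ turns V into −V and L into −L, so h is replaced by ρ∘h∘ρ and N by
−ρ∘N∘ρ. The mean of the two equations is the claim. -/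
lemma homological_average {L : E → E} {ρ : E →L[ℝ] E} (hρ : ∀ p, ρ (ρ p) = p)
    (hLρ : ∀ p, L (ρ p) = -ρ (L p)) (hLa : ∀ p q, L (p + q) = L p + L q)
    (hLs : ∀ (c : ℝ) p, L (c • p) = c • L p) {h N V : E → E} (hh : Differentiable ℝ h)
    (hV : ∀ p, V (ρ p) = -ρ (V p)) (heq : ∀ y, V y = fderiv ℝ h y (L y) - L (h y) + N y) (y : E) :
    V y = fderiv ℝ (eqvPart ρ h) y (L y) - L (eqvPart ρ h y) + revPart ρ N y := by
  have h1 : HasFDerivAt (eqvPart ρ h)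
      ((1 / 2 : ℝ) • (fderiv ℝ h y + ρ.comp ((fderiv ℝ h (ρ y)).comp ρ))) y := by
    have h2 : HasFDerivAt (fun y => ρ (h (ρ y))) (ρ.comp ((fderiv ℝ h (ρ y)).comp ρ)) y :=
      ρ.hasFDerivAt.comp y ((hh (ρ y)).hasFDerivAt.comp y ρ.hasFDerivAt)
    exact ((hh y).hasFDerivAt.fun_add h2).fun_const_smul (1 / 2 : ℝ)
  rw [h1.fderiv, revPart_apply, eqvPart, hLs, hLa, hLρ]
  have h3 : ρ (V (ρ y)) = - V y := by rw [hV, map_neg, hρ]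
  have h4 := heq (ρ y)
  rw [hLρ, map_neg] at h4
  have h5 : V y = (1 / 2 : ℝ) • (V y - ρ (V (ρ y))) := by rw [h3]; module
  rw [h5, h4, heq y]
  simp only [map_add, map_sub, map_neg, smul_apply, add_apply, ContinuousLinearMap.comp_apply]
  module

end Abstract

/-- The vector field `f · (x₁ ∂₁ + x₂ ∂₂)`. -/
def fieldX : (PhaseSpace m → ℝ) →ₗ[ℝ] PhaseSpace m → PhaseSpace m where
  toFun f p := (p.1 * f p, p.2.1 * f p, 0)
  map_add' f g := by ext p <;> simp <;> ring
  map_smul' c f := by ext p <;> simp <;> ring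

/-- The vector field `f ∂₂`. -/
def fieldH : (PhaseSpace m → ℝ) →ₗ[ℝ] PhaseSpace m → PhaseSpace m where
  toFun f p := (0, f p, 0)
  map_add' f g := by ext p <;> simp
  map_smul' c f := by ext p <;> simp

/-- The vector field with `z_j`-component `f`. -/
def fieldZ (j : Fin (m + 2)) : (PhaseSpace m → ℂ) →ₗ[ℝ] PhaseSpace m → PhaseSpace m where
  toFun f p := (0, 0, Pi.single j (f p))
  map_add' f g := by ext p <;> simp [Pi.single_add]
  map_smul' c f := by
    ext p l
    · simp
    · simp
    · rcases eq_or_ne l j with rfl | hl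
      · simp
      · simp [hl]

lemma fieldX_apply (f : PhaseSpace m → ℝ) (p : PhaseSpace m) :
    fieldX f p = (p.1 * f p, p.2.1 * f p, 0) := rfl

lemma fieldH_apply (f : PhaseSpace m → ℝ) (p : PhaseSpace m) : fieldH f p = (0, f p, 0) := rfl

lemma fieldZ_apply (j : Fin (m + 2)) (f : PhaseSpace m → ℂ) (p : PhaseSpace m) :
    fieldZ j f p = (0, 0, Pi.single j (f p)) := rfl

/-- The projection onto the bireversible vector fields. -/
def birevPart (a₀ : ℤˣ) (a : Fin (m + 2) → ℤˣ) :
    (PhaseSpace m → PhaseSpace m) →ₗ[ℝ] PhaseSpace m → PhaseSpace m :=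
  (revPart (psiL a₀ a)).comp (revPart (psiL 1 1))

/-- `f(φ p) = conj f(p)` and `f(ψ p) = s conj f(p)`. -/
def HasSign (a₀ : ℤˣ) (a : Fin (m + 2) → ℤˣ) (s : ℤˣ) (f : PhaseSpace m → ℂ) : Prop :=
  (∀ p, f (psi 1 1 p) = conj (f p)) ∧ ∀ p, f (psi a₀ a p) = ((s : ℤ) : ℂ) * conj (f p)

variable {a₀ : ℤˣ} {a : Fin (m + 2) → ℤˣ} {s : ℤˣ} {f : PhaseSpace m → ℂ}

/-- The field x₁∂₁ + x₂∂₂ is invariant under both involutions, so reversibility asks for a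
coefficient that changes sign: φ keeps only Im f, and ψ keeps it exactly when s = 1. -/
lemma birevPart_fieldX (hf : HasSign a₀ a s f) (c : ℂ) :
    birevPart a₀ a (fieldX fun p => (c * f p).re)
      = (-c.im * (1 + ((s : ℤ) : ℝ)) / 2) • fieldX fun p => (f p).im := by
  have h1 : revPart (psiL 1 1) (fieldX fun p => (c * f p).re)
      = (-c.im) • fieldX fun p => (f p).im := by
    ext p <;> simp [revPart_apply, fieldX_apply, hf.1 p] <;> simp [psi] <;> ring
  rw [birevPart, LinearMap.comp_apply, h1, map_smul, mul_div_assoc, mul_smul]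
  congr 1
  have h2 := hf.2
  ext p
  · rcases Int.units_eq_one_or a₀ with h | h <;> rcases Int.units_eq_one_or s with h' | h' <;>
      simp [revPart_apply, fieldX_apply, h2 p, h'] <;> simp [psi, h] <;> ring
  · rcases Int.units_eq_one_or a₀ with h | h <;> rcases Int.units_eq_one_or s with h' | h' <;>
      simp [revPart_apply, fieldX_apply, h2 p, h'] <;> simp [psi, h] <;> ring
  · simp [revPart_apply, fieldX_apply, psi]

/-- Since φ sends ∂₂ to −∂₂, it keeps the even part Re f. Under ψ, which multiplies ∂₂ by −a₀, this
survives exactly when s = a₀. -/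
lemma birevPart_fieldH (hf : HasSign a₀ a s f) (c : ℂ) :
    birevPart a₀ a (fieldH fun p => (c * f p).re)
      = (c.re * (1 + ((a₀ * s : ℤˣ) : ℤ) : ℝ) / 2) • fieldH fun p => (f p).re := by
  have h1 : revPart (psiL 1 1) (fieldH fun p => (c * f p).re)
      = c.re • fieldH fun p => (f p).re := by
    ext p <;> simp [revPart_apply, fieldH_apply, hf.1 p] <;> (simp [psi]; try ring)
  rw [birevPart, LinearMap.comp_apply, h1, map_smul, mul_div_assoc, mul_smul]
  congr 1
  have h2 := hf.2
  ext p
  · simp [revPart_apply, fieldH_apply, psi]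
  · rcases Int.units_eq_one_or a₀ with h | h <;> rcases Int.units_eq_one_or s with h' | h' <;>
      simp [revPart_apply, fieldH_apply, h2 p, h'] <;> simp [psi, h] <;> ring
  · simp [revPart_apply, fieldH_apply, psi]

/-- Reversibility under φ amounts to c = −c̄, hence only the imaginary part of c remains; then ψ
requires the sign of f to equal that of z_j. -/
lemma birevPart_fieldZ (hf : HasSign a₀ a s f) (j : Fin (m + 2)) (c : ℂ) :
    birevPart a₀ a (fieldZ j fun p => c * f p)
      = (c.im * (1 + ((a j * s : ℤˣ) : ℤ) : ℝ) / 2) • fieldZ j fun p => Complex.I * f p := by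
  have h1 : revPart (psiL 1 1) (fieldZ j fun p => c * f p)
      = c.im • fieldZ j fun p => Complex.I * f p := by
    ext p l
    · simp [revPart_apply, fieldZ_apply, psi]
    · simp [revPart_apply, fieldZ_apply, psi]
    · rcases eq_or_ne l j with rfl | hl
      · simp only [revPart_apply, fieldZ_apply, psiL_apply, hf.1 p, Pi.smul_apply]
        simp only [psi, Prod.smul_snd, Prod.snd_sub, Pi.smul_apply, Pi.sub_apply, Pi.single_eq_same,
          Complex.real_smul, map_mul, Complex.conj_conj, Pi.one_apply, Units.val_one, Int.cast_one,
          one_mul]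
        have : c - conj c = 2 * c.im * Complex.I := by
          rw [Complex.sub_conj]; push_cast; ring
        have h3 : c * f p - conj c * f p = 2 * c.im * Complex.I * f p := by rw [← this]; ring
        rw [h3]; push_cast; ring
      · simp [revPart_apply, fieldZ_apply, psi, hl]
  rw [birevPart, LinearMap.comp_apply, h1, map_smul, mul_div_assoc, mul_smul]
  congr 1
  have h2 := hf.2
  ext p l
  · simp [revPart_apply, fieldZ_apply, psi]
  · simp [revPart_apply, fieldZ_apply, psi]
  · rcases eq_or_ne l j with rfl | hl
    · simp only [revPart_apply, fieldZ_apply, psiL_apply, h2 p, Pi.smul_apply]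
      simp only [psi, Prod.smul_snd, Prod.snd_sub, Pi.smul_apply, Pi.sub_apply, Pi.single_eq_same,
          Complex.real_smul, map_mul, Complex.conj_conj, Complex.conj_I]
      rcases Int.units_eq_one_or (a l) with h | h <;> rcases Int.units_eq_one_or s with h' | h' <;>
        simp [h, h'] <;> ring
    · simp [revPart_apply, fieldZ_apply, psi, hl]

end Averaging

/-! ### Resonant monomials -/

section Resonance

variable {m : ℕ}

/-- The product of powers of the `|z_j|²`. -/
def normProd (γ : Fin (m + 2) → ℕ) (p : PhaseSpace m) : ℝ := ∏ j, (‖p.2.2 j‖ ^ 2) ^ γ j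

/-- In each variable, the common power min(α, β) of z and z̄ becomes a power of |z|². What remains
is a pure power of z or of z̄, described by the exponents x₀, y₀, x₁, y₁ and δ. -/
lemma exists_mon_eq (a : ℕ) {α β : Fin (m + 2) → ℕ} {x₀ y₀ x₁ y₁ : ℕ} {δ : Fin m → ℕ}
    (h0 : α 0 + y₀ = x₀ + β 0) (h0' : x₀ = 0 ∨ y₀ = 0) (h1 : α 1 + y₁ = x₁ + β 1)
    (h1' : x₁ = 0 ∨ y₁ = 0) (h2 : ∀ j : Fin m, α j.succ.succ = δ j + β j.succ.succ) :
    ∃ γ, ∀ p : PhaseSpace m, mon a 0 α β p = normProd γ p * ((p.1 : ℂ) ^ a *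
      (p.2.2 0 ^ x₀ * conj (p.2.2 0) ^ y₀ * (p.2.2 1 ^ x₁ * conj (p.2.2 1) ^ y₁) *
        ∏ j : Fin m, p.2.2 j.succ.succ ^ δ j)) := by
  refine ⟨fun l => min (α l) (β l), fun p => ?_⟩
  have key : ∀ (z : ℂ) (x y a b : ℕ), a + y = x + b → (x = 0 ∨ y = 0) →
      z ^ a * conj z ^ b = ((‖z‖ ^ 2) ^ min a b : ℝ) * (z ^ x * conj z ^ y) := by
    intro z x y a b h h'
    have ea : a = min a b + x := by omega
    have eb : b = min a b + y := by omega
    have hz : ((‖z‖ ^ 2 : ℝ) : ℂ) = z * conj z := by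
      rw [Complex.mul_conj, Complex.normSq_eq_norm_sq]
    generalize min a b = g at ea eb ⊢
    rw [ea, eb, Complex.ofReal_pow, hz]
    ring
  have h2' : ∀ j : Fin m, p.2.2 j.succ.succ ^ α j.succ.succ
      * conj (p.2.2 j.succ.succ) ^ β j.succ.succ
      = ((‖p.2.2 j.succ.succ‖ ^ 2) ^ min (α j.succ.succ) (β j.succ.succ) : ℝ)
        * p.2.2 j.succ.succ ^ δ j := by
    intro j
    have := key (p.2.2 j.succ.succ) (δ j) 0 _ _ (by have := h2 j; omega) (Or.inr rfl)
    rwa [pow_zero, mul_one] at this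
  have k0 := key (p.2.2 0) _ _ _ _ h0 h0'
  have k1 := key (p.2.2 1) _ _ _ _ h1 h1'
  have hs : (Fin.succ 0 : Fin (m + 2)) = 1 := rfl
  have htail : (∏ j : Fin m, p.2.2 j.succ.succ ^ α j.succ.succ)
      * ∏ j : Fin m, conj (p.2.2 j.succ.succ) ^ β j.succ.succ
      = ((∏ j : Fin m, (‖p.2.2 j.succ.succ‖ ^ 2) ^ min (α j.succ.succ) (β j.succ.succ) : ℝ) : ℂ)
        * ∏ j : Fin m, p.2.2 j.succ.succ ^ δ j := by
    rw [Complex.ofReal_prod, ← Finset.prod_mul_distrib, ← Finset.prod_mul_distrib]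
    exact Finset.prod_congr rfl fun j _ => h2' j
  simp only [mon, normProd, Fin.prod_univ_succ, hs]
  calc _ = (p.1 : ℂ) ^ a * ((p.2.2 0 ^ α 0 * conj (p.2.2 0) ^ β 0)
        * (p.2.2 1 ^ α 1 * conj (p.2.2 1) ^ β 1)
        * ((∏ j : Fin m, p.2.2 j.succ.succ ^ α j.succ.succ)
          * ∏ j : Fin m, conj (p.2.2 j.succ.succ) ^ β j.succ.succ)) := by ring
    _ = _ := by
      rw [k0, k1, htail, Complex.ofReal_mul, Complex.ofReal_mul]
      ring

variable {n₁ n₂ : ℕ} {ω : Fin (m + 2) → ℝ}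

/-- Multiplying the relation by n₁ and using n₁ω₂ = n₂ω₁ eliminates ω₂. Independence of the other
frequencies gives n₁ d 0 + n₂ d 1 = 0 and kills the remaining entries; coprimality then gives n₂ ∣ d
0. -/
lemma resonance_int (hn₁ : 0 < n₁) (hn₂ : 0 < n₂) (hcop : Nat.Coprime n₁ n₂)
    (hres : (n₁ : ℝ) * ω 1 - (n₂ : ℝ) * ω 0 = 0)
    (hind : LinearIndependent ℚ (Matrix.vecCons (ω 0) (fun j : Fin m => ω j.succ.succ)))
    {d : Fin (m + 2) → ℤ} (hd : ∑ j, ω j * d j = 0) :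
    ∃ t : ℤ, d 0 = n₂ * t ∧ d 1 = -(n₁ * t) ∧ ∀ j : Fin m, d j.succ.succ = 0 := by
  have hs : (Fin.succ 0 : Fin (m + 2)) = 1 := rfl
  rw [Fintype.linearIndependent_iff] at hind
  have h := hind (Matrix.vecCons ((n₁ : ℚ) * d 0 + n₂ * d 1) fun j => n₁ * d j.succ.succ) (by
    rw [Fin.sum_univ_succ]
    simp only [Matrix.cons_val_zero, Matrix.cons_val_succ, Rat.smul_def]
    rw [Fin.sum_univ_succ, Fin.sum_univ_succ, hs] at hd
    have : ∑ j : Fin m, ((n₁ * d j.succ.succ : ℚ) : ℝ) * ω j.succ.succ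
        = n₁ * ∑ j : Fin m, ω j.succ.succ * d j.succ.succ := by
      rw [Finset.mul_sum]
      refine Finset.sum_congr rfl fun j _ => ?_
      push_cast; ring
    rw [this]
    push_cast
    linear_combination (n₁ : ℝ) * hd - (d 1 : ℝ) * hres)
  have h0 := h 0
  simp only [Matrix.cons_val_zero] at h0
  have h0' : (n₁ : ℤ) * d 0 + n₂ * d 1 = 0 := by exact_mod_cast h0
  have htail : ∀ j : Fin m, d j.succ.succ = 0 := by
    intro j
    have hj := h j.succ
    simp only [Matrix.cons_val_succ] at hj
    have hj' : (n₁ : ℤ) * d j.succ.succ = 0 := by exact_mod_cast hj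
    exact (mul_eq_zero.1 hj').resolve_left (by positivity)
  have hdvd : (n₂ : ℤ) ∣ d 0 := by
    have : IsCoprime (n₂ : ℤ) n₁ := (Nat.isCoprime_iff_coprime.2 hcop).symm
    refine this.dvd_of_dvd_mul_left ⟨-d 1, by linarith⟩
  obtain ⟨t, ht⟩ := hdvd
  refine ⟨t, ht, ?_, htail⟩
  rw [ht] at h0'
  have hn' : (n₂ : ℤ) ≠ 0 := by positivity
  apply mul_left_cancel₀ hn'
  linarith

lemma sum_of_freq_add {α β : Fin (m + 2) → ℕ} {c : ℝ} (h : freq ω α β + Complex.I * c = 0) :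
    ∑ j, ω j * ((α j : ℤ) - (β j : ℤ) : ℤ) = c := by
  have h1 : Complex.I * (∑ j, (ω j : ℂ) * ((α j : ℂ) - β j) - c) = 0 := by
    rw [← neg_eq_zero, ← h, freq]; ring
  have h2 := sub_eq_zero.1 ((mul_eq_zero.1 h1).resolve_left Complex.I_ne_zero)
  have : ((∑ j, ω j * ((α j : ℤ) - (β j : ℤ) : ℤ) : ℝ) : ℂ) = c := by
    push_cast; exact h2
  exact_mod_cast this

/-- The function `∏ |z_j|^{2γ_j} x₁ᵏ wᵗ`. -/
def resCore (n₁ n₂ : ℕ) (γ : Fin (m + 2) → ℕ) (k t : ℕ) (p : PhaseSpace m) : ℂ :=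
  normProd γ p * ((p.1 : ℂ) ^ k * resMon n₁ n₂ p.2.2 ^ t)

lemma conj_resCore (γ : Fin (m + 2) → ℕ) (k t : ℕ) (p : PhaseSpace m) :
    conj (resCore n₁ n₂ γ k t p)
      = normProd γ p * ((p.1 : ℂ) ^ k * conj (resMon n₁ n₂ p.2.2) ^ t) := by
  simp [resCore]

/-- The exponent difference is t·(n₂, −n₁, 0, …); the sign of t decides between powers of w and of
w̄. -/
lemma resonant_mon_zero (hn₁ : 0 < n₁) (hn₂ : 0 < n₂) (hcop : Nat.Coprime n₁ n₂)
    (hres : (n₁ : ℝ) * ω 1 - (n₂ : ℝ) * ω 0 = 0)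
    (hind : LinearIndependent ℚ (Matrix.vecCons (ω 0) (fun j : Fin m => ω j.succ.succ)))
    (k : ℕ) {α β : Fin (m + 2) → ℕ} (h : freq ω α β + 0 = 0) :
    ∃ γ t, (∀ p, mon k 0 α β p = resCore n₁ n₂ γ k t p) ∨
      ∀ p, mon k 0 α β p = conj (resCore n₁ n₂ γ k t p) := by
  have hs := sum_of_freq_add (c := 0) (ω := ω) (α := α) (β := β) (by simpa using h)
  obtain ⟨t, h0, h1, h2⟩ := resonance_int hn₁ hn₂ hcop hres hind hs
  have h2' : ∀ j : Fin m, α j.succ.succ = (0 : Fin m → ℕ) j + β j.succ.succ := by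
    intro j; have := h2 j; simp; omega
  obtain ⟨t, rfl | rfl⟩ := Int.eq_nat_or_neg t
  · obtain ⟨γ, hγ⟩ := exists_mon_eq k (x₀ := n₂ * t) (y₀ := 0) (x₁ := 0) (y₁ := n₁ * t)
      (by zify; linarith) (Or.inr rfl) (by zify; linarith) (Or.inl rfl) h2'
    refine ⟨γ, t, Or.inl fun p => ?_⟩
    rw [hγ, resCore, resMon]
    simp [mul_pow, pow_mul]
  · obtain ⟨γ, hγ⟩ := exists_mon_eq k (x₀ := 0) (y₀ := n₂ * t) (x₁ := n₁ * t) (y₁ := 0)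
      (by zify; linarith) (Or.inl rfl) (by zify; linarith) (Or.inr rfl) h2'
    refine ⟨γ, t, Or.inr fun p => ?_⟩
    rw [hγ, conj_resCore, resMon]
    simp [mul_pow, pow_mul]

/-- Resonance in the j-th component means ω·(α − β) = ω_j. Subtracting the j-th unit vector makes
the relation homogeneous, so that `resonance_int` applies. -/
lemma resonant_sub_single {α β : Fin (m + 2) → ℕ} {j : Fin (m + 2)}
    (h : freq ω α β + Complex.I * ω j = 0) :
    ∑ l, ω l * (((α l : ℤ) - (β l : ℤ) - Pi.single (M := fun _ => ℤ) j 1 l : ℤ) : ℝ) = 0 := by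
  have hs := sum_of_freq_add h
  have : ∀ l, ω l * (((α l : ℤ) - (β l : ℤ) - Pi.single (M := fun _ => ℤ) j 1 l : ℤ) : ℝ)
      = ω l * (((α l : ℤ) - (β l : ℤ) : ℤ) : ℝ) - (Pi.single j (ω j) : Fin (m + 2) → ℝ) l := by
    intro l
    rcases eq_or_ne l j with rfl | hl
    · simp; ring
    · simp [hl]
  rw [Finset.sum_congr rfl fun l _ => this l, Finset.sum_sub_distrib, hs]
  simp

/-- The exponent difference is (1 + n₂t, −n₁t). For t ≥ 0 this is `z 0` times wᵗ. For t = −(t' + 1),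
the factor `z 0` cancels one of the n₂(t' + 1) conjugates, leaving P·w̄^t'. -/
lemma resonant_mon_first (hn₁ : 0 < n₁) (hn₂ : 0 < n₂) (hcop : Nat.Coprime n₁ n₂)
    (hres : (n₁ : ℝ) * ω 1 - (n₂ : ℝ) * ω 0 = 0)
    (hind : LinearIndependent ℚ (Matrix.vecCons (ω 0) (fun j : Fin m => ω j.succ.succ)))
    (k : ℕ) {α β : Fin (m + 2) → ℕ} (h : freq ω α β + Complex.I * ω 0 = 0) :
    ∃ γ t, (∀ p, mon k 0 α β p = p.2.2 0 * resCore n₁ n₂ γ k t p) ∨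
      ∀ p, mon k 0 α β p = resMon₁ n₁ n₂ p.2.2 * conj (resCore n₁ n₂ γ k t p) := by
  obtain ⟨t, h0, h1, h2⟩ := resonance_int hn₁ hn₂ hcop hres hind (resonant_sub_single h)
  have h2' : ∀ j : Fin m, α j.succ.succ = (0 : Fin m → ℕ) j + β j.succ.succ := by
    intro j; have := h2 j; simp at this ⊢; omega
  simp only [Pi.single_eq_same, Pi.single_eq_of_ne (one_ne_zero : (1 : Fin (m + 2)) ≠ 0)] at h0 h1
  rcases t with t | t
  · simp only [Int.ofNat_eq_natCast] at h0 h1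
    obtain ⟨γ, hγ⟩ := exists_mon_eq k (x₀ := n₂ * t + 1) (y₀ := 0) (x₁ := 0) (y₁ := n₁ * t)
      (by zify; linarith) (Or.inr rfl) (by zify; linarith) (Or.inl rfl) h2'
    refine ⟨γ, t, Or.inl fun p => ?_⟩
    rw [hγ, resCore, resMon]
    simp [mul_pow, pow_mul, pow_succ]
    ring
  · rw [Int.negSucc_eq] at h0 h1
    have e : n₂ * (t + 1) = n₂ * t + (n₂ - 1) + 1 := by rw [mul_add]; omega
    have e' : (n₂ : ℤ) * (t + 1) = ((n₂ * t + (n₂ - 1) : ℕ) : ℤ) + 1 := by exact_mod_cast e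
    obtain ⟨γ, hγ⟩ := exists_mon_eq k (x₀ := 0) (y₀ := n₂ * t + (n₂ - 1)) (x₁ := n₁ * (t + 1))
      (y₁ := 0) (by zify at e' ⊢; linarith) (Or.inl rfl) (by zify; linarith) (Or.inr rfl) h2'
    refine ⟨γ, t, Or.inr fun p => ?_⟩
    rw [hγ, conj_resCore, resMon, resMon₁]
    simp [mul_pow, pow_mul, pow_add, mul_add]
    ring

lemma resonant_mon_second (hn₁ : 0 < n₁) (hn₂ : 0 < n₂) (hcop : Nat.Coprime n₁ n₂)
    (hres : (n₁ : ℝ) * ω 1 - (n₂ : ℝ) * ω 0 = 0)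
    (hind : LinearIndependent ℚ (Matrix.vecCons (ω 0) (fun j : Fin m => ω j.succ.succ)))
    (k : ℕ) {α β : Fin (m + 2) → ℕ} (h : freq ω α β + Complex.I * ω 1 = 0) :
    ∃ γ t, (∀ p, mon k 0 α β p = p.2.2 1 * conj (resCore n₁ n₂ γ k t p)) ∨
      ∀ p, mon k 0 α β p = resMon₂ n₁ n₂ p.2.2 * resCore n₁ n₂ γ k t p := by
  obtain ⟨t, h0, h1, h2⟩ := resonance_int hn₁ hn₂ hcop hres hind (resonant_sub_single h)
  have h2' : ∀ j : Fin m, α j.succ.succ = (0 : Fin m → ℕ) j + β j.succ.succ := by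
    intro j
    have := h2 j
    have hj : j.succ.succ ≠ (1 : Fin (m + 2)) := by
      intro hj; simpa using congrArg Fin.val hj
    simp [hj] at this ⊢; omega
  simp only [Pi.single_eq_same, Pi.single_eq_of_ne (zero_ne_one : (0 : Fin (m + 2)) ≠ 1)] at h0 h1
  -- The sign is flipped because w contains the conjugate of `z 1`: nonnegative t now gives `z 1`
  -- times a power of w̄, and negative t gives Q times a power of w.
  obtain ⟨t, rfl⟩ : ∃ t', t = -t' := ⟨-t, by ring⟩
  rcases t with t | t
  · simp only [Int.ofNat_eq_natCast] at h0 h1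
    obtain ⟨γ, hγ⟩ := exists_mon_eq k (x₀ := 0) (y₀ := n₂ * t) (x₁ := n₁ * t + 1) (y₁ := 0)
      (by zify; linarith) (Or.inl rfl) (by zify; linarith) (Or.inr rfl) h2'
    refine ⟨γ, t, Or.inl fun p => ?_⟩
    rw [hγ, conj_resCore, resMon]
    simp [mul_pow, pow_mul, pow_succ]
    ring
  · rw [Int.negSucc_eq] at h0 h1
    have e : n₁ * (t + 1) = n₁ * t + (n₁ - 1) + 1 := by rw [mul_add]; omega
    have e' : (n₁ : ℤ) * (t + 1) = ((n₁ * t + (n₁ - 1) : ℕ) : ℤ) + 1 := by exact_mod_cast e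
    obtain ⟨γ, hγ⟩ := exists_mon_eq k (x₀ := n₂ * (t + 1)) (y₀ := 0) (x₁ := 0)
      (y₁ := n₁ * t + (n₁ - 1)) (by zify; linarith) (Or.inr rfl) (by zify at e' ⊢; linarith)
      (Or.inl rfl) h2'
    refine ⟨γ, t, Or.inr fun p => ?_⟩
    rw [hγ, resCore, resMon, resMon₂]
    simp [mul_pow, pow_mul, pow_add, mul_add]
    ring

lemma resonant_mon_tail (hn₁ : 0 < n₁) (hn₂ : 0 < n₂) (hcop : Nat.Coprime n₁ n₂)
    (hres : (n₁ : ℝ) * ω 1 - (n₂ : ℝ) * ω 0 = 0)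
    (hind : LinearIndependent ℚ (Matrix.vecCons (ω 0) (fun j : Fin m => ω j.succ.succ)))
    (k : ℕ) {α β : Fin (m + 2) → ℕ} {j : Fin m}
    (h : freq ω α β + Complex.I * ω j.succ.succ = 0) :
    ∃ γ t, (∀ p, mon k 0 α β p = p.2.2 j.succ.succ * resCore n₁ n₂ γ k t p) ∨
      ∀ p, mon k 0 α β p = p.2.2 j.succ.succ * conj (resCore n₁ n₂ γ k t p) := by
  obtain ⟨t, h0, h1, h2⟩ := resonance_int hn₁ hn₂ hcop hres hind (resonant_sub_single h)
  have hj0 : (0 : Fin (m + 2)) ≠ j.succ.succ := (Fin.succ_ne_zero _).symm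
  have hj1 : (1 : Fin (m + 2)) ≠ j.succ.succ := by
    intro hj; simpa using congrArg Fin.val hj
  have h2' : ∀ l : Fin m, α l.succ.succ = (Pi.single j 1 : Fin m → ℕ) l + β l.succ.succ := by
    intro l
    have := h2 l
    rcases eq_or_ne l j with rfl | hl
    · simp at this ⊢; omega
    · have hl' : l.succ.succ ≠ j.succ.succ := by simpa using hl
      simp only [Pi.single_eq_of_ne hl', Pi.single_eq_of_ne hl] at this ⊢; omega
  have hprod : ∀ p : PhaseSpace m,
      ∏ l : Fin m, p.2.2 l.succ.succ ^ (Pi.single j 1 : Fin m → ℕ) l = p.2.2 j.succ.succ := by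
    intro p
    rw [Finset.prod_eq_single j]
    · simp
    · intro l _ hl; simp [hl]
    · simp
  simp only [Pi.single_eq_of_ne hj0, Pi.single_eq_of_ne hj1] at h0 h1
  obtain ⟨t, rfl | rfl⟩ := Int.eq_nat_or_neg t
  · obtain ⟨γ, hγ⟩ := exists_mon_eq k (x₀ := n₂ * t) (y₀ := 0) (x₁ := 0) (y₁ := n₁ * t)
      (by zify; linarith) (Or.inr rfl) (by zify; linarith) (Or.inl rfl) h2'
    refine ⟨γ, t, Or.inl fun p => ?_⟩
    rw [hγ, hprod, resCore, resMon]
    simp [mul_pow, pow_mul]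
    ring
  · obtain ⟨γ, hγ⟩ := exists_mon_eq k (x₀ := 0) (y₀ := n₂ * t) (x₁ := n₁ * t) (y₁ := 0)
      (by zify; linarith) (Or.inl rfl) (by zify; linarith) (Or.inr rfl) h2'
    refine ⟨γ, t, Or.inr fun p => ?_⟩
    rw [hγ, hprod, conj_resCore, resMon]
    simp [mul_pow, pow_mul]
    ring

end Resonance

/-! ### Spaces of bireversible resonant vector fields -/

section Admissible

variable {m : ℕ}

/-- The function `x₁ᵏ Rˡ`. -/
def xPow (n₁ n₂ k l : ℕ) (p : PhaseSpace m) : ℝ := p.1 ^ k * (resMon n₁ n₂ p.2.2).re ^ l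

/-- Spaces of vector fields which contain the generators of the bireversible resonant vector
fields, where `s` is the sign of the resonant monomial. -/
structure Admissible (n₁ n₂ : ℕ) (a₀ s : ℤˣ) (N : Submodule ℝ (PhaseSpace m → PhaseSpace m)) :
    Prop where
  normSq_smul : ∀ j, ∀ Y ∈ N, (fun p => (‖p.2.2 j‖ ^ 2) • Y p) ∈ N
  fieldX_mem : ∀ k l, a₀ ^ k * s ^ (l + 1) = 1 →
    fieldX (fun p => xPow n₁ n₂ k l p * (resMon n₁ n₂ p.2.2).im) ∈ N
  fieldH_mem : ∀ k l, a₀ ^ k * s ^ l = a₀ → fieldH (fun p => xPow n₁ n₂ k l p) ∈ N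
  fieldZ_mem : ∀ j k l, a₀ ^ k * s ^ l = 1 →
    fieldZ j (fun p => Complex.I * p.2.2 j * xPow n₁ n₂ k l p) ∈ N
  fieldZ_im_mem : ∀ j k l, a₀ ^ k * s ^ (l + 1) = 1 →
    fieldZ j (fun p => p.2.2 j * (xPow n₁ n₂ k l p * (resMon n₁ n₂ p.2.2).im : ℝ)) ∈ N
  fieldP_mem : ∀ k l, a₀ ^ k * s ^ (l + 1) = 1 →
    fieldZ 0 (fun p => Complex.I * resMon₁ n₁ n₂ p.2.2 * xPow n₁ n₂ k l p) ∈ N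
  fieldP_im_mem : ∀ k l, a₀ ^ k * s ^ l = 1 →
    fieldZ 0 (fun p => resMon₁ n₁ n₂ p.2.2 *
      (xPow n₁ n₂ k l p * (resMon n₁ n₂ p.2.2).im : ℝ)) ∈ N
  fieldQ_mem : ∀ k l, a₀ ^ k * s ^ (l + 1) = 1 →
    fieldZ 1 (fun p => Complex.I * resMon₂ n₁ n₂ p.2.2 * xPow n₁ n₂ k l p) ∈ N
  fieldQ_im_mem : ∀ k l, a₀ ^ k * s ^ l = 1 →
    fieldZ 1 (fun p => resMon₂ n₁ n₂ p.2.2 *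
      (xPow n₁ n₂ k l p * (resMon n₁ n₂ p.2.2).im : ℝ)) ∈ N

variable {n₁ n₂ : ℕ} {a₀ s : ℤˣ} {N : Submodule ℝ (PhaseSpace m → PhaseSpace m)}

lemma normProd_smul_mem (hN : ∀ j, ∀ Y ∈ N, (fun p => (‖p.2.2 j‖ ^ 2) • Y p) ∈ N)
    (γ : Fin (m + 2) → ℕ) {Y : PhaseSpace m → PhaseSpace m} (hY : Y ∈ N) :
    (fun p => normProd γ p • Y p) ∈ N := by
  have hpow : ∀ j n, ∀ Y ∈ N, (fun p => ((‖p.2.2 j‖ ^ 2) ^ n) • Y p) ∈ N := by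
    intro j n
    induction n with
    | zero => intro Y hY; simpa using hY
    | succ n ih =>
      intro Y hY
      convert hN j _ (ih Y hY) using 1
      ext1 p
      rw [smul_smul, pow_succ']
  have hset : ∀ t : Finset (Fin (m + 2)), ∀ Y ∈ N,
      (fun p => (∏ j ∈ t, (‖p.2.2 j‖ ^ 2) ^ γ j) • Y p) ∈ N := by
    intro t
    induction t using Finset.induction_on with
    | empty => intro Y hY; simpa using hY
    | insert j t hj ih =>
      intro Y hY
      convert hpow j (γ j) _ (ih Y hY) using 1
      ext1 p
      rw [Finset.prod_insert hj, smul_smul]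
  exact hset Finset.univ Y hY

lemma normSq_resMon (z : Fin (m + 2) → ℂ) : Complex.normSq (resMon n₁ n₂ z)
    = (‖z 0‖ ^ 2) ^ n₂ * (‖z 1‖ ^ 2) ^ n₁ := by
  simp [resMon, Complex.normSq_eq_norm_sq, pow_right_comm]
  ring

/-- The number w is a root of its real quadratic: w^(t+2) = 2R·w^(t+1) − |w|²·w^t. In the first term
R takes over one factor w, keeping l + t; in the second l + t drops by two, which no sign notices.
As |w|² is a product of the |z_j|², only the cases t = 0, 1 remain. -/
lemma map_pow_mem (hN : ∀ j, ∀ Y ∈ N, (fun p => (‖p.2.2 j‖ ^ 2) • Y p) ∈ N)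
    (Ψ : (PhaseSpace m → ℂ) →ₗ[ℝ] PhaseSpace m → PhaseSpace m)
    (hΨ : ∀ (r : PhaseSpace m → ℝ) f, Ψ (fun p => r p * f p) = fun p => r p • Ψ f p) {c : ℤˣ}
    (h0 : ∀ k l, a₀ ^ k * s ^ l = c → Ψ (fun p => (xPow n₁ n₂ k l p : ℂ)) ∈ N)
    (h1 : ∀ k l, a₀ ^ k * s ^ (l + 1) = c →
      Ψ (fun p => xPow n₁ n₂ k l p * resMon n₁ n₂ p.2.2) ∈ N) :
    ∀ t k l, a₀ ^ k * s ^ (l + t) = c →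
      Ψ (fun p => xPow n₁ n₂ k l p * resMon n₁ n₂ p.2.2 ^ t) ∈ N := by
  intro t
  induction t using Nat.twoStepInduction with
  | zero => intro k l h; simpa using h0 k l h
  | one => intro k l h; simpa using h1 k l h
  | more t ih ih' =>
    intro k l h
    have h2 := ih' k (l + 1) (by rw [← h]; congr 2; ring)
    have h3 := ih k l (by
      rw [← h, show l + (t + 2) = (l + t) + 2 by ring, pow_add s (l + t) 2, Int.units_sq, mul_one])
    have h4 : (fun p : PhaseSpace m => (xPow n₁ n₂ k l p : ℂ) * resMon n₁ n₂ p.2.2 ^ (t + 2))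
        = (2 : ℝ) • (fun p => (xPow n₁ n₂ k (l + 1) p : ℂ) * resMon n₁ n₂ p.2.2 ^ (t + 1))
        - (fun p => ((Complex.normSq (resMon n₁ n₂ p.2.2) : ℝ) : ℂ) *
          ((xPow n₁ n₂ k l p : ℂ) * resMon n₁ n₂ p.2.2 ^ t)) := by
      ext p
      simp only [Pi.sub_apply, Pi.smul_apply, Complex.real_smul, xPow, Complex.normSq_eq_conj_mul_self]
      have h5 : (((resMon n₁ n₂ p.2.2).re : ℝ) : ℂ)
          = (resMon n₁ n₂ p.2.2 + conj (resMon n₁ n₂ p.2.2)) / 2 := Complex.re_eq_add_conj _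
      push_cast
      rw [pow_succ (((resMon n₁ n₂ p.2.2).re : ℝ) : ℂ) l]
      generalize hR : (((resMon n₁ n₂ p.2.2).re : ℝ) : ℂ) ^ l = R
      rw [h5]
      ring
    rw [h4, map_sub, map_smul]
    refine Submodule.sub_mem _ (Submodule.smul_mem _ _ h2) ?_
    rw [hΨ (fun p => Complex.normSq (resMon n₁ n₂ p.2.2))]
    -- The exponents are those of |w|² = |z 0|^(2n₂)·|z 1|^(2n₁).
    convert normProd_smul_mem hN (Pi.single 0 n₂ + Pi.single 1 n₁) h3 using 1
    ext1 p
    congr 1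
    rw [normSq_resMon, normProd]
    simp only [Pi.add_apply, pow_add, Finset.prod_mul_distrib]
    congr 1
    · rw [Finset.prod_eq_single 0] <;> simp +contextual
    · rw [Finset.prod_eq_single 1] <;> simp +contextual

lemma map_resCore_mem (hN : ∀ j, ∀ Y ∈ N, (fun p => (‖p.2.2 j‖ ^ 2) • Y p) ∈ N)
    (Ψ : (PhaseSpace m → ℂ) →ₗ[ℝ] PhaseSpace m → PhaseSpace m)
    (hΨ : ∀ (r : PhaseSpace m → ℝ) f, Ψ (fun p => r p * f p) = fun p => r p • Ψ f p) {c : ℤˣ}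
    (h0 : ∀ k l, a₀ ^ k * s ^ l = c → Ψ (fun p => (xPow n₁ n₂ k l p : ℂ)) ∈ N)
    (h1 : ∀ k l, a₀ ^ k * s ^ (l + 1) = c →
      Ψ (fun p => xPow n₁ n₂ k l p * resMon n₁ n₂ p.2.2) ∈ N)
    (γ : Fin (m + 2) → ℕ) {k t : ℕ} (h : a₀ ^ k * s ^ t = c) : Ψ (resCore n₁ n₂ γ k t) ∈ N := by
  have h2 := normProd_smul_mem hN γ (map_pow_mem hN Ψ hΨ h0 h1 t k 0 (by simpa using h))
  rw [← hΨ] at h2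
  convert h2 using 2
  ext p
  simp [resCore, xPow]

/-- Multiplication of a vector field component by a fixed function, as a linear map. -/
def mulZ (j : Fin (m + 2)) (g : PhaseSpace m → ℂ) :
    (PhaseSpace m → ℂ) →ₗ[ℝ] PhaseSpace m → PhaseSpace m :=
  (fieldZ j).comp (LinearMap.mulLeft ℝ g)

/-- Multiplication of the conjugate by a fixed function, as a linear map. -/
def mulConjZ (j : Fin (m + 2)) (g : PhaseSpace m → ℂ) :
    (PhaseSpace m → ℂ) →ₗ[ℝ] PhaseSpace m → PhaseSpace m :=
  (mulZ j g).comp (Complex.conjAe.toLinearMap.compLeft (PhaseSpace m))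

lemma mulZ_apply (j : Fin (m + 2)) (g f : PhaseSpace m → ℂ) :
    mulZ j g f = fieldZ j fun p => g p * f p := rfl

lemma mulConjZ_apply (j : Fin (m + 2)) (g f : PhaseSpace m → ℂ) :
    mulConjZ j g f = fieldZ j fun p => g p * conj (f p) := rfl

lemma fieldZ_real_mul (j : Fin (m + 2)) (r : PhaseSpace m → ℝ) (f : PhaseSpace m → ℂ) :
    fieldZ j (fun p => (r p : ℂ) * f p) = fun p => r p • fieldZ j f p := by
  ext p l
  · simp [fieldZ_apply]
  · simp [fieldZ_apply]
  · rcases eq_or_ne l j with rfl | hl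
    · simp [fieldZ_apply]
    · simp [fieldZ_apply, hl]

lemma mulZ_real_mul (j : Fin (m + 2)) (g : PhaseSpace m → ℂ) (r : PhaseSpace m → ℝ)
    (f : PhaseSpace m → ℂ) : mulZ j g (fun p => (r p : ℂ) * f p) = fun p => r p • mulZ j g f p := by
  simp only [mulZ_apply]
  rw [← fieldZ_real_mul]
  congr 1; ext p; ring

lemma mulConjZ_real_mul (j : Fin (m + 2)) (g : PhaseSpace m → ℂ) (r : PhaseSpace m → ℝ)
    (f : PhaseSpace m → ℂ) :
    mulConjZ j g (fun p => (r p : ℂ) * f p) = fun p => r p • mulConjZ j g f p := by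
  simp only [mulConjZ_apply]
  rw [← fieldZ_real_mul]
  congr 1; ext p; simp; ring

/-- Of the two base cases of `map_resCore_mem`, the one without w has zero imaginary part and the
one with w gives J. -/
lemma Admissible.fieldX_resCore (hN : Admissible n₁ n₂ a₀ s N) (γ : Fin (m + 2) → ℕ) {k t : ℕ}
    (h : a₀ ^ k * s ^ t = 1) : fieldX (fun p => (resCore n₁ n₂ γ k t p).im) ∈ N := by
  refine map_resCore_mem hN.normSq_smul (fieldX.comp (Complex.imLm.compLeft (PhaseSpace m)))
    (fun r f => ?_) (fun k l _ => ?_) (fun k l hkl => ?_) γ h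
  · ext p <;> simp [fieldX_apply] <;> ring
  · convert N.zero_mem using 1
    ext p <;> simp [fieldX_apply]
  · convert hN.fieldX_mem k l hkl using 1
    ext p <;> simp [fieldX_apply]

lemma Admissible.fieldH_resCore (hN : Admissible n₁ n₂ a₀ s N) (γ : Fin (m + 2) → ℕ) {k t : ℕ}
    (h : a₀ ^ k * s ^ t = a₀) : fieldH (fun p => (resCore n₁ n₂ γ k t p).re) ∈ N := by
  refine map_resCore_mem hN.normSq_smul (fieldH.comp (Complex.reLm.compLeft (PhaseSpace m)))
    (fun r f => ?_) (fun k l hkl => ?_) (fun k l hkl => ?_) γ h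
  · ext p <;> simp [fieldH_apply]
  · convert hN.fieldH_mem k l hkl using 1
    ext p <;> simp [fieldH_apply]
  · convert hN.fieldH_mem k (l + 1) hkl using 1
    ext p
    · simp [fieldH_apply]
    · simp only [LinearMap.comp_apply, fieldH_apply, LinearMap.compLeft_apply, Function.comp_apply,
        Complex.reLm_coe, Complex.re_ofReal_mul, xPow]
      ring
    · simp [fieldH_apply]

lemma sub_eq_re_add_im (w : ℂ) : w = w.re + w.im * Complex.I := (Complex.re_add_im w).symm

/-- The four families of `z`-components of resonant vector fields. -/
lemma Admissible.mulZ_resCore (hN : Admissible n₁ n₂ a₀ s N) (γ : Fin (m + 2) → ℕ) {k t : ℕ}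
    (h : a₀ ^ k * s ^ t = 1) (j : Fin (m + 2)) :
    fieldZ j (fun p => Complex.I * (p.2.2 j * resCore n₁ n₂ γ k t p)) ∈ N := by
  have := map_resCore_mem hN.normSq_smul (mulZ j fun p => Complex.I * p.2.2 j) (mulZ_real_mul j _)
    (fun k l hkl => hN.fieldZ_mem j k l hkl) (fun k l hkl => ?_) γ h
  · simpa [mulZ_apply, mul_assoc] using this
  · have h1 := hN.fieldZ_mem j k (l + 1) hkl
    have h2 := hN.fieldZ_im_mem j k l hkl
    convert N.sub_mem h1 h2 using 1
    rw [mulZ_apply, ← map_sub]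
    congr 1
    ext p
    have := sub_eq_re_add_im (resMon n₁ n₂ p.2.2)
    simp only [Pi.sub_apply, xPow, pow_succ]
    push_cast
    linear_combination Complex.I * p.2.2 j * p.1 ^ k * ((resMon n₁ n₂ p.2.2).re : ℂ) ^ l * this
      + p.2.2 j * p.1 ^ k * ((resMon n₁ n₂ p.2.2).re : ℂ) ^ l * (resMon n₁ n₂ p.2.2).im
        * Complex.I_sq

/-- The base case is i z w̄ = i z R + z J; the conjugate changes only the sign in front of J. -/
lemma Admissible.mulConjZ_resCore (hN : Admissible n₁ n₂ a₀ s N) (γ : Fin (m + 2) → ℕ) {k t : ℕ}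
    (h : a₀ ^ k * s ^ t = 1) (j : Fin (m + 2)) :
    fieldZ j (fun p => Complex.I * (p.2.2 j * conj (resCore n₁ n₂ γ k t p))) ∈ N := by
  have := map_resCore_mem (n₁ := n₁) (n₂ := n₂) hN.normSq_smul (mulConjZ j fun p => Complex.I * p.2.2 j)
    (mulConjZ_real_mul j _) (fun k l hkl => ?_) (fun k l hkl => ?_) γ h
  · simpa [mulConjZ_apply, mul_assoc] using this
  · simpa [mulConjZ_apply] using hN.fieldZ_mem j k l hkl
  · have h1 := hN.fieldZ_mem j k (l + 1) hkl
    have h2 := hN.fieldZ_im_mem j k l hkl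
    convert N.add_mem h1 h2 using 1
    rw [mulConjZ_apply, ← map_add]
    congr 1
    ext p
    have := congrArg conj (sub_eq_re_add_im (resMon n₁ n₂ p.2.2))
    simp only [Pi.add_apply, xPow, pow_succ, map_mul, map_add, Complex.conj_ofReal,
      Complex.conj_I] at this ⊢
    push_cast
    linear_combination Complex.I * p.2.2 j * p.1 ^ k * ((resMon n₁ n₂ p.2.2).re : ℂ) ^ l * this
      - p.2.2 j * p.1 ^ k * ((resMon n₁ n₂ p.2.2).re : ℂ) ^ l * (resMon n₁ n₂ p.2.2).im
        * Complex.I_sq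

lemma mul_self_units (s : ℤˣ) : s * s = 1 := by rw [← sq, Int.units_sq]

lemma pow_eq_of_pow_succ {k l : ℕ} (h : a₀ ^ k * s ^ (l + 1) = s) : a₀ ^ k * s ^ l = 1 := by
  rw [pow_succ, ← mul_assoc] at h
  exact mul_eq_right.1 h

lemma pow_succ_eq_of_pow {k l : ℕ} (h : a₀ ^ k * s ^ l = s) : a₀ ^ k * s ^ (l + 1) = 1 := by
  rw [pow_succ, ← mul_assoc, h, mul_self_units]

/-- P carries the sign `a 0` times that of w, so its cofactor must carry the sign s instead of 1.
This interchanges the conditions on the two families: i P xᵏRˡ needs the odd sign and P xᵏRˡJ the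
even one. -/
lemma Admissible.mulP_resCore (hN : Admissible n₁ n₂ a₀ s N) (γ : Fin (m + 2) → ℕ) {k t : ℕ}
    (h : a₀ ^ k * s ^ t = s) :
    fieldZ 0 (fun p => Complex.I * (resMon₁ n₁ n₂ p.2.2 * conj (resCore n₁ n₂ γ k t p))) ∈ N := by
  have := map_resCore_mem (n₁ := n₁) (n₂ := n₂) hN.normSq_smul (mulConjZ 0 fun p => Complex.I * resMon₁ n₁ n₂ p.2.2)
    (mulConjZ_real_mul 0 _) (fun k l hkl => ?_) (fun k l hkl => ?_) γ h
  · simpa [mulConjZ_apply, mul_assoc] using this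
  · simpa [mulConjZ_apply] using hN.fieldP_mem k l (pow_succ_eq_of_pow hkl)
  · have h1 := hN.fieldP_mem k (l + 1) (pow_succ_eq_of_pow hkl)
    have h2 := hN.fieldP_im_mem k l (pow_eq_of_pow_succ hkl)
    convert N.add_mem h1 h2 using 1
    rw [mulConjZ_apply, ← map_add]
    congr 1
    ext p
    have := congrArg conj (sub_eq_re_add_im (resMon n₁ n₂ p.2.2))
    simp only [Pi.add_apply, xPow, pow_succ, map_mul, map_add, Complex.conj_ofReal,
      Complex.conj_I] at this ⊢
    push_cast
    linear_combination Complex.I * resMon₁ n₁ n₂ p.2.2 * p.1 ^ k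
        * ((resMon n₁ n₂ p.2.2).re : ℂ) ^ l * this
      - resMon₁ n₁ n₂ p.2.2 * p.1 ^ k * ((resMon n₁ n₂ p.2.2).re : ℂ) ^ l
        * (resMon n₁ n₂ p.2.2).im * Complex.I_sq

lemma Admissible.mulQ_resCore (hN : Admissible n₁ n₂ a₀ s N) (γ : Fin (m + 2) → ℕ) {k t : ℕ}
    (h : a₀ ^ k * s ^ t = s) :
    fieldZ 1 (fun p => Complex.I * (resMon₂ n₁ n₂ p.2.2 * resCore n₁ n₂ γ k t p)) ∈ N := by
  have := map_resCore_mem hN.normSq_smul (mulZ 1 fun p => Complex.I * resMon₂ n₁ n₂ p.2.2)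
    (mulZ_real_mul 1 _) (fun k l hkl => hN.fieldQ_mem k l (pow_succ_eq_of_pow hkl))
    (fun k l hkl => ?_) γ h
  · simpa [mulZ_apply, mul_assoc] using this
  · have h1 := hN.fieldQ_mem k (l + 1) (pow_succ_eq_of_pow hkl)
    have h2 := hN.fieldQ_im_mem k l (pow_eq_of_pow_succ hkl)
    convert N.sub_mem h1 h2 using 1
    rw [mulZ_apply, ← map_sub]
    congr 1
    ext p
    have := sub_eq_re_add_im (resMon n₁ n₂ p.2.2)
    simp only [Pi.sub_apply, xPow, pow_succ]
    push_cast
    linear_combination Complex.I * resMon₂ n₁ n₂ p.2.2 * p.1 ^ k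
        * ((resMon n₁ n₂ p.2.2).re : ℂ) ^ l * this
      + resMon₂ n₁ n₂ p.2.2 * p.1 ^ k * ((resMon n₁ n₂ p.2.2).re : ℂ) ^ l
        * (resMon n₁ n₂ p.2.2).im * Complex.I_sq

/-! ### Signs -/

variable {a : Fin (m + 2) → ℤˣ}

lemma HasSign.mul {s t : ℤˣ} {f g : PhaseSpace m → ℂ} (hf : HasSign a₀ a s f)
    (hg : HasSign a₀ a t g) : HasSign a₀ a (s * t) fun p => f p * g p :=
  ⟨fun p => by simp only [hf.1 p, hg.1 p, map_mul], fun p => by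
    simp only [hf.2 p, hg.2 p, map_mul]; push_cast; ring⟩

lemma HasSign.pow {s : ℤˣ} {f : PhaseSpace m → ℂ} (hf : HasSign a₀ a s f) (n : ℕ) :
    HasSign a₀ a (s ^ n) fun p => f p ^ n :=
  ⟨fun p => by simp only [hf.1 p, map_pow], fun p => by
    simp only [hf.2 p, map_pow, mul_pow]; push_cast; rfl⟩

lemma HasSign.conj {s : ℤˣ} {f : PhaseSpace m → ℂ} (hf : HasSign a₀ a s f) :
    HasSign a₀ a s fun p => conj (f p) :=
  ⟨fun p => by simp only [hf.1 p], fun p => by simp [hf.2 p]⟩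

lemma hasSign_coord (j : Fin (m + 2)) : HasSign a₀ a (a j) fun p => p.2.2 j :=
  ⟨fun p => by simp [psi], fun p => by simp [psi]⟩

lemma hasSign_x₁ : HasSign a₀ a a₀ fun p : PhaseSpace m => (p.1 : ℂ) :=
  ⟨fun p => by simp [psi], fun p => by simp [psi]⟩

lemma normProd_psi (b₀ : ℤˣ) (b : Fin (m + 2) → ℤˣ) (γ : Fin (m + 2) → ℕ) (p : PhaseSpace m) :
    normProd γ (psi b₀ b p) = normProd γ p := by
  refine Finset.prod_congr rfl fun j _ => ?_
  rcases Int.units_eq_one_or (b j) with h | h <;> simp [psi, h]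

lemma hasSign_normProd (γ : Fin (m + 2) → ℕ) :
    HasSign a₀ a 1 fun p : PhaseSpace m => (normProd γ p : ℂ) :=
  ⟨fun p => by simp [normProd_psi], fun p => by simp [normProd_psi]⟩

/-- The sign of the resonant monomial. -/
def resSign (n₁ n₂ : ℕ) (a : Fin (m + 2) → ℤˣ) : ℤˣ := a 0 ^ n₂ * a 1 ^ n₁

lemma hasSign_resMon : HasSign a₀ a (resSign n₁ n₂ a) fun p => resMon n₁ n₂ p.2.2 :=
  ((hasSign_coord 0).pow n₂).mul ((hasSign_coord 1).conj.pow n₁)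

lemma hasSign_resCore (γ : Fin (m + 2) → ℕ) (k t : ℕ) :
    HasSign a₀ a (a₀ ^ k * resSign n₁ n₂ a ^ t) (resCore n₁ n₂ γ k t) := by
  have := (hasSign_normProd (a₀ := a₀) (a := a) γ).mul
    ((hasSign_x₁.pow k).mul ((hasSign_resMon (n₁ := n₁) (n₂ := n₂)).pow t))
  rwa [one_mul] at this

/-- Signs square to 1, so removing one factor z̄₁ from w̄ = z̄₁P multiplies the sign by `a 0`. -/
lemma hasSign_resMon₁ (hn₂ : 0 < n₂) :
    HasSign a₀ a (a 0 * resSign n₁ n₂ a) fun p => resMon₁ n₁ n₂ p.2.2 := by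
  have := ((hasSign_coord (a₀ := a₀) (a := a) 0).conj.pow (n₂ - 1)).mul ((hasSign_coord 1).pow n₁)
  suffices h : a 0 * resSign n₁ n₂ a = a 0 ^ (n₂ - 1) * a 1 ^ n₁ by rw [h]; exact this
  obtain ⟨n, rfl⟩ : ∃ n, n₂ = n + 1 := ⟨n₂ - 1, by omega⟩
  rw [resSign, pow_succ', ← mul_assoc, ← mul_assoc, mul_self_units, one_mul, Nat.add_sub_cancel]

lemma hasSign_resMon₂ (hn₁ : 0 < n₁) :
    HasSign a₀ a (a 1 * resSign n₁ n₂ a) fun p => resMon₂ n₁ n₂ p.2.2 := by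
  have := ((hasSign_coord (a₀ := a₀) (a := a) 0).pow n₂).mul
    ((hasSign_coord 1).conj.pow (n₁ - 1))
  suffices h : a 1 * resSign n₁ n₂ a = a 0 ^ n₂ * a 1 ^ (n₁ - 1) by rw [h]; exact this
  obtain ⟨n, rfl⟩ : ∃ n, n₁ = n + 1 := ⟨n₁ - 1, by omega⟩
  rw [resSign, pow_succ', Nat.add_sub_cancel, mul_comm (a 1), mul_assoc, mul_assoc,
    mul_comm _ (a 1), ← mul_assoc (a 1), mul_self_units, one_mul]

lemma birevPart_fieldZ_mem {N : Submodule ℝ (PhaseSpace m → PhaseSpace m)} {j : Fin (m + 2)}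
    {s : ℤˣ} {f : PhaseSpace m → ℂ} (hf : HasSign a₀ a s f)
    (hm : a j * s = 1 → fieldZ j (fun p => Complex.I * f p) ∈ N) (c : ℂ) :
    birevPart a₀ a (fieldZ j fun p => c * f p) ∈ N := by
  rw [birevPart_fieldZ hf]
  rcases Int.units_eq_one_or (a j * s) with h | h
  · exact N.smul_mem _ (hm h)
  · rw [h]; simp

/-- The map Ψ and the space N are only real, while the span is complex. Quantifying over all complex
multiples makes the span induction close up. -/
lemma mem_of_forall_smul_mem {N : Submodule ℝ (PhaseSpace m → PhaseSpace m)}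
    (Ψ : (PhaseSpace m → ℂ) →ₗ[ℝ] PhaseSpace m → PhaseSpace m) {S : Set (PhaseSpace m → ℂ)}
    (hS : ∀ f ∈ S, ∀ c : ℂ, Ψ (c • f) ∈ N) {f : PhaseSpace m → ℂ}
    (hf : f ∈ Submodule.span ℂ S) : Ψ f ∈ N := by
  suffices h : ∀ c : ℂ, Ψ (c • f) ∈ N by simpa using h 1
  induction hf using Submodule.span_induction with
  | mem f hf => exact hS f hf
  | zero => intro c; simp
  | add f g _ _ hf hg => intro c; rw [smul_add, map_add]; exact N.add_mem (hf c) (hg c)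
  | smul d f _ hf => intro c; rw [smul_smul]; exact hf (c * d)

/-! ### Bireversible parts of resonant vector fields -/

section Resonant

variable {ω : Fin (m + 2) → ℝ}

/-- Monomials conjugate to a core function need no separate treatment, because Re(c f̄) = Re(c̄ f).
-/
lemma birevPart_fieldX_mem (hn₁ : 0 < n₁) (hn₂ : 0 < n₂) (hcop : Nat.Coprime n₁ n₂)
    (hres : (n₁ : ℝ) * ω 1 - (n₂ : ℝ) * ω 0 = 0)
    (hind : LinearIndependent ℚ (Matrix.vecCons (ω 0) (fun j : Fin m => ω j.succ.succ)))
    (hN : Admissible n₁ n₂ a₀ (resSign n₁ n₂ a) N) {k : ℕ} {g : PhaseSpace m → ℂ}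
    (hg : g ∈ resSpan ω 0 k) : birevPart a₀ a (fieldX fun p => (g p).re) ∈ N := by
  refine mem_of_forall_smul_mem
    ((birevPart a₀ a).comp (fieldX.comp (Complex.reLm.compLeft (PhaseSpace m)))) ?_ hg
  rintro f ⟨k, α, β, -, hfr, rfl⟩ c
  have key : ∀ γ t (c : ℂ), birevPart a₀ a (fieldX fun p => (c * resCore n₁ n₂ γ k t p).re) ∈ N := by
    intro γ t c
    rw [birevPart_fieldX (hasSign_resCore γ k t)]
    rcases Int.units_eq_one_or (a₀ ^ k * resSign n₁ n₂ a ^ t) with h | h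
    · exact N.smul_mem _ (hN.fieldX_resCore γ h)
    · rw [h]; simp
  obtain ⟨γ, t, h | h⟩ := resonant_mon_zero hn₁ hn₂ hcop hres hind k hfr
  · have e : (fun p => ((c • mon k 0 α β) p).re) = fun p => (c * resCore n₁ n₂ γ k t p).re := by
      ext p; simp [h p]
    change birevPart a₀ a (fieldX fun p => ((c • mon k 0 α β) p).re) ∈ N
    rw [e]
    exact key γ t c
  · have e : (fun p => ((c • mon k 0 α β) p).re)
        = fun p => (conj c * resCore n₁ n₂ γ k t p).re := by
      ext p; simp [h p]
    change birevPart a₀ a (fieldX fun p => ((c • mon k 0 α β) p).re) ∈ N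
    rw [e]
    exact key γ t (conj c)

lemma birevPart_fieldH_mem (hn₁ : 0 < n₁) (hn₂ : 0 < n₂) (hcop : Nat.Coprime n₁ n₂)
    (hres : (n₁ : ℝ) * ω 1 - (n₂ : ℝ) * ω 0 = 0)
    (hind : LinearIndependent ℚ (Matrix.vecCons (ω 0) (fun j : Fin m => ω j.succ.succ)))
    (hN : Admissible n₁ n₂ a₀ (resSign n₁ n₂ a) N) {k : ℕ} {g : PhaseSpace m → ℂ}
    (hg : g ∈ resSpan ω 0 k) : birevPart a₀ a (fieldH fun p => (g p).re) ∈ N := by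
  refine mem_of_forall_smul_mem
    ((birevPart a₀ a).comp (fieldH.comp (Complex.reLm.compLeft (PhaseSpace m)))) ?_ hg
  rintro f ⟨k, α, β, -, hfr, rfl⟩ c
  have key : ∀ γ t (c : ℂ), birevPart a₀ a (fieldH fun p => (c * resCore n₁ n₂ γ k t p).re) ∈ N := by
    intro γ t c
    rw [birevPart_fieldH (hasSign_resCore γ k t)]
    rcases Int.units_eq_one_or (a₀ * (a₀ ^ k * resSign n₁ n₂ a ^ t)) with h | h
    · refine N.smul_mem _ (hN.fieldH_resCore γ ?_)
      have := congrArg (a₀ * ·) h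
      simpa only [← mul_assoc, mul_self_units, one_mul, mul_one] using this
    · rw [h]; simp
  obtain ⟨γ, t, h | h⟩ := resonant_mon_zero hn₁ hn₂ hcop hres hind k hfr
  · have e : (fun p => ((c • mon k 0 α β) p).re) = fun p => (c * resCore n₁ n₂ γ k t p).re := by
      ext p; simp [h p]
    change birevPart a₀ a (fieldH fun p => ((c • mon k 0 α β) p).re) ∈ N
    rw [e]
    exact key γ t c
  · have e : (fun p => ((c • mon k 0 α β) p).re)
        = fun p => (conj c * resCore n₁ n₂ γ k t p).re := by
      ext p; simp [h p]
    change birevPart a₀ a (fieldH fun p => ((c • mon k 0 α β) p).re) ∈ N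
    rw [e]
    exact key γ t (conj c)

lemma birevPart_fieldZ_mem_of_resSpan (hn₁ : 0 < n₁) (hn₂ : 0 < n₂) (hcop : Nat.Coprime n₁ n₂)
    (hres : (n₁ : ℝ) * ω 1 - (n₂ : ℝ) * ω 0 = 0)
    (hind : LinearIndependent ℚ (Matrix.vecCons (ω 0) (fun j : Fin m => ω j.succ.succ)))
    (hN : Admissible n₁ n₂ a₀ (resSign n₁ n₂ a) N) {k : ℕ} {g : PhaseSpace m → ℂ}
    (j : Fin (m + 2)) (hg : g ∈ resSpan ω (Complex.I * ω j) k) :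
    birevPart a₀ a (fieldZ j g) ∈ N := by
  refine mem_of_forall_smul_mem ((birevPart a₀ a).comp (fieldZ j)) ?_ hg
  rintro f ⟨k, α, β, -, hfr, rfl⟩ c
  have e1 : ∀ j γ t, birevPart a₀ a (fieldZ j fun p => c * (p.2.2 j * resCore n₁ n₂ γ k t p)) ∈ N :=
    fun j γ t => birevPart_fieldZ_mem ((hasSign_coord j).mul (hasSign_resCore γ k t))
      (fun h => hN.mulZ_resCore γ (by rwa [← mul_assoc, mul_self_units, one_mul] at h) j) c
  have e2 : ∀ j γ t,
      birevPart a₀ a (fieldZ j fun p => c * (p.2.2 j * conj (resCore n₁ n₂ γ k t p))) ∈ N :=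
    fun j γ t => birevPart_fieldZ_mem ((hasSign_coord j).mul (hasSign_resCore γ k t).conj)
      (fun h => hN.mulConjZ_resCore γ (by rwa [← mul_assoc, mul_self_units, one_mul] at h) j) c
  -- For P and Q, whose sign is b·s, survival of the averaged field forces the core factor to have
  -- the sign s of w.
  have hs : ∀ (b s u : ℤˣ), b * (b * s * u) = 1 → u = s := by
    intro b s u h
    rw [← mul_assoc, ← mul_assoc, mul_self_units, one_mul] at h
    rw [← one_mul u, ← mul_self_units s, mul_assoc, h, mul_one]
  have e3 : ∀ γ t, birevPart a₀ a
      (fieldZ 0 fun p => c * (resMon₁ n₁ n₂ p.2.2 * conj (resCore n₁ n₂ γ k t p))) ∈ N :=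
    fun γ t => birevPart_fieldZ_mem ((hasSign_resMon₁ hn₂).mul (hasSign_resCore γ k t).conj)
      (fun h => hN.mulP_resCore γ (hs _ _ _ h)) c
  have e4 : ∀ γ t, birevPart a₀ a
      (fieldZ 1 fun p => c * (resMon₂ n₁ n₂ p.2.2 * resCore n₁ n₂ γ k t p)) ∈ N :=
    fun γ t => birevPart_fieldZ_mem ((hasSign_resMon₂ hn₁).mul (hasSign_resCore γ k t))
      (fun h => hN.mulQ_resCore γ (hs _ _ _ h)) c
  have tr : ∀ {F : PhaseSpace m → ℂ}, (∀ p, mon k 0 α β p = F p) →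
      birevPart a₀ a (fieldZ j fun p => c * F p) ∈ N →
      ((birevPart a₀ a).comp (fieldZ j)) (c • mon k 0 α β) ∈ N := by
    intro F hF h
    have e : c • mon k 0 α β = fun p => c * F p := by ext p; simp [hF p]
    change birevPart a₀ a (fieldZ j (c • mon k 0 α β)) ∈ N
    rw [e]
    exact h
  refine Fin.cases (fun hfr tr => ?_) (fun j => Fin.cases (fun hfr tr => ?_)
    (fun j hfr tr => ?_) j) j hfr @tr
  · obtain ⟨γ, t, h | h⟩ := resonant_mon_first hn₁ hn₂ hcop hres hind k hfr
    · exact tr h (e1 0 γ t)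
    · exact tr h (e3 γ t)
  · obtain ⟨γ, t, h | h⟩ := resonant_mon_second hn₁ hn₂ hcop hres hind k hfr
    · exact tr h (e2 1 γ t)
    · exact tr h (e4 γ t)
  · obtain ⟨γ, t, h | h⟩ := resonant_mon_tail hn₁ hn₂ hcop hres hind k hfr
    · exact tr h (e1 _ γ t)
    · exact tr h (e2 _ γ t)

end Resonant

end Admissible

/-! ### Smooth realization of formal combinations of homogeneous maps -/

section Realization

variable {E F : Type*} [NormedAddCommGroup E] [NormedSpace ℝ E]
  [NormedAddCommGroup F] [NormedSpace ℝ F]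

lemma isHomog_const (c : F) : IsHomog 0 fun _ : E => c :=
  ⟨contDiff_const, fun t y => by simp⟩

lemma IsHomog.prod {ι : Type*} (s : Finset ι) {d : ι → ℕ} {f : ι → E → ℝ}
    (hf : ∀ i ∈ s, IsHomog (d i) (f i)) : IsHomog (∑ i ∈ s, d i) fun y => ∏ i ∈ s, f i y := by
  refine ⟨contDiff_prod fun i hi => (hf i hi).1, fun t y => ?_⟩
  rw [← Finset.prod_pow_eq_pow_sum, smul_eq_mul, ← Finset.prod_mul_distrib]
  exact Finset.prod_congr rfl fun i hi => (hf i hi).2 t y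

lemma IsHomog.pow {k : ℕ} {f : E → ℝ} (hf : IsHomog k f) (n : ℕ) :
    IsHomog (n * k) fun y => f y ^ n :=
  ⟨hf.1.pow n, fun t y => by simp only [hf.2, smul_eq_mul, mul_pow, mul_comm n k, pow_mul]⟩

lemma isHomog_monomial {M : ℕ} {v : E → Fin M → ℝ} {wt : Fin M → ℕ}
    (hv : ∀ l, IsHomog (wt l) fun y => v y l) (γ : Fin M →₀ ℕ) :
    IsHomog (∑ l, γ l * wt l) fun y => ∏ l, v y l ^ γ l :=
  IsHomog.prod _ fun l _ => (hv l).pow (γ l)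

lemma IsHomog.isBigO {k j : ℕ} {f : E → F} (hf : IsHomog k f) (h : j ≤ k) :
    f =O[nhds 0] fun y => ‖y‖ ^ j := by
  obtain ⟨B, hB0, hB⟩ := hf.exists_norm_le
  refine Asymptotics.IsBigO.of_bound B ?_
  filter_upwards [Metric.ball_mem_nhds (0 : E) one_pos] with y hy
  rw [mem_ball_zero_iff] at hy
  simp only [norm_pow, norm_norm]
  exact (hB y).trans (mul_le_mul_of_nonneg_left (pow_le_pow_of_le_one (norm_nonneg y) hy.le h) hB0)

/-- The value at `v` of the homogeneous part of degree `r` of the formal series with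
coefficients `c`. -/
def seriesPart {M : ℕ} (c : (Fin M →₀ ℕ) → ℝ) (r : ℕ) (v : Fin M → ℝ) : ℝ :=
  ∑ γ ∈ Finset.finsuppAntidiag Finset.univ r, c γ * ∏ l, v l ^ γ l

lemma isHomog_seriesPart {M : ℕ} (c : (Fin M →₀ ℕ) → ℝ) (r : ℕ) : IsHomog r (seriesPart c r) := by
  refine IsHomog.sum _ fun γ hγ => ?_
  have h1 : ∀ l, IsHomog 1 fun v : Fin M → ℝ => v l := fun l =>
    ⟨contDiff_apply ℝ ℝ l, fun t y => by simp⟩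
  have h2 := (isHomog_monomial h1 γ).const_smul (c γ)
  simp only [mul_one] at h2
  rwa [(Finset.mem_finsuppAntidiag.1 hγ).1] at h2

/-- Positive weights give v(y) = O(‖y‖), so the order of vanishing in the invariants is at least
inherited in phase space. -/
lemma isBigO_comp_smul {M K : ℕ} {g : (Fin M → ℝ) → ℝ} {v : E → Fin M → ℝ} {e : E → F}
    {wt : Fin M → ℕ} (hv : ∀ l, IsHomog (wt l) fun y => v y l) (hwt : ∀ l, 1 ≤ wt l)
    (hg : g =O[nhds 0] fun u => ‖u‖ ^ K) {d : ℕ} (he : IsHomog d e) :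
    (fun y => g (v y) • e y) =O[nhds 0] fun y => ‖y‖ ^ K := by
  have h1 : v =O[nhds 0] fun y => ‖y‖ := by
    refine Asymptotics.isBigO_pi.2 fun l => ?_
    simpa using (hv l).isBigO (hwt l)
  have h2 : Filter.Tendsto v (nhds 0) (nhds 0) := by
    refine h1.trans_tendsto ?_
    simpa using (continuous_norm (E := E)).tendsto 0
  have h3 : (fun y => g (v y)) =O[nhds 0] fun y => ‖y‖ ^ K :=
    (hg.comp_tendsto h2).trans (h1.norm_left.pow K)
  simpa using h3.smul (he.isBigO (Nat.zero_le d))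

/-- Homogeneous combinations of the `e i` with coefficients polynomial in the `v l` are the
homogeneous parts of a smooth combination of the `e i`. -/
theorem exists_realization {ι : Type*} [Fintype ι] {M : ℕ} {e : ι → E → F} {d : ι → ℕ}
    (he : ∀ i, IsHomog (d i) (e i)) {v : E → Fin M → ℝ} {wt : Fin M → ℕ}
    (hv : ∀ l, IsHomog (wt l) fun y => v y l) (hwt : ∀ l, 1 ≤ wt l) {N : ℕ → E → F}
    (hN : ∀ k, 2 ≤ k → IsHomog k (N k) ∧ ∃ q : ι → MvPolynomial (Fin M) ℝ,
      ∀ y, N k y = ∑ i, MvPolynomial.eval (v y) (q i) • e i y) :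
    ∃ f : ι → (Fin M → ℝ) → ℝ, (∀ i, ContDiff ℝ (⊤ : ℕ∞) (f i)) ∧
      ∀ k y, diagTaylor k (fun y => ∑ i, f i (v y) • e i y) y = if 2 ≤ k then N k y else 0 := by
  choose! hNh q hq using hN
  -- This is the degree in phase space of the monomial v^γ times e i. The coefficient of γ is read
  -- from the polynomial given for N in exactly that degree; other monomials there have the wrong
  -- degree and cannot affect the homogeneous part. Degrees below 2 receive coefficient zero.
  let deg : ι → (Fin M →₀ ℕ) → ℕ := fun i γ => ∑ l, γ l * wt l + d i
  let c : ι → (Fin M →₀ ℕ) → ℝ := fun i γ =>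
    if 2 ≤ deg i γ then MvPolynomial.coeff γ (q (deg i γ) i) else 0
  have hvs : ContDiff ℝ (⊤ : ℕ∞) v := contDiff_pi.2 fun l => (hv l).1
  have hmon : ∀ i γ, IsHomog (deg i γ) fun y => (∏ l, v y l ^ γ l) • e i y := fun i γ =>
    (isHomog_monomial hv γ).smul (he i)
  choose f hf hfO using fun i => exists_contDiff_of_isHomog fun r => isHomog_seriesPart (c i) r
  refine ⟨f, hf, fun k y => ?_⟩
  have hgs : ContDiff ℝ (⊤ : ℕ∞) fun y =>
      ∑ i, (∑ r ∈ Finset.range (k + 1), seriesPart (c i) r (v y)) • e i y :=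
    ContDiff.sum fun i _ => (ContDiff.sum fun r _ =>
      (isHomog_seriesPart (c i) r).1.comp hvs).smul (he i).1
  have hfs : ContDiff ℝ (⊤ : ℕ∞) fun y =>
      ∑ i, (f i (v y) - ∑ r ∈ Finset.range (k + 1), seriesPart (c i) r (v y)) • e i y :=
    ContDiff.sum fun i _ => (((hf i).comp hvs).sub (ContDiff.sum fun r _ =>
      (isHomog_seriesPart (c i) r).1.comp hvs)).smul (he i).1
  -- Truncating the series at order k in the invariants leaves a remainder O(‖y‖^(k+1)), which is
  -- invisible to the Taylor part of degree k.
  have h1 : diagTaylor k (fun y => ∑ i, f i (v y) • e i y) y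
      = diagTaylor k (fun y =>
        ∑ i, (∑ r ∈ Finset.range (k + 1), seriesPart (c i) r (v y)) • e i y) y := by
    have h2 := diagTaylor_add hfs hgs k y
    rw [diagTaylor_eq_zero_of_isBigO hfs (Asymptotics.IsBigO.fun_sum fun i _ =>
      isBigO_comp_smul hv hwt (hfO i k) (he i)) le_rfl y, zero_add] at h2
    rw [← h2]
    congr 1
    ext1 y
    rw [← Finset.sum_add_distrib]
    refine Finset.sum_congr rfl fun i _ => ?_
    rw [← add_smul, sub_add_cancel]
  let Γ : Finset (Fin M →₀ ℕ) :=
    (Finset.range (k + 1)).biUnion fun r => Finset.finsuppAntidiag Finset.univ r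
  have hΓ : ∀ (c : (Fin M →₀ ℕ) → ℝ) u, ∑ r ∈ Finset.range (k + 1), seriesPart c r u
      = ∑ γ ∈ Γ, c γ * ∏ l, u l ^ γ l := by
    intro c u
    refine (Finset.sum_biUnion fun r _ s _ hrs => ?_).symm
    refine Finset.disjoint_left.2 fun γ h h' => hrs ?_
    rw [← (Finset.mem_finsuppAntidiag.1 h).1, ← (Finset.mem_finsuppAntidiag.1 h').1]
  have hexp : ∀ (T : Finset (Fin M →₀ ℕ)) (b : (Fin M →₀ ℕ) → ℝ) i,
      ContDiff ℝ (⊤ : ℕ∞) (fun y => (∑ γ ∈ T, b γ * ∏ l, v y l ^ γ l) • e i y) ∧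
      diagTaylor k (fun y => (∑ γ ∈ T, b γ * ∏ l, v y l ^ γ l) • e i y) y
        = ∑ γ ∈ T, b γ • if k = deg i γ then (∏ l, v y l ^ γ l) • e i y else 0 := by
    intro T b i
    have h2 : (fun y => (∑ γ ∈ T, b γ * ∏ l, v y l ^ γ l) • e i y)
        = fun y => ∑ γ ∈ T, b γ • (∏ l, v y l ^ γ l) • e i y := by
      ext1 y
      rw [Finset.sum_smul]
      simp only [smul_smul]
    have h3 : ∀ γ ∈ T, ContDiff ℝ (⊤ : ℕ∞) fun y => b γ • (∏ l, v y l ^ γ l) • e i y :=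
      fun γ _ => ((hmon i γ).const_smul _).1
    rw [h2]
    refine ⟨ContDiff.sum h3, ?_⟩
    rw [diagTaylor_sum _ h3]
    refine Finset.sum_congr rfl fun γ _ => ?_
    rw [diagTaylor_const_smul (hmon i γ).1, (hmon i γ).diagTaylor_eq]
  have h4 : diagTaylor k (fun y => ∑ i, f i (v y) • e i y) y
      = ∑ i, ∑ γ ∈ Γ, c i γ • if k = deg i γ then (∏ l, v y l ^ γ l) • e i y else 0 := by
    rw [h1]
    simp only [hΓ]
    rw [diagTaylor_sum _ fun i _ => (hexp Γ (c i) i).1]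
    exact Finset.sum_congr rfl fun i _ => (hexp Γ (c i) i).2
  rw [h4]
  split_ifs with hk
  · have h5 := (hNh k hk).diagTaylor_eq k y
    rw [if_pos rfl] at h5
    have h6 : N k = fun y => ∑ i, (∑ γ ∈ (q k i).support, (q k i).coeff γ * ∏ l, v y l ^ γ l)
        • e i y := by
      ext1 y
      rw [hq k hk y]
      refine Finset.sum_congr rfl fun i _ => ?_
      rw [MvPolynomial.eval_eq']
    rw [← h5, h6, diagTaylor_sum _ fun i _ => (hexp _ _ i).1]
    refine Finset.sum_congr rfl fun i _ => ?_
    rw [(hexp _ _ i).2]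
    -- Indices outside the support of the polynomial have zero coefficient; indices outside Γ have
    -- order above k, hence degree above k because all weights are at least 1. On the common part
    -- the coefficients agree by construction.
    refine Finset.sum_congr_of_eq_on_inter (fun γ _ hγ => ?_) (fun γ _ hγ => ?_) fun γ _ _ => ?_
    · split_ifs with hd
      · simp only [c, ← hd, if_pos hk, MvPolynomial.notMem_support_iff.1 hγ, zero_smul]
      · simp
    · rw [if_neg, smul_zero]
      intro hd
      apply hγ
      refine Finset.mem_biUnion.2 ⟨∑ l, γ l, ?_, Finset.mem_finsuppAntidiag.2 ⟨rfl, by simp⟩⟩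
      rw [Finset.mem_range, hd, Nat.lt_succ_iff]
      refine le_trans (Finset.sum_le_sum fun l _ => ?_) (Nat.le_add_right _ _)
      exact Nat.le_mul_of_pos_right _ (hwt l)
    · split_ifs with hd
      · simp only [c, ← hd, if_pos hk]
      · simp
  · refine Finset.sum_eq_zero fun i _ => Finset.sum_eq_zero fun γ _ => ?_
    split_ifs with hd
    · simp only [c, ← hd, if_neg hk, zero_smul]
    · simp

end Realization

/-! ### The module of normal forms -/

section PolyCombination

variable {E F ι : Type*} [AddCommGroup F] [Module ℝ F] [Fintype ι] {M : ℕ}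

/-- The combinations of the maps `e i` with coefficients polynomial in the `v l`. -/
def polyCombination (v : E → Fin M → ℝ) (e : ι → E → F) : Submodule ℝ (E → F) where
  carrier := {Y | ∃ q : ι → MvPolynomial (Fin M) ℝ,
    ∀ y, Y y = ∑ i, MvPolynomial.eval (v y) (q i) • e i y}
  add_mem' := by
    rintro Y Z ⟨q, hq⟩ ⟨r, hr⟩
    refine ⟨fun i => q i + r i, fun y => ?_⟩
    simp only [Pi.add_apply, hq y, hr y, map_add, add_smul, Finset.sum_add_distrib]
  zero_mem' := ⟨fun _ => 0, fun y => by simp⟩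
  smul_mem' := by
    rintro c Y ⟨q, hq⟩
    refine ⟨fun i => MvPolynomial.C c * q i, fun y => ?_⟩
    simp only [Pi.smul_apply, hq y, map_mul, MvPolynomial.eval_C, mul_smul, Finset.smul_sum]

variable {v : E → Fin M → ℝ} {e : ι → E → F}

lemma eval_smul_mem_polyCombination (q : MvPolynomial (Fin M) ℝ) {Y : E → F}
    (hY : Y ∈ polyCombination v e) :
    (fun y => MvPolynomial.eval (v y) q • Y y) ∈ polyCombination v e := by
  obtain ⟨r, hr⟩ := hY
  refine ⟨fun i => q * r i, fun y => ?_⟩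
  simp only [hr y, map_mul, mul_smul, Finset.smul_sum]

lemma mem_polyCombination (i : ι) : e i ∈ polyCombination v e := by
  classical
  refine ⟨Pi.single i 1, fun y => ?_⟩
  rw [Finset.sum_eq_single i]
  · simp
  · intro j _ hj; simp [hj]
  · simp

/-- Expanding a scalar coefficient over generators expands the corresponding vector field, since Ψ
commutes with multiplication by real functions. -/
lemma map_mem_polyCombination {K : Type*} [Semiring K] [Module ℝ K]
    {Ψ : (E → K) →ₗ[ℝ] E → F}
    (hΨ : ∀ (r : E → ℝ) f, Ψ (fun y => r y • f y) = fun y => r y • Ψ f y) {κ : Type*} [Fintype κ]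
    (q : κ → MvPolynomial (Fin M) ℝ) {f : κ → E → K} {g : E → K}
    (hf : ∀ i, Ψ (f i) ∈ polyCombination v e)
    (hg : ∀ y, g y = ∑ i, MvPolynomial.eval (v y) (q i) • f i y) :
    Ψ g ∈ polyCombination v e := by
  have : g = ∑ i, fun y => MvPolynomial.eval (v y) (q i) • f i y := by
    ext1 y; rw [hg, Finset.sum_apply]
  rw [this, map_sum]
  refine Submodule.sum_mem _ fun i _ => ?_
  rw [hΨ]
  exact eval_smul_mem_polyCombination _ (hf i)

end PolyCombination

/-! ### Generators of the modules of normal forms -/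

section Generators

variable {m : ℕ}

lemma fieldX_smul (r : PhaseSpace m → ℝ) (f : PhaseSpace m → ℝ) :
    fieldX (fun p => r p • f p) = fun p => r p • fieldX f p := by
  ext p <;> simp [fieldX_apply] <;> ring

lemma fieldH_smul (r : PhaseSpace m → ℝ) (f : PhaseSpace m → ℝ) :
    fieldH (fun p => r p • f p) = fun p => r p • fieldH f p := by
  ext p <;> simp [fieldH_apply]

lemma fieldZ_smul (j : Fin (m + 2)) (r : PhaseSpace m → ℝ) (f : PhaseSpace m → ℂ) :
    fieldZ j (fun p => r p • f p) = fun p => r p • fieldZ j f p := by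
  ext p l
  · simp [fieldZ_apply]
  · simp [fieldZ_apply]
  · rcases eq_or_ne l j with rfl | hl
    · simp [fieldZ_apply]
    · simp [fieldZ_apply, hl]

/-- The index set of the generators of a module of normal forms. -/
abbrev GenIndex (m a b : ℕ) : Type :=
  Fin a ⊕ Fin b ⊕ Fin (m + 2) ⊕ (Fin (m + 2) × Fin a) ⊕ Fin a ⊕ Unit ⊕ Fin a ⊕ Unit

/-- The generators of a module of normal forms, where the `u i` generate the functions of the same
symmetry as `J`, and the `w i` those of the same symmetry as `x₁`. -/
def gen (n₁ n₂ : ℕ) {a b : ℕ} (u : Fin a → PhaseSpace m → ℝ) (w : Fin b → PhaseSpace m → ℝ) :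
    GenIndex m a b → PhaseSpace m → PhaseSpace m
  | .inl i => fieldX fun p => u i p * (resMon n₁ n₂ p.2.2).im
  | .inr (.inl i) => fieldH (w i)
  | .inr (.inr (.inl j)) => fieldZ j fun p => Complex.I * p.2.2 j
  | .inr (.inr (.inr (.inl i))) =>
    fieldZ i.1 fun p => p.2.2 i.1 * (u i.2 p * (resMon n₁ n₂ p.2.2).im : ℝ)
  | .inr (.inr (.inr (.inr (.inl i)))) => fieldZ 0 fun p => Complex.I * resMon₁ n₁ n₂ p.2.2 * u i p
  | .inr (.inr (.inr (.inr (.inr (.inl _))))) =>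
    fieldZ 0 fun p => resMon₁ n₁ n₂ p.2.2 * (resMon n₁ n₂ p.2.2).im
  | .inr (.inr (.inr (.inr (.inr (.inr (.inl i)))))) =>
    fieldZ 1 fun p => Complex.I * resMon₂ n₁ n₂ p.2.2 * u i p
  | .inr (.inr (.inr (.inr (.inr (.inr (.inr _)))))) =>
    fieldZ 1 fun p => resMon₂ n₁ n₂ p.2.2 * (resMon n₁ n₂ p.2.2).im

/-- The monomials `x₁ᵏ Rˡ` of each symmetry class are generated over the polynomials in the `v l`
by `1`, by the `u i` and by the `w i`, respectively. -/
structure Generates (n₁ n₂ : ℕ) (a₀ s : ℤˣ) {M a b : ℕ} (v : PhaseSpace m → Fin M → ℝ)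
    (u : Fin a → PhaseSpace m → ℝ) (w : Fin b → PhaseSpace m → ℝ) : Prop where
  normSq : ∀ j, ∃ l, ∀ p, v p l = ‖p.2.2 j‖ ^ 2
  one : ∀ k l, a₀ ^ k * s ^ l = 1 → ∃ q, ∀ p, xPow n₁ n₂ k l p = MvPolynomial.eval (v p) q
  im : ∀ k l, a₀ ^ k * s ^ (l + 1) = 1 → ∃ q : Fin a → MvPolynomial (Fin M) ℝ,
    ∀ p, xPow n₁ n₂ k l p = ∑ i, MvPolynomial.eval (v p) (q i) * u i p
  half : ∀ k l, a₀ ^ k * s ^ l = a₀ → ∃ q : Fin b → MvPolynomial (Fin M) ℝ,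
    ∀ p, xPow n₁ n₂ k l p = ∑ i, MvPolynomial.eval (v p) (q i) * w i p

variable {n₁ n₂ : ℕ} {a₀ s : ℤˣ} {M a b : ℕ} {v : PhaseSpace m → Fin M → ℝ}
  {u : Fin a → PhaseSpace m → ℝ} {w : Fin b → PhaseSpace m → ℝ}

lemma gen_mem (i : GenIndex m a b) : gen n₁ n₂ u w i ∈ polyCombination v (gen n₁ n₂ u w) :=
  mem_polyCombination i

/-- Each membership reduces to expanding x₁ᵏRˡ over its symmetry class. The fields i z_j, PJ and QJ
are multiplied by invariant functions only, so one generator suffices for each; the other families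
run over the `u i` or the `w i`. -/
lemma Generates.admissible (h : Generates n₁ n₂ a₀ s v u w) :
    Admissible n₁ n₂ a₀ s (polyCombination v (gen n₁ n₂ u w)) where
  normSq_smul j Y hY := by
    obtain ⟨l, hl⟩ := h.normSq j
    simpa [hl] using eval_smul_mem_polyCombination (MvPolynomial.X l) hY
  fieldX_mem k l hkl := by
    obtain ⟨q, hq⟩ := h.im k l hkl
    refine map_mem_polyCombination fieldX_smul q (fun i => gen_mem (.inl i))
      fun p => ?_
    simp only [hq, Finset.sum_mul, smul_eq_mul, mul_assoc]
  fieldH_mem k l hkl := by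
    obtain ⟨q, hq⟩ := h.half k l hkl
    exact map_mem_polyCombination fieldH_smul q (fun i => gen_mem (.inr (.inl i))) hq
  fieldZ_mem j k l hkl := by
    obtain ⟨q, hq⟩ := h.one k l hkl
    refine map_mem_polyCombination (fieldZ_smul j) (fun _ : Unit => q)
      (fun i => gen_mem (.inr (.inr (.inl j)))) fun p => ?_
    simp only [hq, Finset.univ_unique, Finset.sum_singleton, Complex.real_smul]
    ring
  fieldZ_im_mem j k l hkl := by
    obtain ⟨q, hq⟩ := h.im k l hkl
    refine map_mem_polyCombination (fieldZ_smul j) q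
      (fun i => gen_mem (.inr (.inr (.inr (.inl (j, i)))))) fun p => ?_
    simp only [hq, Finset.sum_mul, Complex.ofReal_sum, Finset.mul_sum, Complex.real_smul]
    refine Finset.sum_congr rfl fun i _ => ?_
    push_cast
    ring
  fieldP_mem k l hkl := by
    obtain ⟨q, hq⟩ := h.im k l hkl
    refine map_mem_polyCombination (fieldZ_smul 0) q
      (fun i => gen_mem (.inr (.inr (.inr (.inr (.inl i)))))) fun p => ?_
    simp only [hq, Complex.ofReal_sum, Finset.mul_sum, Complex.real_smul]
    refine Finset.sum_congr rfl fun i _ => ?_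
    push_cast
    ring
  fieldP_im_mem k l hkl := by
    obtain ⟨q, hq⟩ := h.one k l hkl
    refine map_mem_polyCombination (fieldZ_smul 0) (fun _ : Unit => q)
      (fun i => gen_mem (.inr (.inr (.inr (.inr (.inr (.inl ()))))))) fun p => ?_
    simp only [hq, Finset.univ_unique, Finset.sum_singleton, Complex.real_smul]
    push_cast
    ring
  fieldQ_mem k l hkl := by
    obtain ⟨q, hq⟩ := h.im k l hkl
    refine map_mem_polyCombination (fieldZ_smul 1) q
      (fun i => gen_mem (.inr (.inr (.inr (.inr (.inr (.inr (.inl i)))))))) fun p => ?_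
    simp only [hq, Complex.ofReal_sum, Finset.mul_sum, Complex.real_smul]
    refine Finset.sum_congr rfl fun i _ => ?_
    push_cast
    ring
  fieldQ_im_mem k l hkl := by
    obtain ⟨q, hq⟩ := h.one k l hkl
    refine map_mem_polyCombination (fieldZ_smul 1) (fun _ : Unit => q)
      (fun i => gen_mem (.inr (.inr (.inr (.inr (.inr (.inr (.inr ()))))))))
      fun p => ?_
    simp only [hq, Finset.univ_unique, Finset.sum_singleton, Complex.real_smul]
    push_cast
    ring

/-! ### Homogeneity of the generators -/

lemma IsHomog.mul_complex {k l : ℕ} {f g : PhaseSpace m → ℂ} (hf : IsHomog k f)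
    (hg : IsHomog l g) : IsHomog (k + l) fun p => f p * g p :=
  ⟨hf.1.mul hg.1, fun t p => by
    simp only [hf.2, hg.2, Complex.real_smul]; push_cast; ring⟩

lemma IsHomog.pow_complex {k : ℕ} {f : PhaseSpace m → ℂ} (hf : IsHomog k f) (n : ℕ) :
    IsHomog (k * n) fun p => f p ^ n :=
  ⟨hf.1.pow n, fun t p => by
    simp only [hf.2, Complex.real_smul]; push_cast; rw [mul_pow, pow_mul]⟩

lemma isHomog_coord (j : Fin (m + 2)) : IsHomog 1 fun p : PhaseSpace m => p.2.2 j :=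
  ⟨contDiff_coord j, fun t p => by simp⟩

lemma isHomog_conj_coord (j : Fin (m + 2)) :
    IsHomog 1 fun p : PhaseSpace m => conj (p.2.2 j) :=
  ⟨contDiff_conj.comp (contDiff_coord j), fun t p => by simp⟩

lemma isHomog_fst : IsHomog 1 fun p : PhaseSpace m => p.1 :=
  ⟨contDiff_fst, fun t p => by simp⟩

lemma isHomog_resMon : IsHomog (n₂ + n₁) fun p : PhaseSpace m => resMon n₁ n₂ p.2.2 := by
  simpa only [one_mul, resMon, resMon₁, resMon₂] using ((isHomog_coord 0).pow_complex n₂).mul_complex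
    ((isHomog_conj_coord 1).pow_complex n₁)

lemma isHomog_resMon₁ : IsHomog (n₂ - 1 + n₁) fun p : PhaseSpace m => resMon₁ n₁ n₂ p.2.2 := by
  simpa only [one_mul, resMon, resMon₁, resMon₂] using ((isHomog_conj_coord 0).pow_complex (n₂ - 1)).mul_complex
    ((isHomog_coord 1).pow_complex n₁)

lemma isHomog_resMon₂ : IsHomog (n₂ + (n₁ - 1)) fun p : PhaseSpace m => resMon₂ n₁ n₂ p.2.2 := by
  simpa only [one_mul, resMon, resMon₁, resMon₂] using ((isHomog_coord 0).pow_complex n₂).mul_complex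
    ((isHomog_conj_coord 1).pow_complex (n₁ - 1))

lemma isHomog_re : IsHomog (n₂ + n₁) fun p : PhaseSpace m => (resMon n₁ n₂ p.2.2).re :=
  isHomog_resMon.clm_comp Complex.reCLM

lemma isHomog_im : IsHomog (n₂ + n₁) fun p : PhaseSpace m => (resMon n₁ n₂ p.2.2).im :=
  isHomog_resMon.clm_comp Complex.imCLM

lemma isHomog_normSq (j : Fin (m + 2)) : IsHomog 2 fun p : PhaseSpace m => ‖p.2.2 j‖ ^ 2 := by
  refine ⟨(contDiff_coord j).norm_sq ℝ, fun t p => ?_⟩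
  simp [mul_pow]

lemma IsHomog.ofReal {k : ℕ} {f : PhaseSpace m → ℝ} (hf : IsHomog k f) :
    IsHomog k fun p => (f p : ℂ) :=
  hf.clm_comp Complex.ofRealCLM

lemma IsHomog.fieldX {k : ℕ} {f : PhaseSpace m → ℝ} (hf : IsHomog k f) :
    IsHomog (k + 1) (fieldX f) := by
  refine ⟨(contDiff_fst.mul hf.1).prodMk (((contDiff_fst.comp contDiff_snd).mul hf.1).prodMk
    contDiff_const), fun t p => ?_⟩
  ext <;> simp [fieldX_apply, hf.2] <;> ring

lemma IsHomog.fieldH {k : ℕ} {f : PhaseSpace m → ℝ} (hf : IsHomog k f) :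
    IsHomog k (fieldH f) := by
  refine ⟨contDiff_const.prodMk (hf.1.prodMk contDiff_const), fun t p => ?_⟩
  ext <;> simp [fieldH_apply, hf.2]

lemma IsHomog.fieldZ {k : ℕ} {f : PhaseSpace m → ℂ} (hf : IsHomog k f) (j : Fin (m + 2)) :
    IsHomog k (fieldZ j f) := by
  refine ⟨contDiff_const.prodMk (contDiff_const.prodMk (contDiff_pi.2 fun l => ?_)), fun t p => ?_⟩
  · rcases eq_or_ne l j with rfl | hl
    · simpa using hf.1
    · simpa [hl] using contDiff_const
  · ext l
    · simp [fieldZ_apply]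
    · simp [fieldZ_apply]
    · rcases eq_or_ne l j with rfl | hl
      · simp [fieldZ_apply, hf.2]
      · simp [fieldZ_apply, hl]

lemma exists_isHomog_gen (hu : ∀ i, ∃ d, IsHomog d (u i)) (hw : ∀ i, ∃ d, IsHomog d (w i)) :
    ∀ i, ∃ d, IsHomog d (gen n₁ n₂ u w i) := by
  have hJ := isHomog_im (m := m) (n₁ := n₁) (n₂ := n₂)
  have hI : IsHomog 0 fun _ : PhaseSpace m => Complex.I := isHomog_const _
  choose du hu using hu
  choose dw hw using hw
  rintro (i | i | j | ⟨j, i⟩ | i | i | i | i)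
  · exact ⟨_, ((hu i).smul hJ).fieldX⟩
  · exact ⟨_, (hw i).fieldH⟩
  · exact ⟨_, (hI.mul_complex (isHomog_coord j)).fieldZ j⟩
  · exact ⟨_, ((isHomog_coord j).mul_complex ((hu i).smul hJ).ofReal).fieldZ j⟩
  · exact ⟨_, ((hI.mul_complex isHomog_resMon₁).mul_complex (hu i).ofReal).fieldZ 0⟩
  · exact ⟨_, (isHomog_resMon₁.mul_complex hJ.ofReal).fieldZ 0⟩
  · exact ⟨_, ((hI.mul_complex isHomog_resMon₂).mul_complex (hu i).ofReal).fieldZ 1⟩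
  · exact ⟨_, (isHomog_resMon₂.mul_complex hJ.ofReal).fieldZ 1⟩

end Generators

/-! ### The four types of normal form -/

section Types

variable {m n₁ n₂ : ℕ} {ω : Fin (m + 2) → ℝ}

/-- Componentwise form of a combination of generators, ready for comparison with the explicit normal
forms. -/
lemma sum_gen {a b : ℕ} (u : Fin a → PhaseSpace m → ℝ) (w : Fin b → PhaseSpace m → ℝ)
    (F : GenIndex m a b → ℝ) (p : PhaseSpace m) :
    ∑ i, F i • gen n₁ n₂ u w i p
      = (p.1 * ∑ i, F (.inl i) * (u i p * (resMon n₁ n₂ p.2.2).im),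
        p.2.1 * (∑ i, F (.inl i) * (u i p * (resMon n₁ n₂ p.2.2).im))
          + ∑ i, F (.inr (.inl i)) * w i p,
        fun j => F (.inr (.inr (.inl j))) * (Complex.I * p.2.2 j)
          + ∑ i, F (.inr (.inr (.inr (.inl (j, i)))))
            * (p.2.2 j * (u i p * (resMon n₁ n₂ p.2.2).im : ℝ))
          + (if j = 0 then
            ∑ i, F (.inr (.inr (.inr (.inr (.inl i)))))
              * (Complex.I * resMon₁ n₁ n₂ p.2.2 * u i p)
            + F (.inr (.inr (.inr (.inr (.inr (.inl ()))))))
              * (resMon₁ n₁ n₂ p.2.2 * (resMon n₁ n₂ p.2.2).im) else 0)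
          + if j = 1 then
            ∑ i, F (.inr (.inr (.inr (.inr (.inr (.inr (.inl i)))))))
              * (Complex.I * resMon₂ n₁ n₂ p.2.2 * u i p)
            + F (.inr (.inr (.inr (.inr (.inr (.inr (.inr ())))))))
              * (resMon₂ n₁ n₂ p.2.2 * (resMon n₁ n₂ p.2.2).im) else 0) := by
  simp only [Fintype.sum_sum_type, Fintype.sum_prod_type, gen, fieldX_apply, fieldH_apply,
    fieldZ_apply, Finset.univ_unique, Finset.sum_singleton]
  refine Prod.ext ?_ (Prod.ext ?_ (funext fun j => ?_))
  · simp [Prod.fst_sum, Finset.mul_sum]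
    refine Finset.sum_congr rfl fun i _ => ?_
    ring
  · simp [Prod.fst_sum, Prod.snd_sum, Finset.mul_sum]
    refine Finset.sum_congr rfl fun i _ => ?_
    ring
  · simp only [Prod.snd_add, Prod.snd_sum, Prod.smul_snd, smul_zero, Finset.sum_const_zero,
      zero_add, Pi.add_apply, Finset.sum_apply, Pi.smul_apply, Pi.single_apply, Complex.real_smul,
      mul_ite, mul_zero, Finset.sum_ite_eq, Finset.mem_univ, if_true, Pi.zero_apply]
    have h : ∀ G : Fin (m + 2) → ℂ, (∑ x, if j = x then G x else 0) = G j := by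
      intro G; simp
    have h' : ∑ x : Fin (m + 2), ∑ i : Fin a, (if j = x then
        (F (.inr (.inr (.inr (.inl (x, i))))) : ℂ)
          * (p.2.2 x * (u i p * (resMon n₁ n₂ p.2.2).im : ℝ)) else 0)
        = ∑ i : Fin a, (F (.inr (.inr (.inr (.inl (j, i))))) : ℂ)
          * (p.2.2 j * (u i p * (resMon n₁ n₂ p.2.2).im : ℝ)) := by
      rw [Finset.sum_comm]
      exact Finset.sum_congr rfl fun i _ => h _
    rw [h']
    split_ifs <;> simp <;> ring

/-- The arguments of the coefficient functions for types A, B and C. -/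
def nfVars (x r : PhaseSpace m → ℝ) (p : PhaseSpace m) : Fin (m + 4) → ℝ :=
  Matrix.vecCons (x p) (Matrix.vecCons (‖p.2.2 0‖ ^ 2) (Matrix.vecCons (‖p.2.2 1‖ ^ 2)
    (Matrix.vecCons (r p) (tailSq p.2.2))))

/-- The arguments of the coefficient functions for type D. -/
def nfVarsD (n₁ n₂ : ℕ) (p : PhaseSpace m) : Fin (m + 5) → ℝ :=
  Matrix.vecCons (p.1 ^ 2) (Matrix.vecCons (‖p.2.2 0‖ ^ 2) (Matrix.vecCons (‖p.2.2 1‖ ^ 2)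
    (Matrix.vecCons ((resMon n₁ n₂ p.2.2).re ^ 2)
      (Matrix.vecCons (p.1 * (resMon n₁ n₂ p.2.2).re) (tailSq p.2.2)))))

lemma exists_nfVars_eq (x r : PhaseSpace m → ℝ) (j : Fin (m + 2)) :
    ∃ l, ∀ p, nfVars x r p l = ‖p.2.2 j‖ ^ 2 :=
  Fin.cases ⟨1, fun _ => rfl⟩ (fun j => Fin.cases ⟨2, fun _ => rfl⟩
    (fun j => ⟨j.succ.succ.succ.succ, fun _ => rfl⟩) j) j

lemma exists_nfVarsD_eq (j : Fin (m + 2)) :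
    ∃ l, ∀ p, nfVarsD n₁ n₂ p l = ‖p.2.2 j‖ ^ 2 :=
  Fin.cases ⟨1, fun _ => rfl⟩ (fun j => Fin.cases ⟨2, fun _ => rfl⟩
    (fun j => ⟨j.succ.succ.succ.succ.succ, fun _ => rfl⟩) j) j

lemma exists_isHomog_nfVars {x r : PhaseSpace m → ℝ} (hx : ∃ d ≥ 1, IsHomog d x)
    (hr : ∃ d ≥ 1, IsHomog d r) (l : Fin (m + 4)) :
    ∃ d ≥ 1, IsHomog d fun p => nfVars x r p l := by
  refine Fin.cases hx (fun l => Fin.cases ⟨2, one_le_two, isHomog_normSq 0⟩ (fun l =>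
    Fin.cases ⟨2, one_le_two, isHomog_normSq 1⟩ (fun l => Fin.cases hr (fun j => ?_) l) l) l) l
  exact ⟨2, one_le_two, isHomog_normSq j.succ.succ⟩

lemma exists_isHomog_nfVarsD (hn₁ : 0 < n₁) (l : Fin (m + 5)) :
    ∃ d ≥ 1, IsHomog d fun p => nfVarsD n₁ n₂ p l := by
  refine Fin.cases ⟨_, by norm_num, isHomog_fst.pow 2⟩ (fun l => Fin.cases
    ⟨2, one_le_two, isHomog_normSq 0⟩ (fun l => Fin.cases ⟨2, one_le_two, isHomog_normSq 1⟩
    (fun l => Fin.cases ⟨_, ?_, isHomog_re.pow 2⟩ (fun l => Fin.cases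
      ⟨_, ?_, isHomog_fst.smul isHomog_re⟩ (fun j => ?_) l) l) l) l) l
  · omega
  · omega
  · exact ⟨2, one_le_two, isHomog_normSq j.succ.succ⟩

lemma neg_one_pow_units_eq_one_iff {n : ℕ} : (-1 : ℤˣ) ^ n = 1 ↔ Even n := by
  rcases Nat.even_or_odd n with h | h
  · simp [h.neg_one_pow, h]
  · simp [h.neg_one_pow, Nat.not_even_iff_odd.2 h, show (-1 : ℤˣ) ≠ 1 by decide]

lemma neg_one_pow_units_eq_neg_one_iff {n : ℕ} : (-1 : ℤˣ) ^ n = -1 ↔ Odd n := by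
  rcases Nat.even_or_odd n with h | h
  · simp [h.neg_one_pow, Nat.not_odd_iff_even.2 h, show (1 : ℤˣ) ≠ -1 by decide]
  · simp [h.neg_one_pow, h]

open MvPolynomial in
lemma generates_A : Generates n₁ n₂ 1 1
    (nfVars (fun p : PhaseSpace m => p.1) fun p => (resMon n₁ n₂ p.2.2).re)
    ![fun _ => 1] ![fun _ => 1] where
  normSq := exists_nfVars_eq _ _
  one k l _ := ⟨X 0 ^ k * X 3 ^ l, fun p => by
    simp only [map_mul, map_pow, eval_X]; rfl⟩
  im k l _ := ⟨![X 0 ^ k * X 3 ^ l], fun p => by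
    simp only [Fin.sum_univ_one, Matrix.cons_val_zero, map_mul, map_pow, eval_X, mul_one]; rfl⟩
  half k l _ := ⟨![X 0 ^ k * X 3 ^ l], fun p => by
    simp only [Fin.sum_univ_one, Matrix.cons_val_zero, map_mul, map_pow, eval_X, mul_one]; rfl⟩

-- Only the parity of l matters: invariants contain R to an even power, and the cofactors of J
-- contain an odd power, hence one explicit factor R.
open MvPolynomial in
lemma generates_B : Generates n₁ n₂ 1 (-1)
    (nfVars (fun p : PhaseSpace m => p.1) fun p => (resMon n₁ n₂ p.2.2).re ^ 2)
    ![fun p => (resMon n₁ n₂ p.2.2).re] ![fun _ => 1] where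
  normSq := exists_nfVars_eq _ _
  one k l h := by
    rw [one_pow, one_mul, neg_one_pow_units_eq_one_iff, even_iff_exists_two_mul] at h
    obtain ⟨l, rfl⟩ := h
    refine ⟨X 0 ^ k * X 3 ^ l, fun p => ?_⟩
    simp only [map_mul, map_pow, eval_X, xPow, pow_mul]
    rfl
  im k l h := by
    rw [one_pow, one_mul, neg_one_pow_units_eq_one_iff, Nat.even_add_one, Nat.not_even_iff_odd] at h
    obtain ⟨l, rfl⟩ := h
    refine ⟨![X 0 ^ k * X 3 ^ l], fun p => ?_⟩
    simp only [Fin.sum_univ_one, Matrix.cons_val_zero, map_mul, map_pow, eval_X, xPow, pow_succ _ (2 * l),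
      pow_mul, ← mul_assoc]
    rfl
  half k l h := by
    rw [one_pow, one_mul, neg_one_pow_units_eq_one_iff, even_iff_exists_two_mul] at h
    obtain ⟨l, rfl⟩ := h
    refine ⟨![X 0 ^ k * X 3 ^ l], fun p => ?_⟩
    simp only [Fin.sum_univ_one, Matrix.cons_val_zero, map_mul, map_pow, eval_X, mul_one, xPow,
      pow_mul]
    rfl

-- Only the parity of k matters: it is even for invariants and cofactors of J, and odd for the
-- coefficient of ∂₂, which yields the factor x₁.
open MvPolynomial in
lemma generates_C : Generates n₁ n₂ (-1) 1
    (nfVars (fun p : PhaseSpace m => p.1 ^ 2) fun p => (resMon n₁ n₂ p.2.2).re)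
    ![fun _ => 1] ![fun p => p.1] where
  normSq := exists_nfVars_eq _ _
  one k l h := by
    rw [one_pow, mul_one, neg_one_pow_units_eq_one_iff, even_iff_exists_two_mul] at h
    obtain ⟨k, rfl⟩ := h
    refine ⟨X 0 ^ k * X 3 ^ l, fun p => ?_⟩
    simp only [map_mul, map_pow, eval_X, xPow, pow_mul]
    rfl
  im k l h := by
    rw [one_pow, mul_one, neg_one_pow_units_eq_one_iff, even_iff_exists_two_mul] at h
    obtain ⟨k, rfl⟩ := h
    refine ⟨![X 0 ^ k * X 3 ^ l], fun p => ?_⟩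
    simp only [Fin.sum_univ_one, Matrix.cons_val_zero, map_mul, map_pow, eval_X, mul_one, xPow,
      pow_mul]
    rfl
  half k l h := by
    rw [one_pow, mul_one, neg_one_pow_units_eq_neg_one_iff] at h
    obtain ⟨k, rfl⟩ := h
    refine ⟨![X 0 ^ k * X 3 ^ l], fun p => ?_⟩
    simp only [Fin.sum_univ_one, Matrix.cons_val_zero, map_mul, map_pow, eval_X, xPow,
      pow_succ _ (2 * k), pow_mul, mul_right_comm _ p.1]
    rfl

-- Exactly one of k and l is odd, and that one supplies the factor x₁ or R over polynomials in x₁²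
-- and R².
open MvPolynomial in
lemma exists_xPow_eq_of_odd {k l : ℕ} (h : Odd (k + l)) :
    ∃ q : Fin 2 → MvPolynomial (Fin (m + 5)) ℝ, ∀ p : PhaseSpace m, xPow n₁ n₂ k l p
      = ∑ i, eval (nfVarsD n₁ n₂ p) (q i) *
        (![fun p => p.1, fun p => (resMon n₁ n₂ p.2.2).re] : Fin 2 → PhaseSpace m → ℝ) i p := by
  rcases Nat.even_or_odd' k with ⟨k, rfl | rfl⟩
  · obtain ⟨l, rfl⟩ : Odd l := by
      rw [Nat.odd_add'] at h
      exact h.2 (even_two_mul k)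
    refine ⟨![0, X 0 ^ k * X 3 ^ l], fun p => ?_⟩
    have h0 : nfVarsD n₁ n₂ p 0 = p.1 ^ 2 := rfl
    have h3 : nfVarsD n₁ n₂ p 3 = (resMon n₁ n₂ p.2.2).re ^ 2 := rfl
    simp [Fin.sum_univ_two, xPow, h0, h3]
    ring
  · obtain ⟨l, rfl⟩ : Even l := by
      rw [Nat.odd_add] at h
      exact h.1 ⟨k, rfl⟩
    refine ⟨![X 0 ^ k * X 3 ^ l, 0], fun p => ?_⟩
    have h0 : nfVarsD n₁ n₂ p 0 = p.1 ^ 2 := rfl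
    have h3 : nfVarsD n₁ n₂ p 3 = (resMon n₁ n₂ p.2.2).re ^ 2 := rfl
    simp [Fin.sum_univ_two, xPow, h0, h3]
    ring

-- For k + l even, either both exponents are even or both are odd; the second case leaves one factor
-- x₁R, which is why it appears among the variables. Cofactors of J and coefficients of ∂₂ both
-- require k + l odd, so they share the generators x₁ and R.
open MvPolynomial in
lemma generates_D : Generates n₁ n₂ (-1) (-1) (nfVarsD (m := m) n₁ n₂)
    ![fun p => p.1, fun p => (resMon n₁ n₂ p.2.2).re]
    ![fun p => p.1, fun p => (resMon n₁ n₂ p.2.2).re] where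
  normSq := exists_nfVarsD_eq
  one k l h := by
    rw [← pow_add, neg_one_pow_units_eq_one_iff] at h
    rcases Nat.even_or_odd' k with ⟨k, rfl | rfl⟩
    · obtain ⟨l, rfl⟩ : Even l := (Nat.even_add.1 h).1 (even_two_mul k)
      refine ⟨X 0 ^ k * X 3 ^ l, fun p => ?_⟩
      have h0 : nfVarsD n₁ n₂ p 0 = p.1 ^ 2 := rfl
      have h3 : nfVarsD n₁ n₂ p 3 = (resMon n₁ n₂ p.2.2).re ^ 2 := rfl
      simp [xPow, h0, h3]
      ring
    · obtain ⟨l, rfl⟩ : Odd l := (Nat.even_add'.1 h).1 ⟨k, rfl⟩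
      refine ⟨X 0 ^ k * X 3 ^ l * X 4, fun p => ?_⟩
      have h0 : nfVarsD n₁ n₂ p 0 = p.1 ^ 2 := rfl
      have h3 : nfVarsD n₁ n₂ p 3 = (resMon n₁ n₂ p.2.2).re ^ 2 := rfl
      have h4 : nfVarsD n₁ n₂ p 4 = p.1 * (resMon n₁ n₂ p.2.2).re := rfl
      simp [xPow, h0, h3, h4]
      ring
  im k l h := by
    rw [← pow_add, neg_one_pow_units_eq_one_iff, ← add_assoc, Nat.even_add_one,
      Nat.not_even_iff_odd] at h
    exact exists_xPow_eq_of_odd h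
  half k l h := by
    rw [← pow_add, neg_one_pow_units_eq_neg_one_iff] at h
    exact exists_xPow_eq_of_odd h

/-- The generator whose coefficient is the function `f i` in the formulas of types A and C. -/
def indexA : ℕ → GenIndex m 1 1
  | 0 => .inl 0
  | 1 => .inr (.inl 0)
  | 2 => .inr (.inr (.inl 0))
  | 3 => .inr (.inr (.inr (.inr (.inl 0))))
  | 4 => .inr (.inr (.inr (.inl (0, 0))))
  | 5 => .inr (.inr (.inr (.inr (.inr (.inl ())))))
  | 6 => .inr (.inr (.inl 1))
  | 7 => .inr (.inr (.inr (.inr (.inr (.inr (.inl 0))))))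
  | 8 => .inr (.inr (.inr (.inl (1, 0))))
  | 9 => .inr (.inr (.inr (.inr (.inr (.inr (.inr ()))))))
  | n + 10 => if h : n / 2 < m then
      if n % 2 = 0 then .inr (.inr (.inl (⟨n / 2, h⟩ : Fin m).succ.succ))
      else .inr (.inr (.inr (.inl ((⟨n / 2, h⟩ : Fin m).succ.succ, 0))))
    -- A filler: the formulas use no index beyond 2m + 9 = 2n + 5.
    else .inl 0

/-- The generator whose coefficient is the function `f i` in the formulas of type B. -/
def indexB : ℕ → GenIndex m 1 1
  | 3 => indexA 5
  | 4 => indexA 3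
  | 5 => indexA 4
  | 7 => indexA 9
  | 8 => indexA 7
  | 9 => indexA 8
  | n => indexA n

/-- The generator whose coefficient is the function `f i` in the formulas of type D. -/
def indexD : ℕ → GenIndex m 2 2
  | 0 => .inl 0
  | 1 => .inl 1
  | 2 => .inr (.inl 0)
  | 3 => .inr (.inl 1)
  | 4 => .inr (.inr (.inl 0))
  | 5 => .inr (.inr (.inr (.inr (.inr (.inl ())))))
  | 6 => .inr (.inr (.inr (.inr (.inl 0))))
  | 7 => .inr (.inr (.inr (.inl (0, 0))))
  | 8 => .inr (.inr (.inr (.inr (.inl 1))))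
  | 9 => .inr (.inr (.inr (.inl (0, 1))))
  | 10 => .inr (.inr (.inl 1))
  | 11 => .inr (.inr (.inr (.inr (.inr (.inr (.inr ()))))))
  | 12 => .inr (.inr (.inr (.inr (.inr (.inr (.inl 0))))))
  | 13 => .inr (.inr (.inr (.inl (1, 0))))
  | 14 => .inr (.inr (.inr (.inr (.inr (.inr (.inl 1))))))
  | 15 => .inr (.inr (.inr (.inl (1, 1))))
  | n + 16 => if h : n / 3 < m then
      if n % 3 = 0 then .inr (.inr (.inl (⟨n / 3, h⟩ : Fin m).succ.succ))
      else if n % 3 = 1 then .inr (.inr (.inr (.inl ((⟨n / 3, h⟩ : Fin m).succ.succ, 0))))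
      else .inr (.inr (.inr (.inl ((⟨n / 3, h⟩ : Fin m).succ.succ, 1))))
    -- A filler: the formulas use no index beyond 3m + 15 = 3n + 9.
    else .inl 0

lemma indexA_even (j : Fin m) : indexA (2 * (j : ℕ) + 10) = .inr (.inr (.inl j.succ.succ)) := by
  simp [indexA]

lemma indexA_odd (j : Fin m) :
    indexA (2 * (j : ℕ) + 11) = .inr (.inr (.inr (.inl (j.succ.succ, 0)))) := by
  have h : (2 * (j : ℕ) + 1) / 2 = j := by omega
  simp [indexA, h]

lemma indexB_even (j : Fin m) : indexB (2 * (j : ℕ) + 10) = .inr (.inr (.inl j.succ.succ)) :=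
  indexA_even j

lemma indexB_odd (j : Fin m) :
    indexB (2 * (j : ℕ) + 11) = .inr (.inr (.inr (.inl (j.succ.succ, 0)))) :=
  indexA_odd j

lemma indexD_zero (j : Fin m) : indexD (3 * (j : ℕ) + 16) = .inr (.inr (.inl j.succ.succ)) := by
  simp [indexD]

lemma indexD_one (j : Fin m) :
    indexD (3 * (j : ℕ) + 17) = .inr (.inr (.inr (.inl (j.succ.succ, 0)))) := by
  have h : (3 * (j : ℕ) + 1) / 3 = j := by omega
  have h' : (3 * (j : ℕ) + 1) % 3 = 1 := by omega
  simp [indexD, h, h']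

lemma indexD_two (j : Fin m) :
    indexD (3 * (j : ℕ) + 18) = .inr (.inr (.inr (.inl (j.succ.succ, 1)))) := by
  have h : (3 * (j : ℕ) + 2) / 3 = j := by omega
  have h' : (3 * (j : ℕ) + 2) % 3 = 2 := by omega
  simp [indexD, h, h']

lemma succ_succ_ne_one (j : Fin m) : j.succ.succ ≠ (1 : Fin (m + 2)) := fun h => by
  simpa using congrArg Fin.val h

lemma isNormalForm_A {f : GenIndex m 1 1 → (Fin (m + 4) → ℝ) → ℝ}
    (hf : ∀ i, ContDiff ℝ (⊤ : ℕ∞) (f i)) :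
    IsNormalForm ω n₁ n₂ NFType.A fun p => linearPart ω p
      + ∑ i, f i (nfVars (fun p => p.1) (fun p => (resMon n₁ n₂ p.2.2).re) p)
        • gen n₁ n₂ ![fun _ => 1] ![fun _ => 1] i p := by
  refine ⟨fun n => f (indexA n), fun n => hf _, funext fun p => ?_⟩
  rw [sum_gen]
  refine Prod.ext ?_ (Prod.ext ?_ (funext fun j => Fin.cases ?_ (fun j => Fin.cases ?_
    (fun j => ?_) j) j))
  · simp [normalFormA, linearPart, indexA, nfVars]; ring
  · simp [normalFormA, linearPart, indexA, nfVars]; ring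
  · simp [normalFormA, linearPart, indexA, nfVars]; ring
  · simp [normalFormA, linearPart, indexA, nfVars]; ring
  · simp [normalFormA, linearPart, indexA_even, indexA_odd, nfVars,
      succ_succ_ne_one]; ring

lemma isNormalForm_B {f : GenIndex m 1 1 → (Fin (m + 4) → ℝ) → ℝ}
    (hf : ∀ i, ContDiff ℝ (⊤ : ℕ∞) (f i)) :
    IsNormalForm ω n₁ n₂ NFType.B fun p => linearPart ω p
      + ∑ i, f i (nfVars (fun p => p.1) (fun p => (resMon n₁ n₂ p.2.2).re ^ 2) p)
        • gen n₁ n₂ ![fun p => (resMon n₁ n₂ p.2.2).re] ![fun _ => 1] i p := by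
  refine ⟨fun n => f (indexB n), fun n => hf _, funext fun p => ?_⟩
  rw [sum_gen]
  refine Prod.ext ?_ (Prod.ext ?_ (funext fun j => Fin.cases ?_ (fun j => Fin.cases ?_
    (fun j => ?_) j) j))
  · simp [normalFormB, linearPart, indexB, indexA, nfVars]; ring
  · simp [normalFormB, linearPart, indexB, indexA, nfVars]; ring
  · simp [normalFormB, linearPart, indexB, indexA, nfVars]; ring
  · simp [normalFormB, linearPart, indexB, indexA, nfVars]; ring
  · simp [normalFormB, linearPart, indexB_even, indexB_odd, nfVars,
      succ_succ_ne_one]; ring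

lemma isNormalForm_C {f : GenIndex m 1 1 → (Fin (m + 4) → ℝ) → ℝ}
    (hf : ∀ i, ContDiff ℝ (⊤ : ℕ∞) (f i)) :
    IsNormalForm ω n₁ n₂ NFType.C fun p => linearPart ω p
      + ∑ i, f i (nfVars (fun p => p.1 ^ 2) (fun p => (resMon n₁ n₂ p.2.2).re) p)
        • gen n₁ n₂ ![fun _ => 1] ![fun p => p.1] i p := by
  refine ⟨fun n => f (indexA n), fun n => hf _, funext fun p => ?_⟩
  rw [sum_gen]
  refine Prod.ext ?_ (Prod.ext ?_ (funext fun j => Fin.cases ?_ (fun j => Fin.cases ?_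
    (fun j => ?_) j) j))
  · simp [normalFormC, linearPart, indexA, nfVars]; ring
  · simp [normalFormC, linearPart, indexA, nfVars]; ring
  · simp [normalFormC, linearPart, indexA, nfVars]; ring
  · simp [normalFormC, linearPart, indexA, nfVars]; ring
  · simp [normalFormC, linearPart, indexA_even, indexA_odd, nfVars,
      succ_succ_ne_one]; ring

lemma isNormalForm_D {f : GenIndex m 2 2 → (Fin (m + 5) → ℝ) → ℝ}
    (hf : ∀ i, ContDiff ℝ (⊤ : ℕ∞) (f i)) :
    IsNormalForm ω n₁ n₂ NFType.D fun p => linearPart ω p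
      + ∑ i, f i (nfVarsD n₁ n₂ p)
        • gen n₁ n₂ ![fun p => p.1, fun p => (resMon n₁ n₂ p.2.2).re]
           ![fun p => p.1, fun p => (resMon n₁ n₂ p.2.2).re] i p := by
  refine ⟨fun n => f (indexD n), fun n => hf _, funext fun p => ?_⟩
  rw [sum_gen]
  refine Prod.ext ?_ (Prod.ext ?_ (funext fun j => Fin.cases ?_ (fun j => Fin.cases ?_
    (fun j => ?_) j) j))
  · simp [normalFormD, linearPart, indexD, nfVarsD, Fin.sum_univ_two]; ring
  · simp [normalFormD, linearPart, indexD, nfVarsD, Fin.sum_univ_two]; ring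
  · simp [normalFormD, linearPart, indexD, nfVarsD, Fin.sum_univ_two]; ring
  · simp [normalFormD, linearPart, indexD, nfVarsD, Fin.sum_univ_two]; ring
  · simp [normalFormD, linearPart, indexD_zero, indexD_one, indexD_two, nfVarsD, Fin.sum_univ_two,
      succ_succ_ne_one]; ring

end Types

/-! ### Formal normal forms of bireversible vector fields -/

section NormalForm

lemma revPart_reversed {E : Type*} [NormedAddCommGroup E] [NormedSpace ℝ E] {ρ : E →L[ℝ] E}
    (hρ : ∀ p, ρ (ρ p) = p) (N : E → E) (p : E) : revPart ρ N (ρ p) = -ρ (revPart ρ N p) := by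
  simp only [revPart_apply, hρ, map_smul, map_sub]
  rw [← smul_neg, neg_sub]

lemma revPart_reversed_of_comm {E : Type*} [NormedAddCommGroup E] [NormedSpace ℝ E]
    {ρ τ : E →L[ℝ] E} (hc : ∀ p, ρ (τ p) = τ (ρ p)) {N : E → E}
    (hN : ∀ p, N (τ p) = -τ (N p)) (p : E) : revPart ρ N (τ p) = -τ (revPart ρ N p) := by
  simp only [revPart_apply, hc, hN, map_smul, map_sub, map_neg]
  module

variable {m n₁ n₂ : ℕ} {ω : Fin (m + 2) → ℝ} {a₀ : ℤˣ} {a : Fin (m + 2) → ℤˣ}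

lemma eq_fieldX_add_fieldH_add_fieldZ (f g : PhaseSpace m → ℝ)
    (q : Fin (m + 2) → PhaseSpace m → ℂ) :
    (fun p => ((p.1 * f p, p.2.1 * f p + g p, fun j => q j p) : PhaseSpace m))
      = fieldX f + fieldH g + ∑ j, fieldZ j (q j) := by
  ext p j
  · simp [fieldX_apply, fieldH_apply, fieldZ_apply, Prod.fst_sum]
  · simp [fieldX_apply, fieldH_apply, fieldZ_apply, Prod.fst_sum, Prod.snd_sum]
  · simp [fieldX_apply, fieldH_apply, fieldZ_apply, Prod.snd_sum, Finset.sum_apply,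
      Pi.single_apply]

/-- A solution of the homological equation is averaged first over φ and then over ψ. The two
involutions commute, so the second average preserves the symmetry obtained from the first. -/
lemma exists_bireversible_homological (hn₁ : 0 < n₁) (hn₂ : 0 < n₂) (hcop : Nat.Coprime n₁ n₂)
    (hres : (n₁ : ℝ) * ω 1 - (n₂ : ℝ) * ω 0 = 0)
    (hind : LinearIndependent ℚ (Matrix.vecCons (ω 0) (fun j : Fin m => ω j.succ.succ)))
    {N : Submodule ℝ (PhaseSpace m → PhaseSpace m)} (hN : Admissible n₁ n₂ a₀ (resSign n₁ n₂ a) N)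
    {L : PhaseSpace m →L[ℝ] PhaseSpace m} (hL : ∀ v, L v = linearPart ω v) {k : ℕ}
    {V : PhaseSpace m → PhaseSpace m} (hV : IsHomog (k + 1) V)
    (hV1 : ∀ p, V (psiL 1 1 p) = -psiL 1 1 (V p)) (hV2 : ∀ p, V (psiL a₀ a p) = -psiL a₀ a (V p)) :
    ∃ h Y : PhaseSpace m → PhaseSpace m, IsHomog (k + 1) h ∧
      ((∀ p, h (psiL 1 1 p) = psiL 1 1 (h p)) ∧ ∀ p, h (psiL a₀ a p) = psiL a₀ a (h p)) ∧
      IsHomog (k + 1) Y ∧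
      ((∀ p, Y (psiL 1 1 p) = -psiL 1 1 (Y p)) ∧ ∀ p, Y (psiL a₀ a p) = -psiL a₀ a (Y p)) ∧
      Y ∈ N ∧ ∀ y, V y = fderiv ℝ h y (L y) - L (h y) + Y y := by
  obtain ⟨h, hh, g, hg, e, he, q, hq, heq⟩ := exists_homological (ω := ω) hV
  have hinv : ∀ (b₀ : ℤˣ) (b : Fin (m + 2) → ℤˣ) p, psiL b₀ b (psiL b₀ b p) = p :=
    fun b₀ b p => psi_psi b₀ b p
  have hcomm : ∀ p, psiL a₀ a (psiL 1 1 p) = psiL 1 1 (psiL a₀ a p) := psi_psi_comm a₀ 1 a 1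
  have hLρ : ∀ (b₀ : ℤˣ) (b : Fin (m + 2) → ℤˣ) p, L (psiL b₀ b p) = -psiL b₀ b (L p) := by
    intro b₀ b p
    rw [hL, hL, psiL_apply, psiL_apply, linearPart_psi]
  simp only [← hL] at heq
  have h1 := homological_average (hinv 1 1) (hLρ 1 1) L.map_add L.map_smul
    (hh.1.differentiable (by simp)) hV1 heq
  have hh1 := hh.eqvPart (psiL 1 1)
  have h2 := homological_average (hinv a₀ a) (hLρ a₀ a) L.map_add L.map_smul
    (hh1.1.differentiable (by simp)) hV2 h1
  have hh2 := hh1.eqvPart (psiL a₀ a)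
  have hLh : IsHomog 1 L := ⟨L.contDiff, fun t y => by rw [pow_one, map_smul]⟩
  refine ⟨_, _, hh2, ⟨eqvPart_equivariant_of_comm hcomm (eqvPart_equivariant (hinv 1 1) h),
    eqvPart_equivariant (hinv a₀ a) _⟩, ?_, ⟨revPart_reversed_of_comm hcomm
      (revPart_reversed (hinv 1 1) _), revPart_reversed (hinv a₀ a) _⟩, ?_, h2⟩
  -- Homogeneity of the averaged remainder is read off from the equation itself, as the difference
  -- of V and the homological term.
  · have h3 := hV.sub ((hh2.fderiv_apply hLh rfl).sub (hh2.clm_comp L))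
    convert h3 using 1
    ext1 y
    rw [h2 y, add_sub_cancel_left]
  · change birevPart a₀ a _ ∈ N
    rw [eq_fieldX_add_fieldH_add_fieldZ, map_add, map_add, map_sum]
    exact N.add_mem (N.add_mem (birevPart_fieldX_mem hn₁ hn₂ hcop hres hind hN hg)
      (birevPart_fieldH_mem hn₁ hn₂ hcop hres hind hN he))
      (N.sum_mem fun j _ => birevPart_fieldZ_mem_of_resSpan hn₁ hn₂ hcop hres hind hN j (hq j))

/-- The formal normal form has its degree k parts in the module of generators, which is exactly the
input of `exists_realization`. The resulting smooth field then has the prescribed Taylor parts. -/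
theorem exists_formallyConjugate (hn₁ : 0 < n₁) (hn₂ : 0 < n₂) (hcop : Nat.Coprime n₁ n₂)
    (hres : (n₁ : ℝ) * ω 1 - (n₂ : ℝ) * ω 0 = 0)
    (hind : LinearIndependent ℚ (Matrix.vecCons (ω 0) (fun j : Fin m => ω j.succ.succ)))
    {X : PhaseSpace m → PhaseSpace m} (hX : ContDiff ℝ (⊤ : ℕ∞) X) (hX0 : X 0 = 0)
    (hL : ∀ v, fderiv ℝ X 0 v = linearPart ω v) (hphi : ∀ p, X (phi p) = -phi (X p))
    (hpsi : ∀ p, X (psi a₀ a p) = -psi a₀ a (X p)) {M b c : ℕ} {v : PhaseSpace m → Fin M → ℝ}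
    {u : Fin b → PhaseSpace m → ℝ} {w : Fin c → PhaseSpace m → ℝ}
    (hG : Generates n₁ n₂ a₀ (resSign n₁ n₂ a) v u w)
    (hv : ∀ l, ∃ d ≥ 1, IsHomog d fun p => v p l)
    (hu : ∀ i, ∃ d, IsHomog d (u i)) (hw : ∀ i, ∃ d, IsHomog d (w i)) :
    ∃ f : GenIndex m b c → (Fin M → ℝ) → ℝ, (∀ i, ContDiff ℝ (⊤ : ℕ∞) (f i)) ∧
      FormallyConjugate X fun p => linearPart ω p + ∑ i, f i (v p) • gen n₁ n₂ u w i p := by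
  obtain ⟨N, hN, hconj⟩ := exists_formal_normal_form hX hX0 ![psiL 1 1, psiL a₀ a]
    (by
      rw [Fin.forall_fin_two]
      exact ⟨fun p => by simpa [phi_eq_psi] using hphi p, hpsi⟩)
    (fun _ => polyCombination v (gen n₁ n₂ u w))
    (by
      intro k hk V hV hVρ
      obtain ⟨k, rfl⟩ : ∃ l, k = l + 1 := ⟨k - 1, by omega⟩
      rw [Fin.forall_fin_two] at hVρ
      simp only [Fin.forall_fin_two]
      exact exists_bireversible_homological hn₁ hn₂ hcop hres hind hG.admissible hL hV hVρ.1 hVρ.2)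
  choose wt hwt hv using hv
  choose d hd using exists_isHomog_gen (n₁ := n₁) (n₂ := n₂) hu hw
  obtain ⟨f, hf, hfN⟩ := exists_realization hd hv hwt hN
  refine ⟨f, hf, ?_⟩
  set L := fderiv ℝ X 0
  have hLh : IsHomog 1 L := ⟨L.contDiff, fun t y => by rw [pow_one, map_smul]⟩
  have hsum : ContDiff ℝ (⊤ : ℕ∞) fun p => ∑ i, f i (v p) • gen n₁ n₂ u w i p :=
    ContDiff.sum fun i _ => ((hf i).comp (contDiff_pi.2 fun l => (hv l).1)).smul (hd i).1
  -- Degree 1 comes from the linear part alone, because the realization has no Taylor parts below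
  -- degree 2.
  have hY : ∀ k y, diagTaylor k (fun p => linearPart ω p + ∑ i, f i (v p) • gen n₁ n₂ u w i p) y
      = (if k = 1 then L y else 0) + if 2 ≤ k then N k y else 0 := by
    intro k y
    simp only [← hL]
    rw [diagTaylor_add L.contDiff hsum, hLh.diagTaylor_eq, hfN]
  refine hconj _ ?_ (fun y => ?_) fun k hk => funext fun y => ?_
  · exact (diagTaylor_zero _ 0).symm.trans ((hY 0 0).trans (by simp))
  · exact (diagTaylor_one _ y).symm.trans ((hY 1 y).trans (by simp))
  · rw [hY, if_neg (by omega), if_pos hk, zero_add]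

/-- The parity conditions of the table say precisely that the resonant monomial has sign +1. -/
lemma tableType_eq : tableType a₀ (a 0) (a 1) n₁ n₂ =
    if a₀ = 1 then (if resSign n₁ n₂ a = 1 then NFType.A else NFType.B)
    else if resSign n₁ n₂ a = 1 then NFType.C else NFType.D := by
  have h : (-1 : ℤˣ) ≠ 1 := by decide
  unfold tableType resSign
  rcases Int.units_eq_one_or (a 0) with h0 | h0 <;> rcases Int.units_eq_one_or (a 1) with h1 | h1
  · simp [h0, h1]
  · simp [h0, h1, h, neg_one_pow_units_eq_one_iff]
  · simp [h0, h1, h, neg_one_pow_units_eq_one_iff]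
  · simp [h0, h1, h, ← pow_add, neg_one_pow_units_eq_one_iff, add_comm n₂]

end NormalForm

end Bireversible

end

/-! ### The main theorem -/

theorem mainTheorem2 {m : ℕ} (hn : 3 < m + 2)
    (ω : Fin (m + 2) → ℝ) (hω : ∀ j, ω j ≠ 0)
    (n₁ n₂ : ℕ) (hn₁ : 0 < n₁) (hn₂ : 0 < n₂) (hcop : Nat.Coprime n₁ n₂)
    (hres : (n₁ : ℝ) * ω 1 - (n₂ : ℝ) * ω 0 = 0)
    (hind : LinearIndependent ℚ
      (Matrix.vecCons (ω 0) (fun j : Fin m => ω j.succ.succ)))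
    (a₀ : ℤˣ) (a : Fin (m + 2) → ℤˣ)
    (X : Bireversible.PhaseSpace m → Bireversible.PhaseSpace m)
    (hX : ContDiff ℝ (⊤ : ℕ∞) X) (hX0 : X 0 = 0)
    (hL : ∀ v, fderiv ℝ X 0 v = Bireversible.linearPart ω v)
    (hphi : ∀ p, X (Bireversible.phi p) = -Bireversible.phi (X p))
    (hpsi : ∀ p, X (Bireversible.psi a₀ a p) = -Bireversible.psi a₀ a (X p)) :
    ∃ Y : Bireversible.PhaseSpace m → Bireversible.PhaseSpace m,
      Bireversible.IsNormalForm ω n₁ n₂ (Bireversible.tableType a₀ (a 0) (a 1) n₁ n₂) Y ∧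
      Bireversible.FormallyConjugate X Y := by
  open Bireversible in
  have key {M b c : ℕ} {v : PhaseSpace m → Fin M → ℝ} {u : Fin b → PhaseSpace m → ℝ}
      {w : Fin c → PhaseSpace m → ℝ} (hG : Generates n₁ n₂ a₀ (resSign n₁ n₂ a) v u w) :=
    exists_formallyConjugate hn₁ hn₂ hcop hres hind hX hX0 hL hphi hpsi hG
  have h1 : ∃ d, Bireversible.IsHomog d fun _ : Bireversible.PhaseSpace m => (1 : ℝ) :=
    ⟨0, Bireversible.isHomog_const 1⟩
  have hx : Bireversible.IsHomog 1 fun p : Bireversible.PhaseSpace m => p.1 :=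
    Bireversible.isHomog_fst
  have hR := Bireversible.isHomog_re (m := m) (n₁ := n₁) (n₂ := n₂)
  have h2 : (2 : ℕ) * (n₂ + n₁) ≥ 1 := by omega
  have h3 : n₂ + n₁ ≥ 1 := by omega
  rw [Bireversible.tableType_eq]
  -- The pairs (a₀, sign of w) equal to (1, 1), (1, −1), (−1, 1), (−1, −1) give types A, B, C and D
  -- in this order.
  rcases Int.units_eq_one_or a₀ with rfl | rfl <;>
    rcases Int.units_eq_one_or (Bireversible.resSign n₁ n₂ a) with hs | hs <;> rw [hs] at key
  · rw [if_pos rfl, if_pos hs]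
    obtain ⟨f, hf, hc⟩ := key Bireversible.generates_A
      (Bireversible.exists_isHomog_nfVars ⟨_, le_rfl, hx⟩ ⟨_, h3, hR⟩)
      (Fin.forall_fin_one.2 h1) (Fin.forall_fin_one.2 h1)
    exact ⟨_, Bireversible.isNormalForm_A hf, hc⟩
  · rw [if_pos rfl, if_neg (by rw [hs]; decide)]
    obtain ⟨f, hf, hc⟩ := key Bireversible.generates_B
      (Bireversible.exists_isHomog_nfVars ⟨_, le_rfl, hx⟩ ⟨_, h2, hR.pow 2⟩)
      (Fin.forall_fin_one.2 ⟨_, hR⟩) (Fin.forall_fin_one.2 h1)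
    exact ⟨_, Bireversible.isNormalForm_B hf, hc⟩
  · rw [if_neg (by decide), if_pos hs]
    obtain ⟨f, hf, hc⟩ := key Bireversible.generates_C
      (Bireversible.exists_isHomog_nfVars ⟨_, by norm_num, hx.pow 2⟩ ⟨_, h3, hR⟩)
      (Fin.forall_fin_one.2 h1) (Fin.forall_fin_one.2 ⟨_, hx⟩)
    exact ⟨_, Bireversible.isNormalForm_C hf, hc⟩
  · rw [if_neg (by decide), if_neg (by rw [hs]; decide)]
    obtain ⟨f, hf, hc⟩ := key Bireversible.generates_D
      (Bireversible.exists_isHomog_nfVarsD hn₁)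
      (Fin.forall_fin_two.2 ⟨⟨_, hx⟩, _, hR⟩) (Fin.forall_fin_two.2 ⟨⟨_, hx⟩, _, hR⟩)
    exact ⟨_, Bireversible.isNormalForm_D hf, hc⟩
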